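/- \textbf{Conventions.} Let $\mathbb{F}$ be a finite field with $p$ elements, represented by the numbers $0,\dots,p-1$ through a fixed bijection. Algorithms are randomized RAM programs with logarithmic cost; an algorithm runs in time $T(n)$ if on every input of dimension $n$ and for every outcome of its random choices it halts within $T(n)$ steps, where reading the input and writing the output are counted. $f=\tilde O(g)$ means that there are constants $C,k$ with $f(n)\le C\,g(n)(\log n)^k$ for all sufficiently large $n$. Let $q_p := 1-\inf_{n} |GL_n(\mathbb{F})|/|\mathbb{F}^{n\times n}|$. A \emph{trapdoored matrix family} over $\mathbb{F}$ is a sequence of distributions $\mathcal{D}_n$ over pairs $(R,C)$, with $R\in\mathbb{F}^{n\times n}$ and $C$ an arithmetic circuit over $\mathbb{F}$, such that: (i) there is one algorithm that on input $n$ samples from $\mathcal{D}_n$ in time $\tilde O(n^2)$; (ii) for every pair $(R,C)$ in the support of $\mathcal{D}_n$, $C(v)=Rv$ for all $v\in\mathbb{F}^n$; (iii) all circuits in the support of $\mathcal{D}_n$ have size at most $s(n)$, for some $s(n)=\tilde O(n)$; (iv) for every polynomial-time algorithm $\mathcal{A}$, which may be given an advice string of polynomial length that depends only on $n$, the quantity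 $\left|\Pr_{R\sim\mathbb{F}^{n\times n}}[\mathcal{A}(R)=1]-\Pr_{(R,C)\sim\mathcal{D}_n}[\mathcal{A}(R)=1]\right|$ vanishes faster than any inverse polynomial in $n$. \textbf{Theorem.} Assume that a trapdoored matrix family over $\mathbb{F}$ exists. Let $\mathcal{M}$ be a (possibly randomized) algorithm that on input $A\in\mathbb{F}^{n\times n}$ runs in time $T(n)$. Suppose that one of the following holds for all sufficiently large $n$, where the probability is over a uniformly random $A\in\mathbb{F}^{n\times n}$ and the random choices of $\mathcal{M}$: (a) $\Pr[\mathcal{M}(A)=\det(A)]\ge 0.99$; (b) $p>2$ and $\Pr[\mathcal{M}(A)=\det(A)]\ge \frac{3+2q_p}{4}+\varepsilon$, for some fixed $\varepsilon>0$; (c) $p=2$ and $\Pr[\mathcal{M}(A)=\det(A)]\ge \frac{2+q_2}{3}+\varepsilon$, for some fixed $\varepsilon>0$. Then $\det(A)$ can be computed for \emph{every} matrix with high probability in time $\tilde O(T(n))$: for every $c\in\mathbb{N}$ there is an algorithm running in time $\tilde O(T(n))$ which, for every $n\ge 1$ and every $A\in\mathbb{F}^{n\times n}$, outputs $\det(A)$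 with probability at least $1-n^{-c}$. -/

import Mathlib

open Filter

noncomputable section

namespace DetRed

/-! ### The machine model: randomized RAM programs with logarithmic cost

A program has finitely many memory banks, each an array of natural numbers indexed by `ℕ` and
accessed by computed index. -/

/-- The contents of the memory: `σ x i` is the number in cell `i` of bank `x`. -/
abbrev State := ℕ → ℕ → ℕ

/-- The arithmetic operations (`sub` is truncated subtraction). -/
inductive Op
  | add | sub | mul | div | mod

def Op.eval : Op → ℕ → ℕ → ℕ
  | .add, a, b => a + b
  | .sub, a, b => a - b
  | .mul, a, b => a * b
  | .div, a, b => a / b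
  | .mod, a, b => a % b

/-- Expressions: constants, reading a cell with a computed index, arithmetic. -/
inductive Expr
  | const (k : ℕ)
  | get (x : ℕ) (i : Expr)
  | op (o : Op) (a b : Expr)

def Expr.val (σ : State) : Expr → ℕ
  | .const k => k
  | .get x i => σ x (i.val σ)
  | .op o a b => o.eval (a.val σ) (b.val σ)

/-- Logarithmic cost: every node is charged one unit plus the bit length of its value. -/
def Expr.cost (σ : State) : Expr → ℕ
  | .const k => 1 + k.size
  | .get x i => 1 + (σ x (i.val σ)).size + i.cost σ
  | .op o a b => 1 + (o.eval (a.val σ) (b.val σ)).size + a.cost σ + b.cost σ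

/-- Programs.
* `set x i e` writes the value of `e` into cell `i` of bank `x`;
* `rand x i e` writes there a fresh uniformly random element of `{0, …, e}`;
* `cond e c d` runs `c` if `e ≠ 0` and `d` otherwise; `loop e c` repeats `c` while `e ≠ 0`;
* `call c src dst b` calls `c` as a subroutine with its own, initially empty memory, passes to it
  the array in bank `src`, and writes the returned array into bank `dst`.  The subroutine is
  interrupted, without any effect, if it needs more than `b` units of time. -/
inductive Cmd
  | skip
  | set (x : ℕ) (i e : Expr)
  | rand (x : ℕ) (i e : Expr)
  | seq (c d : Cmd)
  | cond (e : Expr) (c d : Cmd)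
  | loop (e : Expr) (c : Cmd)
  | call (c : Cmd) (src dst : ℕ) (b : Expr)

/-- Write `v` into cell `i` of bank `x`. -/
def State.write (σ : State) (x i v : ℕ) : State :=
  fun y j => if y = x ∧ j = i then v else σ y j

/-- The array held in bank `x`: cell `0` holds its length, the following cells its entries. -/
def State.read (σ : State) (x : ℕ) : List ℕ :=
  (List.range (σ x 0)).map fun i => σ x (i + 1)

/-- Write the array `l`, preceded by its length, into the first cells of bank `x`. -/
def State.store (σ : State) (x : ℕ) (l : List ℕ) : State :=
  fun y j => if y = x ∧ j ≤ l.length then (l.length :: l).getD j 0 else σ y j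

/-- The initial memory on input `l`: the array `l` in bank `0`, zeros elsewhere. -/
def State.init (l : List ℕ) : State :=
  State.store (fun _ _ => 0) 0 l

/-- The cost of reading in or writing out an array. -/
def listCost (l : List ℕ) : ℕ := (l.map fun v => 1 + v.size).sum

/-- The time of a whole run on input `l` whose execution cost is `s.2` and whose final memory is
`s.1`: reading the input, executing, and writing out the output, which is left in bank `0`. -/
def totalTime (l : List ℕ) (s : State × ℕ) : ℕ :=
  listCost l + s.2 + listCost (s.1.read 0)

/-- Big-step semantics: `Runs c σ μ` says that `c`, started in the memory `σ`, halts for all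
outcomes of its random choices, and that `μ` is the joint distribution of the final memory and of
the execution cost. -/
inductive Runs : Cmd → State → PMF (State × ℕ) → Prop
  | skip (σ : State) : Runs .skip σ (PMF.pure (σ, 1))
  | set (x : ℕ) (i e : Expr) (σ : State) :
      Runs (.set x i e) σ
        (PMF.pure (σ.write x (i.val σ) (e.val σ), 1 + i.cost σ + e.cost σ))
  | rand (x : ℕ) (i e : Expr) (σ : State) :
      Runs (.rand x i e) σ
        ((PMF.uniformOfFintype (Fin (e.val σ + 1))).map fun v =>
          (σ.write x (i.val σ) (v : ℕ), 1 + i.cost σ + e.cost σ))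
  | seq (c d : Cmd) (σ : State) (μ : PMF (State × ℕ)) (ν : State → PMF (State × ℕ)) :
      Runs c σ μ → (∀ s ∈ μ.support, Runs d s.1 (ν s.1)) →
      Runs (.seq c d) σ (μ.bind fun s => (ν s.1).map fun s' => (s'.1, s.2 + s'.2))
  | cond_pos (e : Expr) (c d : Cmd) (σ : State) (μ : PMF (State × ℕ)) :
      e.val σ ≠ 0 → Runs c σ μ →
      Runs (.cond e c d) σ (μ.map fun s => (s.1, 1 + e.cost σ + s.2))
  | cond_zero (e : Expr) (c d : Cmd) (σ : State) (μ : PMF (State × ℕ)) :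
      e.val σ = 0 → Runs d σ μ →
      Runs (.cond e c d) σ (μ.map fun s => (s.1, 1 + e.cost σ + s.2))
  | loop_zero (e : Expr) (c : Cmd) (σ : State) :
      e.val σ = 0 → Runs (.loop e c) σ (PMF.pure (σ, 1 + e.cost σ))
  | loop_pos (e : Expr) (c : Cmd) (σ : State) (μ : PMF (State × ℕ))
      (ν : State → PMF (State × ℕ)) :
      e.val σ ≠ 0 → Runs c σ μ → (∀ s ∈ μ.support, Runs (.loop e c) s.1 (ν s.1)) →
      Runs (.loop e c) σ
        (μ.bind fun s => (ν s.1).map fun s' => (s'.1, 1 + e.cost σ + s.2 + s'.2))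
  | call (c : Cmd) (src dst : ℕ) (b : Expr) (σ : State) (μ : PMF (State × ℕ)) :
      Runs c (State.init (σ.read src)) μ →
      Runs (.call c src dst b) σ (μ.map fun s =>
        (if totalTime (σ.read src) s ≤ b.val σ then σ.store dst (s.1.read 0) else σ,
          1 + b.cost σ + min (totalTime (σ.read src) s) (b.val σ)))

/-- On input `l` the program `P` always halts within time `t`, and `ρ` is the distribution of its
output. -/
def RunsOn (P : Cmd) (l : List ℕ) (t : ℕ) (ρ : PMF (List ℕ)) : Prop :=
  ∃ μ : PMF (State × ℕ), Runs P (State.init l) μ ∧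
    (∀ s ∈ μ.support, totalTime l s ≤ t) ∧ μ.map (fun s => s.1.read 0) = ρ

/-- `f = Õ(g)`: `f n ≤ C · g n · (log n) ^ k` for all large `n`, with constants `C`, `k`. -/
def SoftO (f g : ℕ → ℕ) : Prop :=
  ∃ C k : ℕ, ∀ᶠ n in atTop, f n ≤ C * g n * Nat.log 2 n ^ k

/-! ### Arithmetic circuits -/

/-- A gate is a constant or adds or multiplies the values of two wires. -/
inductive Gate (F : Type*)
  | const (a : F)
  | add (i j : ℕ)
  | mul (i j : ℕ)

/-- An arithmetic circuit: the wires are the inputs followed by the outputs of the gates, in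
order; `outs` lists the wires that carry the output. -/
structure Circuit (F : Type*) where
  gates : List (Gate F)
  outs : List ℕ

variable {F : Type*} [Field F]

/-- The value of a gate when the values of the preceding wires are `w`. -/
def Gate.eval (w : List F) : Gate F → F
  | .const a => a
  | .add i j => w.getD i 0 + w.getD j 0
  | .mul i j => w.getD i 0 * w.getD j 0

/-- The gate only uses wires with index less than `k`. -/
def Gate.UsesBelow (k : ℕ) : Gate F → Prop
  | .const _ => True
  | .add i j => i < k ∧ j < k
  | .mul i j => i < k ∧ j < k

/-- The size of a circuit is its number of gates. -/
def Circuit.size (C : Circuit F) : ℕ := C.gates.length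

/-- Every gate uses only earlier wires, and every output wire exists (`m` inputs). -/
def Circuit.WellFormed (C : Circuit F) (m : ℕ) : Prop :=
  (∀ (t : ℕ) (g : Gate F), C.gates[t]? = some g → g.UsesBelow (m + t)) ∧
    ∀ i ∈ C.outs, i < m + C.gates.length

/-- The output of the circuit on the input vector `v`. -/
def Circuit.eval (C : Circuit F) (v : List F) : List F :=
  let w := C.gates.foldl (fun w g => w ++ [g.eval w]) v
  C.outs.map fun i => w.getD i 0

/-- `C` computes the linear map `v ↦ M v`. -/
def Circuit.Computes {n : ℕ} (C : Circuit F) (M : Matrix (Fin n) (Fin n) F) : Prop :=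
  C.WellFormed n ∧ ∀ v : Fin n → F, C.eval (List.ofFn v) = List.ofFn (M.mulVec v)

/-! ### Encodings; `enc` numbers the elements of the field -/

variable [Fintype F] (enc : F ≃ Fin (Fintype.card F))

/-- The code of a square matrix: its dimension, then its entries row by row. -/
def encMat {n : ℕ} (A : Matrix (Fin n) (Fin n) F) : List ℕ :=
  n :: (List.ofFn fun i : Fin n => List.ofFn fun j : Fin n => (enc (A i j) : ℕ)).flatten

def encGate : Gate F → List ℕ
  | .const a => [0, (enc a : ℕ), 0]
  | .add i j => [1, i, j]
  | .mul i j => [2, i, j]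

def encCircuit (C : Circuit F) : List ℕ :=
  C.gates.length :: (C.gates.map (encGate enc)).flatten ++ C.outs

/-! ### Trapdoored matrices -/

/-- The matrix drawn from `D n` is computationally indistinguishable from a uniformly random one:
the advantage of every polynomial-time algorithm, possibly with a (polynomially long) advice string
`aux n` that depends on the dimension only, is a negligible function of the dimension. -/
def Indistinguishable (D : ∀ n : ℕ, PMF (Matrix (Fin n) (Fin n) F × Circuit F)) : Prop :=
  ∀ (P : Cmd) (aux : ℕ → List ℕ) (k : ℕ)
    (ρ : ∀ n : ℕ, Matrix (Fin n) (Fin n) F → PMF (List ℕ)),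
    (∀ (n : ℕ) (M : Matrix (Fin n) (Fin n) F),
      RunsOn P (encMat enc M ++ aux n) (n ^ k + k) (ρ n M)) →
    Asymptotics.SuperpolynomialDecay atTop (fun n : ℕ => (n : ℝ)) fun n : ℕ =>
      |(((PMF.uniformOfFintype (Matrix (Fin n) (Fin n) F)).bind (ρ n)) [1]).toReal -
        (((D n).bind fun x => ρ n x.1) [1]).toReal|

/-- `D` is a trapdoored matrix family over `F`: it can be sampled by an algorithm in time
near-linear in the size `n ^ 2` of the matrix, the trapdoor is a circuit of near-linear size for
multiplication by the matrix, and the matrix is indistinguishable from uniform. -/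
structure IsTrapdooredFamily
    (D : ∀ n : ℕ, PMF (Matrix (Fin n) (Fin n) F × Circuit F)) : Prop where
  samplable : ∃ (S : Cmd) (t : ℕ → ℕ), SoftO t (fun n => n ^ 2) ∧
    ∀ n, RunsOn S [n] (t n) ((D n).map fun x => encMat enc x.1 ++ encCircuit enc x.2)
  correct : ∀ n, ∀ x ∈ (D n).support, x.2.Computes x.1
  efficient : ∃ s : ℕ → ℕ, SoftO s (fun n => n) ∧ ∀ n, ∀ x ∈ (D n).support, x.2.size ≤ s n
  indistinguishable : Indistinguishable enc D

/-! ### Average-case and worst-case computation of the determinant -/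

/-- `q = 1 - inf_n |GL_n(F)| / |F^{n × n}|`. -/
def qSing (F : Type*) [Field F] : ℝ :=
  1 - ⨅ n : ℕ, (Nat.card (Matrix.GeneralLinearGroup (Fin n) F) : ℝ) /
    (Nat.card (Matrix (Fin n) (Fin n) F) : ℝ)

/-- The probability that the output distribution `ρ` gives to the determinant of `A`. -/
def detProb {n : ℕ} (A : Matrix (Fin n) (Fin n) F) (ρ : PMF (List ℕ)) : ℝ :=
  (ρ [(enc A.det : ℕ)]).toReal

/-- The probability, over a uniformly random `n × n` matrix `A` and the random choices of the
algorithm with output distributions `ρ n A`, that the output is the determinant of `A`. -/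
def avgDetProb (ρ : ∀ n : ℕ, Matrix (Fin n) (Fin n) F → PMF (List ℕ)) (n : ℕ) : ℝ :=
  (∑ A : Matrix (Fin n) (Fin n) F, detProb enc A (ρ n A)) /
    (Fintype.card (Matrix (Fin n) (Fin n) F) : ℝ)

/-- The determinant of every matrix can be computed with high probability in time `Õ(T(n))`: for
every exponent `c` there is such an algorithm with error probability at most `n ^ (-c)`. -/
def WorstCaseDet (T : ℕ → ℕ) : Prop :=
  ∀ c : ℕ, ∃ (P : Cmd) (T' : ℕ → ℕ) (ρ : ∀ n : ℕ, Matrix (Fin n) (Fin n) F → PMF (List ℕ)),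
    SoftO T' T ∧
    (∀ (n : ℕ) (A : Matrix (Fin n) (Fin n) F), RunsOn P (encMat enc A) (T' n) (ρ n A)) ∧
    ∀ n : ℕ, 1 ≤ n → ∀ A : Matrix (Fin n) (Fin n) F,
      1 - 1 / (n : ℝ) ^ c ≤ detProb enc A (ρ n A)

end DetRed

end

noncomputable section
set_option linter.unusedSectionVars false
namespace DetRed

section

/-! ### Determinism of the semantics and couplings -/

/-! Since det(RA) = det(A) det(R), the determinant of A can be read off from det(R) and det(RA) for
any invertible R. If A is invertible and R is uniform, then R and RA are both uniform, so an
algorithm with average error e is right on both with probability at least 1 - 2e. The obstacle is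
the cost of forming RA. A trapdoored R comes with a circuit of size Õ(n); applied to the n columns
of A it yields RA in time Õ(n²), which is Õ(T(n)) because reading the input alone takes more than n²
steps.

One trial gives the answers x on R and y on RA, and supports d if y = d x. After O(log n)
independent trials the output is a nonzero d supported in at least a fraction θ of them, or 0 if
there is none. For uniform R, and with q bounding the fraction of singular matrices, the probability
of supporting d ≠ 0 is at least 1 - 2e if d = det A (`ratioProb_det`); at most q + 2e if det A ≠ 0
and d ≠ det A, since R must be singular or an answer wrong (`ratioProb_ne`); at most q + e if det A
= 0 (`ratioProb_singular`). In the last case RA is not uniform and nothing is known about the answer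
on it. But if u ≠ 0 and uA = 0, then R and R + y uᵀ have the same product with A for all y, while
det(R + y uᵀ) is, as a function of y, either identically zero or a nonconstant affine function. So 0
is always a most frequent value, and no guess made from RA hits d det(R) more often than det(R) = 0
occurs (`card_det_translate_le`, `sum_guess_le`). Over the field with two elements the second case
is void. Any θ strictly between the bounds works, by a Chernoff bound (`exists_tail_rate`,
`exists_decision_bound`).

Uniform R are replaced by trapdoored ones through indistinguishability: whether a trial supports d
is a test on R, with the worst pair (A, d) for each n supplied as advice
(`eventually_ratioProb_close`). The test must run in polynomial time although T need not be
polynomial, so the given algorithm is first clocked: a run that exceeds a polynomial budget is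
replaced by Gaussian elimination (`exists_clocked`). This costs Õ(T(n)) and can only raise the
success probability. The finitely many n for which the asymptotic hypotheses fail are also left to
Gaussian elimination.

The machine-level argument rests on couplings: `PTri` couples the final memory with an abstract
random outcome, so that the probability theory is done on lists of pairs of field elements. Costs
are controlled by a common bound B on all memory cells: a fixed expression costs a constant times
the bit length of B. -/

theorem pmf_bind_congr {α β : Type*} (p : PMF α) {f g : α → PMF β}
    (h : ∀ a ∈ p.support, f a = g a) : p.bind f = p.bind g := by
  ext b
  simp only [PMF.bind_apply]
  refine tsum_congr fun a => ?_
  by_cases ha : p a = 0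
  · simp [ha]
  · rw [h a ((PMF.mem_support_iff _ _).2 ha)]

theorem pmf_map_congr {α β : Type*} (p : PMF α) {f g : α → β}
    (h : ∀ a ∈ p.support, f a = g a) : p.map f = p.map g :=
  pmf_bind_congr p fun a ha => by simp [h a ha]

/-- The memory decides which rule applies, so induction on one derivation forces the other.
Couplings need this: outcomes that end in the same memory must continue with the same distribution.
-/
theorem Runs.unique {c : Cmd} {σ : State} {μ μ' : PMF (State × ℕ)} (h : Runs c σ μ)
    (h' : Runs c σ μ') : μ = μ' := by
  induction h generalizing μ' with
  | skip σ => cases h'; rfl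
  | set x i e σ => cases h'; rfl
  | rand x i e σ => cases h'; rfl
  | seq c d σ μ ν _ _ ih1 ih2 =>
    cases h' with
    | seq _ _ _ μ2 ν2 h1 h2 =>
      obtain rfl := ih1 h1
      exact pmf_bind_congr _ fun s hs => by rw [ih2 s hs (h2 s hs)]
  | cond_pos e c d σ μ he _ ih =>
    cases h' with
    | cond_pos _ _ _ _ _ _ h1 => rw [ih h1]
    | cond_zero _ _ _ _ _ he' => exact absurd he' he
  | cond_zero e c d σ μ he _ ih =>
    cases h' with
    | cond_pos _ _ _ _ _ he' => exact absurd he he'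
    | cond_zero _ _ _ _ _ _ h1 => rw [ih h1]
  | loop_zero e c σ he =>
    cases h' with
    | loop_zero => rfl
    | loop_pos _ _ _ _ _ he' => exact absurd he he'
  | loop_pos e c σ μ ν he _ _ ih1 ih2 =>
    cases h' with
    | loop_zero _ _ _ he' => exact absurd he' he
    | loop_pos _ _ _ μ2 ν2 _ h1 h2 =>
      obtain rfl := ih1 h1
      exact pmf_bind_congr _ fun s hs => by rw [ih2 s hs (h2 s hs)]
  | call c src dst b σ μ _ ih =>
    cases h' with
    | call _ _ _ _ _ _ h1 => rw [ih h1]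

/-- Started in `σ`, the program `c` halts within time `t`, and its final memory can be coupled with
an outcome of distribution `ν` such that `Q` holds of the outcome and the memory. -/
def PTri {α : Type*} (c : Cmd) (σ : State) (t : ℕ) (ν : PMF α) (Q : α → State → Prop) : Prop :=
  ∃ π : PMF (α × State × ℕ), π.map Prod.fst = ν ∧ Runs c σ (π.map Prod.snd) ∧
    ∀ z ∈ π.support, Q z.1 z.2.1 ∧ z.2.2 ≤ t

/-- Started in `σ`, the program `c` always halts within time `t` in a memory satisfying `Q`. -/
def Tri (c : Cmd) (σ : State) (t : ℕ) (Q : State → Prop) : Prop :=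
  PTri c σ t (PMF.pure ()) fun _ => Q

/-! ### Rules for couplings: sequencing, branching, loops -/

section Rules

variable {α β : Type*} {c d : Cmd} {σ : State} {t t' : ℕ}

theorem PTri.mono_support {ν : PMF α} {Q Q' : α → State → Prop} (h : PTri c σ t ν Q) (ht : t ≤ t')
    (hQ : ∀ a ∈ ν.support, ∀ s, Q a s → Q' a s) : PTri c σ t' ν Q' := by
  obtain ⟨π, rfl, h2, h3⟩ := h
  refine ⟨π, rfl, h2, fun z hz => ⟨hQ _ ?_ _ (h3 z hz).1, (h3 z hz).2.trans ht⟩⟩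
  exact (PMF.mem_support_map_iff _ _ _).2 ⟨z, hz, rfl⟩

theorem PTri.mono {ν : PMF α} {Q Q' : α → State → Prop} (h : PTri c σ t ν Q) (ht : t ≤ t')
    (hQ : ∀ a s, Q a s → Q' a s) : PTri c σ t' ν Q' :=
  h.mono_support ht fun a _ => hQ a

theorem Tri.mono {Q Q' : State → Prop} (h : Tri c σ t Q) (ht : t ≤ t')
    (hQ : ∀ s, Q s → Q' s) : Tri c σ t' Q' :=
  PTri.mono h ht fun _ => hQ

theorem PTri.of_runs {μ : PMF (State × ℕ)} {f : State × ℕ → α} {Q : α → State → Prop}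
    (h : Runs c σ μ) (hQ : ∀ s ∈ μ.support, Q (f s) s.1 ∧ s.2 ≤ t) :
    PTri c σ t (μ.map f) Q := by
  refine ⟨μ.map fun s => (f s, s), ?_, ?_, ?_⟩
  · rw [PMF.map_comp]; rfl
  · rw [PMF.map_comp]
    have : (Prod.snd ∘ fun s : State × ℕ => (f s, s)) = id := rfl
    rwa [this, PMF.map_id]
  · intro z hz
    obtain ⟨s, hs, rfl⟩ := (PMF.mem_support_map_iff _ _ _).1 hz
    exact hQ s hs

theorem Tri.of_runs_pure {σ' : State} {Q : State → Prop} (h : Runs c σ (PMF.pure (σ', t)))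
    (ht : t ≤ t') (hQ : Q σ') : Tri c σ t' Q := by
  have := PTri.of_runs (α := Unit) (t := t') (f := fun _ => ()) (Q := fun _ => Q) h ?_
  · simpa [Tri, PMF.pure_map] using this
  · intro s hs
    rw [PMF.mem_support_pure_iff] at hs
    subst hs
    exact ⟨hQ, ht⟩

theorem PTri.pure_tri {a : α} {Q : α → State → Prop} (h : Tri c σ t (Q a)) :
    PTri c σ t (PMF.pure a) Q := by
  obtain ⟨π, h1, h2, h3⟩ := h
  refine ⟨π.map fun z => (a, z.2), ?_, ?_, ?_⟩
  · rw [PMF.map_comp]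
    exact PMF.map_const _ _
  · rw [PMF.map_comp]; exact h2
  · intro z hz
    obtain ⟨s, hs, rfl⟩ := (PMF.mem_support_map_iff _ _ _).1 hz
    exact h3 s hs

/-- The couplings for the second program are glued along that of the first. They may depend on the
abstract outcome and not only on the memory, whereas the semantics wants one distribution per
memory. -/
theorem PTri.seq {ν : PMF α} {κ : α → PMF β} {R : α → State → Prop} {Q : β → State → Prop}
    (h : PTri c σ t ν R) (h' : ∀ a ∈ ν.support, ∀ s, R a s → PTri d s t' (κ a) Q) :
    PTri (.seq c d) σ (t + t') (ν.bind κ) Q := by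
  obtain ⟨π, rfl, h2, h3⟩ := h
  have key : ∀ z : α × State × ℕ, ∃ π' : PMF (β × State × ℕ), z ∈ π.support →
      π'.map Prod.fst = κ z.1 ∧ Runs d z.2.1 (π'.map Prod.snd) ∧
      ∀ w ∈ π'.support, Q w.1 w.2.1 ∧ w.2.2 ≤ t' := by
    intro z
    by_cases hz : z ∈ π.support
    · obtain ⟨π', h⟩ := h' z.1 ((PMF.mem_support_map_iff _ _ _).2 ⟨z, hz, rfl⟩) z.2.1 (h3 z hz).1
      exact ⟨π', fun _ => h⟩
    · exact ⟨(κ z.1).map fun b => (b, z.2), fun h => absurd h hz⟩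
  choose π' hπ' using key
  classical
  -- The distribution of the second program as a function of the memory alone; by uniqueness it
  -- agrees with the marginal of every coupling that starts from this memory.
  let N : State → PMF (State × ℕ) := fun s =>
    if h : ∃ μ, Runs d s μ then h.choose else PMF.pure (s, 0)
  have hN : ∀ z ∈ π.support, N z.2.1 = (π' z).map Prod.snd := by
    intro z hz
    have hex : ∃ μ, Runs d z.2.1 μ := ⟨_, (hπ' z hz).2.1⟩
    simp only [N, dif_pos hex]
    exact hex.choose_spec.unique (hπ' z hz).2.1
  refine ⟨π.bind fun z => (π' z).map fun w => (w.1, (w.2.1, z.2.2 + w.2.2)), ?_, ?_, ?_⟩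
  · rw [PMF.map_bind, PMF.bind_map]
    refine pmf_bind_congr _ fun z hz => ?_
    rw [PMF.map_comp, Function.comp_apply, ← (hπ' z hz).1]
    rfl
  · have hr := Runs.seq c d σ _ N h2 ?_
    · convert hr using 1
      rw [PMF.map_bind, PMF.bind_map]
      refine pmf_bind_congr _ fun z hz => ?_
      rw [PMF.map_comp, Function.comp_apply, hN z hz, PMF.map_comp]
      rfl
    · intro s hs
      obtain ⟨z, hz, rfl⟩ := (PMF.mem_support_map_iff _ _ _).1 hs
      rw [hN z hz]
      exact (hπ' z hz).2.1
  · intro w hw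
    obtain ⟨z, hz, hw⟩ := (PMF.mem_support_bind_iff _ _ _).1 hw
    obtain ⟨v, hv, rfl⟩ := (PMF.mem_support_map_iff _ _ _).1 hw
    exact ⟨((hπ' z hz).2.2 v hv).1, add_le_add (h3 z hz).2 ((hπ' z hz).2.2 v hv).2⟩

theorem Tri.seq_ptri {ν : PMF β} {R : State → Prop} {Q : β → State → Prop}
    (h : Tri c σ t R) (h' : ∀ s, R s → PTri d s t' ν Q) :
    PTri (.seq c d) σ (t + t') ν Q := by
  have := PTri.seq (κ := fun _ => ν) h (fun _ _ => h')
  rwa [PMF.pure_bind] at this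

theorem Tri.seq {R Q : State → Prop} (h : Tri c σ t R) (h' : ∀ s, R s → Tri d s t' Q) :
    Tri (.seq c d) σ (t + t') Q :=
  Tri.seq_ptri h h'

theorem PTri.seq_tri {ν : PMF α} {R Q : α → State → Prop}
    (h : PTri c σ t ν R) (h' : ∀ a ∈ ν.support, ∀ s, R a s → Tri d s t' (Q a)) :
    PTri (.seq c d) σ (t + t') ν Q := by
  have := PTri.seq (κ := PMF.pure) h (fun a ha s hs => PTri.pure_tri (h' a ha s hs))
  rwa [PMF.bind_pure] at this

/-- Adding a constant to the cost. -/
theorem PTri.of_map_runs {ν : PMF α} {Q : α → State → Prop} (k : ℕ) {σ₀ : State}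
    (h : PTri c σ₀ t ν Q)
    (hr : ∀ μ, Runs c σ₀ μ → Runs d σ (μ.map fun s => (s.1, k + s.2))) :
    PTri d σ (k + t) ν Q := by
  obtain ⟨π, h1, h2, h3⟩ := h
  refine ⟨π.map fun z => (z.1, (z.2.1, k + z.2.2)), ?_, ?_, ?_⟩
  · rw [PMF.map_comp]; exact h1
  · have := hr _ h2
    rw [PMF.map_comp] at this ⊢
    exact this
  · intro w hw
    obtain ⟨z, hz, rfl⟩ := (PMF.mem_support_map_iff _ _ _).1 hw
    exact ⟨(h3 z hz).1, Nat.add_le_add_left (h3 z hz).2 k⟩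

theorem PTri.cond {ν : PMF α} {Q : α → State → Prop} (e : Expr)
    (h1 : e.val σ ≠ 0 → PTri c σ t ν Q) (h2 : e.val σ = 0 → PTri d σ t ν Q) :
    PTri (.cond e c d) σ (1 + e.cost σ + t) ν Q := by
  by_cases he : e.val σ = 0
  · exact PTri.of_map_runs _ (h2 he) fun μ hμ => Runs.cond_zero e c d σ μ he hμ
  · exact PTri.of_map_runs _ (h1 he) fun μ hμ => Runs.cond_pos e c d σ μ he hμ

theorem PTri.loop_pos {ν : PMF α} {κ : α → PMF β} {R : α → State → Prop} {Q : β → State → Prop}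
    (e : Expr) (he : e.val σ ≠ 0) (h : PTri c σ t ν R)
    (h' : ∀ a ∈ ν.support, ∀ s, R a s → PTri (.loop e c) s t' (κ a) Q) :
    PTri (.loop e c) σ (1 + e.cost σ + (t + t')) (ν.bind κ) Q := by
  -- An entered loop behaves like its body followed by the loop, up to the cost of the guard.
  refine PTri.of_map_runs _ (PTri.seq h h') fun μ hμ => ?_
  cases hμ with
  | seq _ _ _ μ ν h1 h2 =>
    convert Runs.loop_pos e c σ μ ν he h1 h2 using 1
    rw [PMF.map_bind]
    refine pmf_bind_congr _ fun s _ => ?_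
    rw [PMF.map_comp]
    refine congrArg (fun f => PMF.map f (ν s.1)) (funext fun s' => ?_)
    simp [add_assoc]

/-- `m` steps of the Markov chain `step`. -/
def iterPMF (step : α → PMF α) : ℕ → α → PMF α
  | 0, a => PMF.pure a
  | m + 1, a => (step a).bind (iterPMF step m)

/-- A loop that is executed exactly `n` times. -/
theorem PTri.loop {step : α → PMF α} {Inv : ℕ → α → State → Prop} (e : Expr) (n tb te : ℕ)
    (hg : ∀ k a s, k ≤ n → Inv k a s → (e.val s = 0 ↔ k = n) ∧ e.cost s ≤ te)
    (hb : ∀ k a s, k < n → Inv k a s → PTri c s tb (step a) (Inv (k + 1)))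
    (m : ℕ) : ∀ (k : ℕ) (a : α) (s : State), k + m = n → Inv k a s →
    PTri (.loop e c) s ((m + 1) * (1 + te + tb)) (iterPMF step m a) (Inv n) := by
  induction m with
  | zero =>
    intro k a s hk hs
    obtain rfl : k = n := by omega
    obtain ⟨h1, h2⟩ := hg k a s le_rfl hs
    refine PTri.pure_tri (Tri.of_runs_pure (Runs.loop_zero e c s (h1.2 rfl)) ?_ hs)
    omega
  | succ m ih =>
    intro k a s hk hs
    obtain ⟨h1, h2⟩ := hg k a s (by omega) hs
    refine (PTri.loop_pos e (fun h => ?_) (hb k a s (by omega) hs)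
      (fun b _ s' hs' => ih (k + 1) b s' (by omega) hs')).mono ?_ (fun _ _ h => h)
    · have := h1.1 h
      omega
    · have : (m + 1 + 1) * (1 + te + tb) = (1 + te + tb) + (m + 1) * (1 + te + tb) := by ring
      omega

theorem iterPMF_pure (m : ℕ) (a : α) : iterPMF PMF.pure m a = PMF.pure a := by
  induction m with
  | zero => rfl
  | succ m ih => rw [iterPMF, PMF.pure_bind, ih]

theorem Tri.loop {Inv : ℕ → State → Prop} (e : Expr) (n tb te : ℕ)
    (hg : ∀ k s, k ≤ n → Inv k s → (e.val s = 0 ↔ k = n) ∧ e.cost s ≤ te)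
    (hb : ∀ k s, k < n → Inv k s → Tri c s tb (Inv (k + 1))) (hσ : Inv 0 σ) :
    Tri (.loop e c) σ ((n + 1) * (1 + te + tb)) (Inv n) := by
  have := PTri.loop (α := Unit) (step := PMF.pure) (Inv := fun k _ => Inv k) e n tb te
    (fun k _ s => hg k s) (fun k _ s => hb k s) n 0 () σ (by omega) hσ
  rwa [iterPMF_pure] at this

/-- Outcomes may be replaced by preimages under a map. -/
theorem PTri.of_map {ν : PMF α} {h : α → β} {Q : β → State → Prop}
    (H : PTri c σ t (ν.map h) Q) : PTri c σ t ν fun a => Q (h a) := by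
  classical
  obtain ⟨π, h1, h2, h3⟩ := H
  have hne : ∀ z ∈ π.support, ∃ a ∈ h ⁻¹' {z.1}, a ∈ ν.support := by
    intro z hz
    have : z.1 ∈ (ν.map h).support := h1 ▸ (PMF.mem_support_map_iff _ _ _).2 ⟨z, hz, rfl⟩
    obtain ⟨a, ha, e⟩ := (PMF.mem_support_map_iff _ _ _).1 this
    exact ⟨a, e, ha⟩
  -- `g b` is `ν` conditioned on the fibre of `h` over `b`; drawing `b` from the image and then from
  -- `g b` restores `ν`. The default `ν` is only used for `b` of probability zero.
  let g : β → PMF α := fun b =>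
    if hb : ∃ a ∈ h ⁻¹' {b}, a ∈ ν.support then ν.filter (h ⁻¹' {b}) hb else ν
  have hg : (ν.map h).bind g = ν := by
    ext a
    rw [PMF.bind_apply, tsum_eq_single (h a)]
    · by_cases ha : a ∈ ν.support
      · have hb : ∃ a' ∈ h ⁻¹' {h a}, a' ∈ ν.support := ⟨a, rfl, ha⟩
        simp only [g, dif_pos hb, PMF.filter_apply]
        have e1 : (h ⁻¹' {h a}).indicator ν a = ν a := by simp
        have e2 : (ν.map h) (h a) = ∑' a', (h ⁻¹' {h a}).indicator ν a' := by
          rw [PMF.map_apply]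
          refine tsum_congr fun a' => ?_
          simp [Set.indicator_apply, eq_comm]
        rw [e1, e2]
        have h0 : ∑' a', (h ⁻¹' {h a}).indicator ν a' ≠ 0 := by
          rw [← e2]
          exact (PMF.mem_support_iff _ _).1 ((PMF.mem_support_map_iff _ _ _).2 ⟨a, ha, rfl⟩)
        have htop : ∑' a', (h ⁻¹' {h a}).indicator ν a' ≠ ⊤ := by
          rw [← e2]; exact PMF.apply_ne_top _ _
        rw [mul_comm, mul_assoc, ENNReal.inv_mul_cancel h0 htop, mul_one]
      · have h0 : ν a = 0 := by simpa [PMF.mem_support_iff] using ha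
        rw [h0]
        simp only [g]
        split_ifs with hb
        · rw [PMF.filter_apply]; simp [Set.indicator_apply, h0]
        · simp [h0]
    · intro b hb
      by_cases hex : ∃ a ∈ h ⁻¹' {b}, a ∈ ν.support
      · simp only [g, dif_pos hex, PMF.filter_apply]
        rw [Set.indicator_of_notMem]
        · simp
        · exact fun h' => hb (by simpa using h'.symm)
      · have : (ν.map h) b = 0 := by
          by_contra hb0
          obtain ⟨a', ha', e⟩ := (PMF.mem_support_map_iff _ _ _).1 ((PMF.mem_support_iff _ _).2 hb0)
          exact hex ⟨a', e, ha'⟩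
        rw [this, zero_mul]
  refine ⟨π.bind fun z => (g z.1).map fun a => (a, z.2), ?_, ?_, ?_⟩
  · rw [PMF.map_bind, ← hg, ← h1, PMF.bind_map]
    refine pmf_bind_congr _ fun z _ => ?_
    rw [PMF.map_comp]
    exact PMF.map_id _
  · convert h2 using 1
    rw [PMF.map_bind]
    change _ = π.bind (PMF.pure ∘ Prod.snd)
    refine pmf_bind_congr _ fun z _ => ?_
    rw [PMF.map_comp]
    exact PMF.map_const _ _
  · intro w hw
    obtain ⟨z, hz, hw⟩ := (PMF.mem_support_bind_iff _ _ _).1 hw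
    obtain ⟨a, ha, rfl⟩ := (PMF.mem_support_map_iff _ _ _).1 hw
    simp only [g, dif_pos (hne z hz), PMF.mem_support_filter_iff] at ha
    have e : h a = z.1 := ha.1
    simpa [e] using h3 z hz

end Rules

/-! ### Subroutine calls and whole runs -/

theorem RunsOn.mono {P : Cmd} {l : List ℕ} {t t' : ℕ} {ρ : PMF (List ℕ)} (h : RunsOn P l t ρ)
    (ht : t ≤ t') : RunsOn P l t' ρ := by
  obtain ⟨μ, h1, h2, h3⟩ := h
  exact ⟨μ, h1, fun s hs => (h2 s hs).trans ht, h3⟩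

theorem RunsOn.listCost_le {P : Cmd} {l : List ℕ} {t : ℕ} {ρ : PMF (List ℕ)}
    (h : RunsOn P l t ρ) : listCost l ≤ t := by
  obtain ⟨μ, _, h2, _⟩ := h
  obtain ⟨s, hs⟩ := μ.support_nonempty
  have := h2 s hs
  unfold totalTime at this
  omega

theorem PTri.runsOn {α : Type*} {P : Cmd} {l : List ℕ} {t u : ℕ} {ν : PMF α} {out : α → List ℕ}
    {Q : α → State → Prop} (h : PTri P (State.init l) t ν Q)
    (hQ : ∀ a ∈ ν.support, ∀ s, Q a s → s.read 0 = out a)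
    (hu : ∀ a ∈ ν.support, listCost (out a) ≤ u) :
    RunsOn P l (listCost l + t + u) (ν.map out) := by
  obtain ⟨π, rfl, h2, h3⟩ := h
  have hfst : ∀ z ∈ π.support, z.1 ∈ (π.map Prod.fst).support := fun z hz =>
    (PMF.mem_support_map_iff _ _ _).2 ⟨z, hz, rfl⟩
  refine ⟨_, h2, ?_, ?_⟩
  · intro s hs
    obtain ⟨z, hz, rfl⟩ := (PMF.mem_support_map_iff _ _ _).1 hs
    have e := hQ _ (hfst z hz) _ (h3 z hz).1
    have := hu _ (hfst z hz)
    have := (h3 z hz).2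
    simp only [totalTime, e]
    omega
  · rw [PMF.map_comp, PMF.map_comp]
    exact pmf_map_congr _ fun z hz => hQ _ (hfst z hz) _ (h3 z hz).1

/-- With a budget that covers the worst-case time, the branch of the semantics in which the
subroutine is interrupted never occurs. -/
theorem RunsOn.call {P : Cmd} {σ : State} {src dst t : ℕ} {b : Expr} {ρ : PMF (List ℕ)}
    (h : RunsOn P (σ.read src) t ρ) (hb : t ≤ b.val σ) :
    PTri (.call P src dst b) σ (1 + b.cost σ + t) ρ fun o s => s = σ.store dst o := by
  obtain ⟨μ, h1, h2, rfl⟩ := h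
  have hr := Runs.call P src dst b σ μ h1
  refine ⟨μ.map fun s => (s.1.read 0, (σ.store dst (s.1.read 0),
    1 + b.cost σ + totalTime (σ.read src) s)), ?_, ?_, ?_⟩
  · rw [PMF.map_comp]; rfl
  · rw [PMF.map_comp]
    convert hr using 1
    refine pmf_map_congr _ fun s hs => ?_
    have := h2 s hs
    simp only [Function.comp_apply]
    rw [if_pos (this.trans hb), min_eq_left (this.trans hb)]
  · intro z hz
    obtain ⟨s, hs, rfl⟩ := (PMF.mem_support_map_iff _ _ _).1 hz
    exact ⟨rfl, Nat.add_le_add_left (h2 s hs) _⟩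

end

section

/-! ### Bounds for expressions and straight-line programs -/

/-- All memory cells hold numbers at most `B`. -/
def State.Bd (σ : State) (B : ℕ) : Prop := ∀ x i, σ x i ≤ B

theorem State.Bd.mono {σ : State} {B B' : ℕ} (h : σ.Bd B) (hB : B ≤ B') : σ.Bd B' :=
  fun x i => (h x i).trans hB

theorem State.Bd.write {σ : State} {B : ℕ} (h : σ.Bd B) {v : ℕ} (hv : v ≤ B) (x i : ℕ) :
    (σ.write x i v).Bd B := by
  intro y j
  unfold State.write
  split_ifs
  exacts [hv, h y j]

theorem State.Bd.store {σ : State} {B : ℕ} (h : σ.Bd B) {l : List ℕ} (hl : l.length ≤ B)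
    (hv : ∀ v ∈ l, v ≤ B) (x : ℕ) : (σ.store x l).Bd B := by
  intro y j
  unfold State.store
  split_ifs with hj
  · cases j with
    | zero => simpa using hl
    | succ j =>
      rw [List.getD_cons_succ, List.getD_eq_getElem _ _ (by omega)]
      exact hv _ (List.getElem_mem _)
  · exact h y j

theorem State.Bd.init {B : ℕ} {l : List ℕ} (hl : l.length ≤ B) (hv : ∀ v ∈ l, v ≤ B) :
    (State.init l).Bd B :=
  State.Bd.store (fun _ _ => Nat.zero_le _) hl hv 0

/-- Growth exponent of an expression. -/
def Expr.wt : Expr → ℕ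
  | .const k => k + 1
  | .get _ _ => 1
  | .op _ a b => a.wt + b.wt

/-- Cost factor of an expression. -/
def Expr.K : Expr → ℕ
  | .const k => k + 2
  | .get _ i => 2 + i.K
  | .op _ a b => 1 + (a.wt + b.wt) + a.K + b.K

theorem Expr.wt_pos (e : Expr) : 1 ≤ e.wt := by
  induction e with
  | const k => simp [Expr.wt]
  | get x i _ => simp [Expr.wt]
  | op o a b iha _ => simp only [Expr.wt]; omega

/-- Both powers are at least 2, so even the sum is at most their product; the other operations are
immediate. -/
theorem Op.eval_le_pow {B u v a b : ℕ} (o : Op) (hB : 2 ≤ B) (hu : 1 ≤ u) (hv : 1 ≤ v)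
    (ha : a ≤ B ^ u) (hb : b ≤ B ^ v) : o.eval a b ≤ B ^ (u + v) := by
  have h1 : 2 ≤ B ^ u := hB.trans (Nat.le_self_pow (by omega) B)
  have h2 : 2 ≤ B ^ v := hB.trans (Nat.le_self_pow (by omega) B)
  rw [pow_add]
  have h3 : B ^ u ≤ B ^ u * B ^ v := Nat.le_mul_of_pos_right _ (by omega)
  cases o <;> simp only [Op.eval]
  · nlinarith
  · omega
  · exact Nat.mul_le_mul ha hb
  · exact (Nat.div_le_self _ _).trans (ha.trans h3)
  · exact (Nat.mod_le _ _).trans (ha.trans h3)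

theorem Expr.val_le {σ : State} {B : ℕ} (hB : 2 ≤ B) (hσ : σ.Bd B) (e : Expr) :
    e.val σ ≤ B ^ e.wt := by
  induction e with
  | const k =>
    simp only [Expr.val, Expr.wt]
    calc k ≤ k + 1 := by omega
      _ ≤ 2 ^ (k + 1) := Nat.lt_two_pow_self.le
      _ ≤ B ^ (k + 1) := Nat.pow_le_pow_left hB _
  | get x i _ => simpa [Expr.val, Expr.wt] using hσ x _
  | op o a b iha ihb => exact o.eval_le_pow hB a.wt_pos b.wt_pos iha ihb

theorem size_pow_le (B w : ℕ) (hw : 1 ≤ w) : (B ^ w).size ≤ w * B.size := by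
  rw [Nat.size_le, mul_comm, pow_mul]
  exact Nat.pow_lt_pow_left (Nat.lt_size_self B) (by omega)

theorem one_le_size {B : ℕ} (hB : 2 ≤ B) : 1 ≤ B.size :=
  Nat.lt_size.2 (by simp; omega)

/-- Every intermediate value is at most a fixed power of `B`, so its bit length is at most a
constant multiple of that of `B`. The factor depends on the expression only, never on the memory. -/
theorem Expr.cost_le {σ : State} {B : ℕ} (hB : 2 ≤ B) (hσ : σ.Bd B) (e : Expr) :
    e.cost σ ≤ e.K * B.size := by
  have hs := one_le_size hB
  induction e with
  | const k =>
    simp only [Expr.cost, Expr.K]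
    have : k.size ≤ k + 1 := Nat.size_le.2 (Nat.lt_two_pow_self.trans_le
      (Nat.pow_le_pow_right (by omega) (by omega)))
    nlinarith
  | get x i ih =>
    simp only [Expr.cost, Expr.K]
    have := Nat.size_le_size (hσ x (i.val σ))
    nlinarith
  | op o a b iha ihb =>
    simp only [Expr.cost, Expr.K]
    have h1 := Nat.size_le_size (o.eval_le_pow hB a.wt_pos b.wt_pos (a.val_le hB hσ)
      (b.val_le hB hσ))
    have h2 := size_pow_le B (a.wt + b.wt) (by have := a.wt_pos; omega)
    nlinarith

/-- Programs without loops, calls and random choices. -/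
def Cmd.Simple : Cmd → Prop
  | .skip => True
  | .set _ _ _ => True
  | .seq c d => c.Simple ∧ d.Simple
  | .cond _ c d => c.Simple ∧ d.Simple
  | _ => False

/-- The effect of a straight-line program. -/
def Cmd.exec : Cmd → State → State
  | .set x i e, σ => σ.write x (i.val σ) (e.val σ)
  | .seq c d, σ => d.exec (c.exec σ)
  | .cond e c d, σ => if e.val σ = 0 then d.exec σ else c.exec σ
  | _, σ => σ

/-- Exponents multiply under composition because the second program starts from cells bounded by a
power of `B`. For branches the product is a convenient common upper bound. -/
def Cmd.wt : Cmd → ℕ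
  | .set _ _ e => e.wt
  | .seq c d => c.wt * d.wt
  | .cond _ c d => c.wt * d.wt
  | _ => 1

def Cmd.K : Cmd → ℕ
  | .skip => 1
  | .set _ i e => 1 + i.K + e.K
  | .seq c d => c.K + c.wt * d.K
  | .cond e c d => 1 + e.K + (c.K + d.K)
  | _ => 0

theorem Cmd.wt_pos (c : Cmd) : 1 ≤ c.wt := by
  induction c with
  | set x i e => exact e.wt_pos
  | seq c d h1 h2 => exact Nat.mul_pos h1 h2
  | cond e c d h1 h2 => exact Nat.mul_pos h1 h2
  | _ => exact le_rfl

theorem Cmd.exec_bd {c : Cmd} {σ : State} {B : ℕ} (hB : 2 ≤ B) (hσ : σ.Bd B) :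
    (c.exec σ).Bd (B ^ c.wt) := by
  induction c generalizing σ B with
  | set x i e =>
    exact (hσ.mono (Nat.le_self_pow (by have := e.wt_pos; omega) B)).write (e.val_le hB hσ) _ _
  | seq c d h1 h2 =>
    have := h2 (hB.trans (Nat.le_self_pow (by have := c.wt_pos; omega) B)) (h1 hB hσ)
    rwa [← pow_mul] at this
  | cond e c d h1 h2 =>
    simp only [Cmd.exec]
    have hc := c.wt_pos
    have hd := d.wt_pos
    split_ifs
    · exact (h2 hB hσ).mono (Nat.pow_le_pow_right (by omega) (Nat.le_mul_of_pos_left _ hc))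
    · exact (h1 hB hσ).mono (Nat.pow_le_pow_right (by omega) (Nat.le_mul_of_pos_right _ hd))
  | _ => simpa [Cmd.exec, Cmd.wt] using hσ

theorem Cmd.Simple.tri {c : Cmd} (hc : c.Simple) {σ : State} {B : ℕ} (hB : 2 ≤ B) (hσ : σ.Bd B) :
    Tri c σ (c.K * B.size) fun s => s = c.exec σ := by
  induction c generalizing σ B with
  | skip =>
    refine Tri.of_runs_pure (Runs.skip σ) ?_ rfl
    have := one_le_size hB
    simp only [Cmd.K]; omega
  | set x i e =>
    refine Tri.of_runs_pure (Runs.set x i e σ) ?_ rfl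
    have := one_le_size hB
    have h1 := i.cost_le hB hσ
    have h2 := e.cost_le hB hσ
    simp only [Cmd.K]
    nlinarith
  | seq c d h1 h2 =>
    have hw := c.wt_pos
    refine Tri.mono (Tri.seq (h1 hc.1 hB hσ) (t' := d.K * (B ^ c.wt).size) ?_) ?_
      (fun _ h => h)
    · rintro s rfl
      exact h2 hc.2 (hB.trans (Nat.le_self_pow (by omega) B)) (Cmd.exec_bd hB hσ)
    · have := size_pow_le B c.wt hw
      simp only [Cmd.K]
      calc _ ≤ c.K * B.size + d.K * (c.wt * B.size) := by gcongr
        _ = _ := by ring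
  | cond e c d h1 h2 =>
    have := one_le_size hB
    have h3 := e.cost_le hB hσ
    refine Tri.mono (PTri.cond e (t := (c.K + d.K) * B.size) (fun he => ?_) (fun he => ?_)) ?_
      (fun _ h => h)
    · refine Tri.mono (h1 hc.1 hB hσ) (Nat.mul_le_mul_right _ (by omega)) ?_
      rintro s rfl
      simp [Cmd.exec, he]
    · refine Tri.mono (h2 hc.2 hB hσ) (Nat.mul_le_mul_right _ (by omega)) ?_
      rintro s rfl
      simp [Cmd.exec, he]
    · simp only [Cmd.K]
      nlinarith
  | rand x i e => exact hc.elim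
  | loop e c => exact hc.elim
  | call c src dst b => exact hc.elim

theorem Tri.simple {c : Cmd} (hc : c.Simple) {σ : State} {B : ℕ} (hB : 2 ≤ B) (hσ : σ.Bd B)
    {Q : State → Prop} (hQ : Q (c.exec σ)) : Tri c σ (c.K * B.size) Q :=
  (hc.tri hB hσ).mono le_rfl (by rintro s rfl; exact hQ)

/-! ### Counting loops -/

/-- The scalar variable kept in cell `0` of bank `x`. -/
def Expr.var (x : ℕ) : Expr := .get x (.const 0)

def Cmd.setVar (x : ℕ) (e : Expr) : Cmd := .set x (.const 0) e

@[simp] theorem Expr.val_var (x : ℕ) (σ : State) : (Expr.var x).val σ = σ x 0 := rfl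

@[simp] theorem Cmd.exec_setVar (x : ℕ) (e : Expr) (σ : State) :
    (Cmd.setVar x e).exec σ = σ.write x 0 (e.val σ) := rfl

theorem State.write_apply (σ : State) (x i v y j : ℕ) :
    σ.write x i v y j = if y = x ∧ j = i then v else σ y j := rfl

theorem State.write_of_ne {σ : State} {x i v y j : ℕ} (h : y ≠ x) : σ.write x i v y j = σ y j := by
  simp [State.write_apply, h]

theorem State.write_of_ne' {σ : State} {x i v y j : ℕ} (h : j ≠ i) :
    σ.write x i v y j = σ y j := by
  simp [State.write_apply, h]

/-- `for x = 0, …, e - 1 do c`, where the bound `e` is evaluated anew in each round. -/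
def Cmd.for (x : ℕ) (e : Expr) (c : Cmd) : Cmd :=
  .seq (.setVar x (.const 0))
    (.loop (.op .sub e (.var x)) (.seq c (.setVar x (.op .add (.var x) (.const 1)))))

/-- The cost factor of the bookkeeping of a counting loop. -/
def forK (e : Expr) : ℕ := 100 + 2 * (e.K + e.wt)

/-- The invariant must restore the same bound `B` in each round: the generic bound of straight-line
code raises `B` to a power, which would compound over the rounds. `hx` says that the invariant
ignores the loop variable, which the loop itself overwrites. -/
theorem Tri.for {x n B tb : ℕ} {e : Expr} {c : Cmd} {σ : State} {Inv : ℕ → State → Prop}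
    (hB : 2 ≤ B) (hσ : σ.Bd B)
    (hbd : ∀ k s, k ≤ n → Inv k s → s.Bd B)
    (hg : ∀ k s, k ≤ n → Inv k s → e.val s = n)
    (hx : ∀ s k v, k ≤ n → v ≤ n → Inv k s → Inv k (s.write x 0 v))
    (h0 : Inv 0 σ)
    (hb : ∀ k s, k < n → Inv k s → s x 0 = k →
      Tri c s tb fun s' => Inv (k + 1) s' ∧ s' x 0 = k) :
    Tri (.for x e c) σ ((n + 1) * (tb + forK e * B.size)) (Inv n) := by
  have h1s := one_le_size hB
  have key := Tri.loop (c := .seq c (.setVar x (.op .add (.var x) (.const 1))))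
    (σ := σ.write x 0 0)
    (Inv := fun k s => Inv k s ∧ s x 0 = k) (.op .sub e (.var x)) n
    (tb + (Cmd.setVar x (.op .add (.var x) (.const 1))).K * B.size)
    ((Expr.op .sub e (.var x)).K * B.size) ?_ ?_ ?_
  · have h := Tri.seq (R := fun s => s = σ.write x 0 0)
      (Tri.simple (c := .setVar x (.const 0)) trivial hB hσ rfl) (fun s hs => hs ▸ key)
    refine h.mono ?_ fun s hs => hs.1
    simp only [Cmd.K, Cmd.setVar, Expr.K, Expr.wt, Expr.var, forK]
    set S := B.size
    nlinarith [Nat.zero_le (n * S), Nat.zero_le (n * e.K * S), Nat.zero_le (n * e.wt * S),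
      Nat.zero_le (e.K * S), Nat.zero_le (e.wt * S), Nat.mul_le_mul_left n h1s]
  · intro k s hk hs
    refine ⟨?_, Expr.cost_le hB (hbd k s hk hs.1) _⟩
    simp only [Expr.val, Expr.var, Op.eval]
    rw [hg k s hk hs.1, hs.2]
    omega
  · intro k s hk hs
    refine Tri.seq (hb k s hk hs.1 hs.2) fun s' hs' => ?_
    refine Tri.simple (by trivial) hB (hbd _ _ hk hs'.1) ⟨?_, ?_⟩
    · refine hx _ _ _ hk ?_ hs'.1
      simpa [Expr.val, Op.eval, hs'.2] using hk
    · simp [State.write_apply, Expr.val, Op.eval, hs'.2]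
  · exact ⟨hx _ _ _ (Nat.zero_le _) (Nat.zero_le _) h0, by simp [State.write_apply]⟩

/-! ### Tables -/

/-- The indicator of `e = a`. -/
def Expr.isConst (e : Expr) (a : ℕ) : Expr :=
  .op .sub (.const 1) (.op .add (.op .sub e (.const a)) (.op .sub (.const a) e))

theorem Expr.val_isConst (e : Expr) (a : ℕ) (σ : State) :
    (e.isConst a).val σ = if e.val σ = a then 1 else 0 := by
  simp only [Expr.isConst, Expr.val, Op.eval]
  split_ifs with h <;> omega

/-- `∑ a < p, [e = a] * f a`. -/
def Expr.table (f : ℕ → Expr) (e : Expr) : ℕ → Expr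
  | 0 => .const 0
  | p + 1 => .op .add (Expr.table f e p) (.op .mul (e.isConst p) (f p))

/-- At most one indicator in the sum is nonzero. As the field is fixed, its operations become lookup
tables of constant size. -/
theorem Expr.val_table (f : ℕ → Expr) (e : Expr) (σ : State) (p : ℕ) :
    (Expr.table f e p).val σ = if e.val σ < p then (f (e.val σ)).val σ else 0 := by
  induction p with
  | zero => simp [Expr.table, Expr.val]
  | succ p ih =>
    simp only [Expr.table, Expr.val, Op.eval, ih, Expr.val_isConst]
    by_cases h1 : e.val σ = p
    · simp [h1]
    · by_cases h2 : e.val σ < p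
      · simp [h1, h2, Nat.lt_succ_of_lt h2]
      · have : ¬ e.val σ < p + 1 := by omega
        simp [h1, h2, this]

variable {F : Type*} [Field F] [Fintype F] (enc : F ≃ Fin (Fintype.card F))

/-- The field element with code `a`; zero if there is none. -/
def decode (a : ℕ) : F := if h : a < Fintype.card F then enc.symm ⟨a, h⟩ else 0

@[simp] theorem decode_enc (x : F) : decode enc (enc x : ℕ) = x := by
  simp [decode]

/-- A function of one field element, given by a table. -/
def Expr.fun₁ (g : F → ℕ) (e : Expr) : Expr :=
  Expr.table (fun a => .const (g (decode enc a))) e (Fintype.card F)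

/-- A function of two field elements, given by a table. -/
def Expr.fun₂ (g : F → F → ℕ) (e₁ e₂ : Expr) : Expr :=
  Expr.table (fun a => Expr.fun₁ enc (g (decode enc a)) e₂) e₁ (Fintype.card F)

variable {enc}

theorem Expr.val_fun₁ (g : F → ℕ) {e : Expr} {σ : State} {x : F} (h : e.val σ = enc x) :
    (Expr.fun₁ enc g e).val σ = g x := by
  simp [Expr.fun₁, Expr.val_table, h, Expr.val]

theorem Expr.val_fun₂ (g : F → F → ℕ) {e₁ e₂ : Expr} {σ : State} {x y : F}
    (h₁ : e₁.val σ = enc x) (h₂ : e₂.val σ = enc y) :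
    (Expr.fun₂ enc g e₁ e₂).val σ = g x y := by
  simp [Expr.fun₂, Expr.val_table, h₁, Expr.val_fun₁ _ h₂]

variable (enc)

/-- A binary field operation on codes. -/
def Expr.fop (g : F → F → F) (e₁ e₂ : Expr) : Expr :=
  Expr.fun₂ enc (fun x y => (enc (g x y) : ℕ)) e₁ e₂

variable {enc}

theorem Expr.val_fop (g : F → F → F) {e₁ e₂ : Expr} {σ : State} {x y : F}
    (h₁ : e₁.val σ = enc x) (h₂ : e₂.val σ = enc y) :
    (Expr.fop enc g e₁ e₂).val σ = enc (g x y) :=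
  Expr.val_fun₂ _ h₁ h₂

theorem enc_lt (x : F) : (enc x : ℕ) < Fintype.card F := (enc x).2

/-! ### Encoded matrices -/

theorem length_encMat {n : ℕ} (A : Matrix (Fin n) (Fin n) F) :
    (encMat enc A).length = n ^ 2 + 1 := by
  simp [encMat, List.length_flatten, List.map_ofFn, Function.comp_def, sq]

theorem getD_flatten_ofFn {α : Type*} (d : α) {m n : ℕ} (f : Fin m → Fin n → α) (i : Fin m)
    (j : Fin n) :
    ((List.ofFn fun i => List.ofFn fun j => f i j).flatten).getD (i * n + j) d = f i j := by
  induction m with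
  | zero => exact i.elim0
  | succ m ih =>
    rw [List.ofFn_succ, List.flatten_cons]
    refine Fin.cases ?_ (fun i => ?_) i
    · rw [List.getD_append _ _ _ _ (by simp)]
      simp
    · rw [List.getD_append_right _ _ _ _ (by simp [Nat.add_mul]; omega)]
      have : ((i.succ : ℕ) * n + j) - (List.ofFn fun j => f 0 j).length = i * n + j := by
        simp [Nat.add_mul]; omega
      rw [this]
      exact ih (fun i j => f i.succ j) i

theorem getD_encMat {n : ℕ} (A : Matrix (Fin n) (Fin n) F) (i j : Fin n) :
    (encMat enc A).getD (1 + (i * n + j)) 0 = enc (A i j) := by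
  rw [encMat, add_comm, List.getD_cons_succ]
  exact getD_flatten_ofFn 0 (fun i j : Fin n => ((enc (A i j) : Fin _) : ℕ)) i j

/-- Bank `x` holds the matrix `A` from cell `o` on, row by row. -/
def State.Mat (enc : F ≃ Fin (Fintype.card F)) (σ : State) (x o : ℕ) {n : ℕ}
    (A : Matrix (Fin n) (Fin n) F) : Prop :=
  ∀ i j : Fin n, σ x (o + (i * n + j)) = enc (A i j)

theorem index_inj {n i i' j j' : ℕ} (hj : j < n) (hj' : j' < n) :
    i * n + j = i' * n + j' ↔ i = i' ∧ j = j' := by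
  refine ⟨fun h => ?_, fun h => by rw [h.1, h.2]⟩
  have h1 : (i * n + j) / n = i := by
    rw [mul_comm, Nat.mul_add_div (by omega), Nat.div_eq_of_lt hj, add_zero]
  have h2 : (i' * n + j') / n = i' := by
    rw [mul_comm, Nat.mul_add_div (by omega), Nat.div_eq_of_lt hj', add_zero]
  have : i = i' := by rw [← h1, ← h2, h]
  subst this
  exact ⟨rfl, by omega⟩

theorem index_lt {n i j : ℕ} (hi : i < n) (hj : j < n) : i * n + j < n ^ 2 := by
  have : (i + 1) * n ≤ n * n := Nat.mul_le_mul_right n hi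
  rw [sq]
  linarith

theorem mem_encMat_le {n : ℕ} (A : Matrix (Fin n) (Fin n) F) {v : ℕ} (hv : v ∈ encMat enc A) :
    v ≤ max n (Fintype.card F) := by
  simp only [encMat, List.mem_cons, List.mem_flatten, List.mem_ofFn] at hv
  rcases hv with rfl | ⟨l, ⟨i, rfl⟩, hv⟩
  · exact le_max_left _ _
  · obtain ⟨j, rfl⟩ := List.mem_ofFn.1 hv
    exact (enc_lt _).le.trans (le_max_right _ _)

theorem listCost_le {l : List ℕ} {B : ℕ} (h : ∀ v ∈ l, v ≤ B) :
    listCost l ≤ l.length * (1 + B.size) := by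
  induction l with
  | nil => simp [listCost]
  | cons a l ih =>
    have h1 := ih fun v hv => h v (List.mem_cons_of_mem _ hv)
    have h2 := Nat.size_le_size (h a List.mem_cons_self)
    simp only [listCost, List.map_cons, List.sum_cons, List.length_cons] at h1 ⊢
    linarith

theorem length_le_listCost (l : List ℕ) : l.length ≤ listCost l := by
  induction l with
  | nil => simp
  | cons a l ih => simp only [listCost, List.map_cons, List.sum_cons, List.length_cons] at ih ⊢; omega

theorem State.store_same {σ : State} {x : ℕ} {l : List ℕ} {j : ℕ} (h : j < l.length) :
    σ.store x l x (j + 1) = l.getD j 0 := by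
  unfold State.store
  rw [if_pos ⟨rfl, h⟩, List.getD_cons_succ]

theorem State.store_zero {σ : State} {x : ℕ} {l : List ℕ} :
    σ.store x l x 0 = l.length := by
  simp [State.store]

theorem State.store_of_ne {σ : State} {x y : ℕ} {l : List ℕ} {j : ℕ} (h : y ≠ x) :
    σ.store x l y j = σ y j := by
  simp [State.store, h]

theorem State.read_eq {σ : State} {x : ℕ} {l : List ℕ} (h0 : σ x 0 = l.length)
    (h : ∀ j < l.length, σ x (j + 1) = l.getD j 0) : σ.read x = l := by
  apply List.ext_getElem
  · simp [State.read, h0]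
  · intro j h1 h2
    simp only [State.read, List.getElem_map, List.getElem_range]
    rw [h j h2, List.getD_eq_getElem _ _ h2]

theorem State.read_init (l : List ℕ) : (State.init l).read 0 = l :=
  State.read_eq State.store_zero fun _ h => State.store_same h

theorem State.read_store (σ : State) (x : ℕ) (l : List ℕ) : (σ.store x l).read x = l :=
  State.read_eq State.store_zero fun _ h => State.store_same h

/-- The offset 2 accounts for the length of the array in cell 0 and for the dimension that precedes
the entries in the code of the matrix. -/
theorem State.Mat.of_getD {σ : State} {x o : ℕ} {n : ℕ} {A : Matrix (Fin n) (Fin n) F}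
    {l : List ℕ} (h : ∀ j < l.length, σ x (j + 1) = l.getD j 0)
    (hl : ∀ j ≤ n ^ 2, l.getD (o + j) 0 = (encMat enc A).getD j 0) (hn : o + n ^ 2 < l.length) :
    σ.Mat enc x (o + 2) A := by
  intro i j
  have h1 := index_lt i.2 j.2
  have h2 := hl (1 + (i * n + j)) (by omega)
  rw [getD_encMat, ← h _ (by omega)] at h2
  rw [← h2]
  congr 1
  omega

theorem State.read_encMat {σ : State} {x n : ℕ} {A : Matrix (Fin n) (Fin n) F}
    (h0 : σ x 0 = n ^ 2 + 1) (h1 : σ x 1 = n) (h : σ.Mat enc x 2 A) :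
    σ.read x = encMat enc A := by
  refine State.read_eq (by rw [h0, length_encMat]) fun j hj => ?_
  rw [length_encMat] at hj
  cases j with
  | zero => simpa [encMat] using h1
  | succ j =>
    have hn : 0 < n := by
      rcases Nat.eq_zero_or_pos n with rfl | h
      · simp at hj
      · exact h
    have hi : j / n < n := Nat.div_lt_of_lt_mul (by rw [← sq]; omega)
    have := h ⟨j / n, hi⟩ ⟨j % n, Nat.mod_lt _ hn⟩
    rw [← getD_encMat] at this
    simp only [Nat.div_add_mod'] at this
    rw [add_comm 1 j] at this
    rw [← this]
    congr 1
    omega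

theorem State.Mat.write {σ : State} {x o n : ℕ} {A A' : Matrix (Fin n) (Fin n) F}
    (h : σ.Mat enc x o A) (i j : Fin n) (v : F)
    (hA : ∀ r c, A' r c = if r = i ∧ c = j then v else A r c) :
    (σ.write x (o + (i * n + j)) (enc v)).Mat enc x o A' := by
  intro r c
  have := index_inj (i := r) (i' := i) c.2 j.2
  rw [State.write_apply, hA]
  by_cases hrc : r = i ∧ c = j
  · rw [if_pos hrc, if_pos ⟨rfl, by rw [hrc.1, hrc.2]⟩]
  · rw [if_neg hrc, if_neg, h r c]
    rintro ⟨-, h'⟩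
    have := this.1 (by omega)
    exact hrc ⟨Fin.ext this.1, Fin.ext this.2⟩

theorem State.Mat.write_of_ne {σ : State} {x o n : ℕ} {A : Matrix (Fin n) (Fin n) F}
    (h : σ.Mat enc x o A) {y i v : ℕ} (hy : x ≠ y) : (σ.write y i v).Mat enc x o A := by
  intro r c
  rw [State.write_of_ne hy, h]

/-- The position `o + (i * N + j)` of an entry. -/
def Expr.ix (o N i j : Expr) : Expr := .op .add o (.op .add (.op .mul i N) j)

@[simp] theorem Expr.val_ix (o N i j : Expr) (σ : State) :
    (Expr.ix o N i j).val σ = o.val σ + (i.val σ * N.val σ + j.val σ) := rfl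

/-- Cost of a straight-line loop body repeated `n` times, in the format of `Tri.for`. -/
theorem Tri.for_mul {x n B K M : ℕ} {e : Expr} {c : Cmd} {σ : State} {Q : State → Prop}
    (h : Tri (.for x e c) σ ((n + 1) * (M * K * B.size + forK e * B.size)) Q) (hM : 1 ≤ M) :
    Tri (.for x e c) σ (((n + 1) * M) * (K + forK e) * B.size) Q := by
  refine h.mono ?_ fun _ h => h
  have : forK e * B.size ≤ M * (forK e * B.size) := Nat.le_mul_of_pos_left _ hM
  calc _ ≤ (n + 1) * (M * K * B.size + M * (forK e * B.size)) := by gcongr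
    _ = _ := by ring

end

section

/-! ### Gaussian elimination without pivot search -/

variable {F : Type*} [Field F]

open Classical in
/-- The coefficient with which row `i` is added to row `k` in order to get a nonzero pivot. -/
def pivotCoeff (a : F) : F := if a = 0 then 1 else 0

/-- Make the entry `(i, k)` zero by means of row `k`. -/
def elimStep {n : ℕ} (k i : Fin n) (A : Matrix (Fin n) (Fin n) F) : Matrix (Fin n) (Fin n) F :=
  let c₁ := pivotCoeff (A k k)
  let c₂ := A i k / (A k k + c₁ * A i k)
  fun r c => if r = i then A i c - c₂ * (A k c + c₁ * A i c)
    else if r = k then A k c + c₁ * A i c else A r c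

/-- The step consists of two additions of a multiple of one row to another: first row `i` to row
`k`, then the new row `k` to row `i`. -/
theorem det_elimStep {n : ℕ} {k i : Fin n} (hki : k ≠ i) (A : Matrix (Fin n) (Fin n) F) :
    (elimStep k i A).det = A.det := by
  set c₁ := pivotCoeff (A k k) with hc₁
  set c₂ := A i k / (A k k + c₁ * A i k) with hc₂
  have h1 := Matrix.det_updateRow_add_smul_self A hki c₁
  set A₁ := A.updateRow k (A k + c₁ • A i) with hA₁
  have h2 := Matrix.det_updateRow_add_smul_self A₁ hki.symm (-c₂)
  rw [← h1, ← h2]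
  congr 1
  ext r c
  by_cases hr : r = i
  · subst hr
    simp [elimStep, hA₁, hki.symm, ← hc₁, ← hc₂, sub_eq_add_neg, mul_add, add_comm]
  · by_cases hr' : r = k
    · subst hr'
      simp [elimStep, hA₁, hr, ← hc₁]
    · simp [elimStep, hA₁, hr, hr']

/-- If the pivot is zero, the repaired pivot is `A i k`. If that is zero too, nothing has to be
eliminated, and the convention 0 / 0 = 0 makes the second coefficient harmless. -/
theorem elimStep_self {n : ℕ} {k i : Fin n} (A : Matrix (Fin n) (Fin n) F) :
    elimStep k i A i k = 0 := by
  simp only [elimStep, if_true, pivotCoeff]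
  by_cases h : A k k = 0
  · by_cases h' : A i k = 0
    · simp [h, h']
    · simp [h, h']
  · simp [h]

/-- The entries below the diagonal are zero in the columns before `k`, and in column `k` above
row `i`. -/
def Cleared {n : ℕ} (k i : ℕ) (A : Matrix (Fin n) (Fin n) F) : Prop :=
  ∀ r c : Fin n, c < r → ((c : ℕ) < k ∨ (c : ℕ) = k ∧ (r : ℕ) < i) → A r c = 0

theorem Cleared.elimStep {n : ℕ} {k i : Fin n} (hki : k < i) {A : Matrix (Fin n) (Fin n) F}
    (h : Cleared k i A) : Cleared k (i + 1) (elimStep k i A) := by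
  intro r c hrc hc
  by_cases hr : r = i
  · subst hr
    by_cases hck : c = k
    · subst hck; exact elimStep_self A
    · have hck' : (c : ℕ) < k := by
        rcases hc with hc | hc
        · exact hc
        · exact absurd (Fin.ext hc.1) hck
      have hck'' : c < k := hck'
      simp [DetRed.elimStep, h r c hrc (Or.inl hck'), h k c hck'' (Or.inl hck')]
  · by_cases hrk : r = k
    · subst hrk
      have hc' : (c : ℕ) < r := hrc
      have hci : c < i := hrc.trans hki
      simp [DetRed.elimStep, hr, h r c hrc (Or.inl hc'), h i c hci (Or.inl hc')]
    · simp only [DetRed.elimStep, hr, hrk, if_false]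
      have hr' : (r : ℕ) ≠ i := fun h => hr (Fin.ext h)
      exact h r c hrc (by omega)

theorem Cleared.det {n : ℕ} {A : Matrix (Fin n) (Fin n) F} (h : Cleared n 0 A) :
    A.det = ∏ i, A i i :=
  Matrix.det_of_isUpperTriangular fun r c hrc => h r c hrc (Or.inl c.2)

variable [Fintype F] (enc : F ≃ Fin (Fintype.card F))

/-! ### Gaussian elimination as a program -/

namespace DetProg

/-- The dimension. -/
def dim : Expr := .get 0 (.const 1)

/-- The matrix entry in row `i` and column `j`. -/
def ent (i j : Expr) : Expr := .get 0 (.ix (.const 2) dim i j)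

def rowBody : Cmd :=
  .seq
    (.set 0 (.ix (.const 2) dim (.var 2) (.var 4))
      (.fop enc (· + ·) (ent (.var 2) (.var 4))
        (.fop enc (· * ·) (.var 5) (ent (.var 3) (.var 4)))))
    (.set 0 (.ix (.const 2) dim (.var 3) (.var 4))
      (.fop enc (· - ·) (ent (.var 3) (.var 4))
        (.fop enc (· * ·) (.var 6) (ent (.var 2) (.var 4)))))

/-- Both coefficients are saved before the pass over the columns, since that pass overwrites the
entries of column `k` on which they depend. -/
def coeffs : Cmd :=
  .seq (.setVar 5 (.fun₁ enc (fun a => (enc (pivotCoeff a) : ℕ)) (ent (.var 2) (.var 2))))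
    (.setVar 6 (.fop enc (· / ·) (ent (.var 3) (.var 2))
      (.fop enc (· + ·) (ent (.var 2) (.var 2))
        (.fop enc (· * ·) (.var 5) (ent (.var 3) (.var 2))))))

def step : Cmd :=
  .cond (.op .sub (.var 3) (.var 2)) (.seq (coeffs enc) (.for 4 dim (rowBody enc))) .skip

def diagBody : Cmd := .setVar 7 (.fop enc (· * ·) (.var 7) (ent (.var 2) (.var 2)))

def output : Cmd := .seq (.set 0 (.const 0) (.const 1)) (.set 0 (.const 1) (.var 7))

/-- Computes the determinant by Gaussian elimination. -/
def prog : Cmd :=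
  .seq (.for 2 dim (.for 3 dim (step enc)))
    (.seq (.setVar 7 (.const (enc 1))) (.seq (.for 2 dim (diagBody enc)) output))

/-- The memory holds the matrix `A`. -/
structure Holds (B n : ℕ) (A : Matrix (Fin n) (Fin n) F) (σ : State) : Prop where
  bd : σ.Bd B
  dim : σ 0 1 = n
  mat : σ.Mat enc 0 2 A

variable {enc}

theorem Holds.write {B n : ℕ} {A : Matrix (Fin n) (Fin n) F} {σ : State}
    (h : Holds enc B n A σ) {x i v : ℕ} (hx : x ≠ 0) (hv : v ≤ B) :
    Holds enc B n A (σ.write x i v) :=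
  ⟨h.bd.write hv _ _, by rw [State.write_of_ne hx.symm, h.dim], h.mat.write_of_ne hx.symm⟩

theorem Holds.write_ent {B n : ℕ} {A A' : Matrix (Fin n) (Fin n) F} {σ : State}
    (h : Holds enc B n A σ) (hp : Fintype.card F ≤ B) (i j : Fin n) (v : F)
    (hA : ∀ r c, A' r c = if r = i ∧ c = j then v else A r c) :
    Holds enc B n A' (σ.write 0 (2 + (i * n + j)) (enc v)) :=
  ⟨h.bd.write ((enc_lt v).le.trans hp) _ _, by rw [State.write_of_ne' (by omega), h.dim],
    h.mat.write i j v hA⟩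

theorem Holds.val_ent {B n : ℕ} {A : Matrix (Fin n) (Fin n) F} {σ : State}
    (h : Holds enc B n A σ) {a b : ℕ} (i j : Fin n) (h1 : σ a 0 = i)
    (h2 : σ b 0 = j) : (ent (.var a) (.var b)).val σ = enc (A i j) := by
  have := h.mat i j
  simp only [ent, Expr.val, Expr.val_ix, Expr.val_var, h1, h2, DetProg.dim, h.dim, this]

variable {B n : ℕ} (hB : 2 ≤ B) (hp : Fintype.card F ≤ B) (hn : n ≤ B)
include hB hp hn

/-- After `j` rounds the first `j` columns are those of the transformed matrix and the others are
still old. Within a column row `k` is updated first, and row `i` then uses its new entry. -/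
theorem tri_row {A : Matrix (Fin n) (Fin n) F} {k i : Fin n} (hki : k < i) {σ : State}
    (hσ : Holds enc B n A σ) (h2 : σ 2 0 = k) (h3 : σ 3 0 = i)
    (h5 : σ 5 0 = enc (pivotCoeff (A k k)))
    (h6 : σ 6 0 = enc (A i k / (A k k + pivotCoeff (A k k) * A i k))) :
    Tri (.for 4 dim (rowBody enc)) σ (((n + 1) * 1) * ((rowBody enc).K + forK dim) * B.size)
      fun s => Holds enc B n (elimStep k i A) s ∧ s 2 0 = k ∧ s 3 0 = i := by
  set c₁ := pivotCoeff (A k k) with hc₁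
  set c₂ := A i k / (A k k + c₁ * A i k) with hc₂
  refine Tri.for_mul (Tri.mono (Tri.for (n := n) (Inv := fun j s =>
    Holds enc B n (fun r c => if (c : ℕ) < j then elimStep k i A r c else A r c) s ∧
    s 2 0 = k ∧ s 3 0 = i ∧ s 5 0 = enc c₁ ∧ s 6 0 = enc c₂)
    hB hσ.bd ?_ ?_ ?_ ?_ ?_) le_rfl ?_) le_rfl
  · exact fun j s _ hs => hs.1.bd
  · exact fun j s _ hs => hs.1.dim
  · rintro s j v _ hv ⟨h1, h2, h3, h4, h5⟩
    refine ⟨h1.write (by decide) (hv.trans hn), ?_, ?_, ?_, ?_⟩ <;>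
    rwa [State.write_of_ne (by decide)]
  · exact ⟨by simpa using hσ, h2, h3, h5, h6⟩
  · rintro j s hj ⟨hs, h2, h3, h5, h6⟩ h4
    have hne : i ≠ k := hki.ne'
    set A₀ : Matrix (Fin n) (Fin n) F :=
      fun r c => if (c : ℕ) < j then elimStep k i A r c else A r c with hA₀
    set J : Fin n := ⟨j, hj⟩ with hJ
    have e1 : A₀ k J = A k J := by simp [hA₀, hJ]
    have e2 : A₀ i J = A i J := by simp [hA₀, hJ]
    rw [one_mul]
    refine Tri.simple (by trivial) hB hs.bd ?_
    simp only [rowBody, Cmd.exec]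
    have v1 : (Expr.ix (.const 2) dim (.var 2) (.var 4)).val s = 2 + ((k : ℕ) * n + J) := by
      simp [Expr.val, dim, hs.dim, h2, h4, hJ]
    rw [v1, Expr.val_fop _ (hs.val_ent k J h2 h4)
      (Expr.val_fop _ (e₁ := .var 5) (x := c₁) h5 (hs.val_ent i J h3 h4)),
      e1, e2]
    set w := A k J + c₁ * A i J with hw
    set A₁ : Matrix (Fin n) (Fin n) F := fun r c => if r = k ∧ c = J then w else A₀ r c with hA₁
    have hs1 := hs.write_ent hp k J w (A' := A₁) (fun _ _ => rfl)
    set s1 := s.write 0 (2 + ((k : ℕ) * n + J)) (enc w) with hs1def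
    have g : ∀ x, x ≠ 0 → ∀ y, s1 x y = s x y := fun x hx y => State.write_of_ne hx
    have v2 : (Expr.ix (.const 2) dim (.var 3) (.var 4)).val s1 = 2 + ((i : ℕ) * n + J) := by
      simp [Expr.val, dim, hs1.dim, g, h3, h4, hJ]
    rw [v2, Expr.val_fop _ (hs1.val_ent i J (a := 3) (b := 4) (by simp [g, h3]) (by simp [g, h4, hJ]))
      (Expr.val_fop _ (e₁ := .var 6) (x := c₂) (by simp [g, h6])
        (hs1.val_ent k J (a := 2) (b := 4) (by simp [g, h2]) (by simp [g, h4, hJ])))]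
    have f1 : A₁ i J = A i J := by simp [hA₁, hne, e2]
    have f2 : A₁ k J = w := by simp [hA₁]
    rw [f1, f2]
    refine ⟨⟨hs1.write_ent hp i J _ ?_, ?_, ?_, ?_, ?_⟩, ?_⟩
    · intro r c
      by_cases hc : c = J
      · subst hc
        by_cases hr : r = i
        · simp [hr, elimStep, hJ, hw, ← hc₁, ← hc₂]
        · by_cases hr' : r = k
          · subst hr'
            simp [hr, elimStep, hJ, hA₁, hw, ← hc₁]
          · simp [hr, hr', elimStep, hJ, hA₁, hA₀]
      · have : (c : ℕ) ≠ j := fun h => hc (Fin.ext h)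
        have h' : (c : ℕ) < j + 1 ↔ (c : ℕ) < j := by omega
        simp only [hA₁, hA₀, hc, h', and_false, if_false]
    all_goals rw [State.write_of_ne (by decide), g _ (by decide)]; assumption
  · rintro s ⟨h1, h2, h3, -⟩
    refine ⟨?_, h2, h3⟩
    simpa using h1

/-- The cost factor of `step`. -/
def stepK (enc : F ≃ Fin (Fintype.card F)) : ℕ :=
  1 + (Expr.op .sub (.var 3) (.var 2)).K + (coeffs enc).K + ((rowBody enc).K + forK dim)

theorem tri_step {A : Matrix (Fin n) (Fin n) F} {k i : Fin n} {σ : State}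
    (hσ : Holds enc B n A σ) (hA : Cleared k i A) (h2 : σ 2 0 = k) (h3 : σ 3 0 = i) :
    Tri (step enc) σ ((n + 1) * stepK enc * B.size)
      fun s => (∃ A', Holds enc B n A' s ∧ A'.det = A.det ∧ Cleared k (i + 1) A') ∧
        s 2 0 = k ∧ s 3 0 = i := by
  have hc := (Expr.op .sub (.var 3) (.var 2)).cost_le hB hσ.bd
  have hs := one_le_size hB
  refine Tri.mono (PTri.cond (t := (coeffs enc).K * B.size +
    ((n + 1) * 1) * ((rowBody enc).K + forK dim) * B.size) _ (fun he => ?_) (fun he => ?_)) ?_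
    (fun _ h => h)
  · have hki : k < i := by
      simp only [Expr.val, Op.eval, Expr.val_var, h2, h3] at he
      exact Fin.lt_def.2 (by omega)
    refine Tri.seq (Tri.simple (by exact ⟨trivial, trivial⟩) hB hσ.bd
      (Q := fun s => Holds enc B n A s ∧ s 2 0 = k ∧ s 3 0 = i ∧
      s 5 0 = enc (pivotCoeff (A k k)) ∧
      s 6 0 = enc (A i k / (A k k + pivotCoeff (A k k) * A i k))) ?_) ?_
    · simp only [coeffs, Cmd.exec, Cmd.exec_setVar]
      rw [Expr.val_fun₁ _ (hσ.val_ent k k h2 h2)]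
      have hs1 := hσ.write (x := 5) (i := 0) (v := enc (pivotCoeff (A k k))) (by decide)
        ((enc_lt _).le.trans hp)
      set s1 := σ.write 5 0 (enc (pivotCoeff (A k k))) with hs1def
      have g : ∀ x, x ≠ 5 → ∀ y, s1 x y = σ x y := fun x hx y => State.write_of_ne hx
      have g5 : s1 5 0 = enc (pivotCoeff (A k k)) := by simp [hs1def, State.write_apply]
      rw [Expr.val_fop _ (hs1.val_ent i k (a := 3) (b := 2) (by simp [g, h3]) (by simp [g, h2]))
        (Expr.val_fop _ (hs1.val_ent k k (a := 2) (b := 2) (by simp [g, h2]) (by simp [g, h2]))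
          (Expr.val_fop _ (e₁ := .var 5) (x := pivotCoeff (A k k)) (by simp [g5])
            (hs1.val_ent i k (a := 3) (b := 2) (by simp [g, h3]) (by simp [g, h2]))))]
      refine ⟨hs1.write (by decide) ((enc_lt _).le.trans hp), ?_, ?_, ?_, ?_⟩
      · rw [State.write_of_ne (by decide), g _ (by decide), h2]
      · rw [State.write_of_ne (by decide), g _ (by decide), h3]
      · rw [State.write_of_ne (by decide), g5]
      · simp [State.write_apply]
    · rintro s ⟨h, g2, g3, g5, g6⟩
      refine (tri_row hB hp hn hki h g2 g3 g5 g6).mono le_rfl ?_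
      rintro s ⟨h, g2, g3⟩
      exact ⟨⟨_, h, det_elimStep hki.ne _, hA.elimStep hki⟩, g2, g3⟩
  -- For `i ≤ k` the position `(i, k)` is not below the diagonal, so the counter advances without
  -- any work.
  · refine (Tri.simple (by trivial) hB hσ.bd (B := B) ?_).mono (t := Cmd.skip.K * B.size) ?_
      (fun _ h => h)
    · refine ⟨⟨A, hσ, rfl, ?_⟩, h2, h3⟩
      simp only [Expr.val, Op.eval, Expr.val_var, h2, h3] at he
      intro r c hrc hc
      have : (c : ℕ) < r := hrc
      exact hA r c hrc (by omega)
    · have : 1 ≤ ((n + 1) * 1) * ((rowBody enc).K + forK dim) :=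
        Nat.mul_pos (by omega) (by simp [forK])
      simp only [Cmd.K]
      nlinarith
  · simp only [stepK]
    nlinarith [Nat.zero_le (n * B.size * (1 + (Expr.op .sub (.var 3) (.var 2)).K +
      (coeffs enc).K))]

theorem tri_elim {A : Matrix (Fin n) (Fin n) F} {σ : State} (hσ : Holds enc B n A σ) :
    Tri (.for 2 dim (.for 3 dim (step enc))) σ
      ((n + 1) * ((n + 1) * (n + 1)) * (stepK enc + forK dim + forK dim) * B.size)
      fun s => ∃ A', Holds enc B n A' s ∧ A'.det = A.det ∧ Cleared n 0 A' := by
  refine Tri.for_mul (Tri.for (n := n) (Inv := fun k s =>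
    ∃ A', Holds enc B n A' s ∧ A'.det = A.det ∧ Cleared k 0 A') hB hσ.bd ?_ ?_ ?_ ?_ ?_)
    (Nat.mul_pos (by omega) (by omega))
  · rintro k s _ ⟨A', h, -⟩; exact h.bd
  · rintro k s _ ⟨A', h, -⟩; exact h.dim
  · rintro s k v _ hv ⟨A', h, h'⟩
    exact ⟨A', h.write (by decide) (hv.trans hn), h'⟩
  · exact ⟨A, hσ, rfl, fun r c _ hc => by omega⟩
  · rintro k s hk ⟨A', h, hdet, hcl⟩ h2
    refine Tri.for_mul (Tri.mono (Tri.for (n := n) (Inv := fun i s =>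
      (∃ A', Holds enc B n A' s ∧ A'.det = A.det ∧ Cleared k i A') ∧ s 2 0 = k) hB h.bd
      ?_ ?_ ?_ ?_ ?_) le_rfl ?_) (by omega)
    · rintro i s _ ⟨⟨A', h, -⟩, -⟩; exact h.bd
    · rintro i s _ ⟨⟨A', h, -⟩, -⟩; exact h.dim
    · rintro s i v _ hv ⟨⟨A', h, h'⟩, h2⟩
      exact ⟨⟨A', h.write (by decide) (hv.trans hn), h'⟩, by rwa [State.write_of_ne (by decide)]⟩
    · exact ⟨⟨A', h, hdet, hcl⟩, h2⟩
    · rintro i s hi ⟨⟨A', h, hdet, hcl⟩, h2⟩ h3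
      refine (tri_step hB hp hn h (k := ⟨k, hk⟩) (i := ⟨i, hi⟩) hcl h2 h3).mono le_rfl ?_
      rintro s ⟨⟨A'', h, hd, hcl⟩, g2, g3⟩
      exact ⟨⟨⟨A'', h, hd.trans hdet, hcl⟩, g2⟩, g3⟩
    · rintro s ⟨⟨A', h, hdet, hcl⟩, h2⟩
      -- Clearing column `k` in all `n` rows is the same as having cleared the columns before `k +
      -- 1`.
      refine ⟨⟨A', h, hdet, fun r c hrc hc => hcl r c hrc ?_⟩, h2⟩
      omega

theorem tri_diag {A : Matrix (Fin n) (Fin n) F} {σ : State} (hσ : Holds enc B n A σ)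
    (h7 : σ 7 0 = enc 1) :
    Tri (.for 2 dim (diagBody enc)) σ (((n + 1) * 1) * ((diagBody enc).K + forK dim) * B.size)
      fun s => s.Bd B ∧ s 7 0 = enc (∏ i, A i i) := by
  refine Tri.for_mul (Tri.mono (Tri.for (n := n) (Inv := fun k s => Holds enc B n A s ∧
    s 7 0 = enc (∏ i ∈ Finset.range k, if h : i < n then A ⟨i, h⟩ ⟨i, h⟩ else 1)) hB hσ.bd
    ?_ ?_ ?_ ?_ ?_) le_rfl ?_) le_rfl
  · exact fun _ _ _ h => h.1.bd
  · exact fun _ _ _ h => h.1.dim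
  · rintro s k v _ hv ⟨h, h7⟩
    exact ⟨h.write (by decide) (hv.trans hn), by rwa [State.write_of_ne (by decide)]⟩
  · exact ⟨hσ, by simpa using h7⟩
  · rintro k s hk ⟨h, h7⟩ h2
    rw [one_mul]
    refine Tri.simple (by trivial) hB h.bd ?_
    simp only [diagBody, Cmd.exec_setVar]
    rw [Expr.val_fop _ (e₁ := .var 7) h7 (h.val_ent ⟨k, hk⟩ ⟨k, hk⟩ h2 h2)]
    refine ⟨⟨h.write (by decide) ((enc_lt _).le.trans hp), ?_⟩, ?_⟩
    · simp [State.write_apply, Finset.prod_range_succ, hk]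
    · rw [State.write_of_ne (by decide), h2]
  · rintro s ⟨h, h7⟩
    refine ⟨h.bd, ?_⟩
    rw [h7, Finset.prod_range]
    simp

omit hp hn in
theorem tri_output {σ : State} {v : ℕ} (hσ : σ.Bd B) (h7 : σ 7 0 = v) :
    Tri output σ (output.K * B.size) fun s => s.read 0 = [v] := by
  refine Tri.simple (by exact ⟨trivial, trivial⟩) hB hσ ?_
  refine State.read_eq ?_ ?_
  · simp [output, Cmd.exec, State.write_apply, Expr.val]
  · intro j hj
    obtain rfl : j = 0 := by simpa using hj
    simp [output, Cmd.exec, State.write_apply, Expr.val, h7]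

omit hp hn in
theorem init_holds (A : Matrix (Fin n) (Fin n) F) (hn : n ^ 2 + 1 ≤ B)
    (hp : Fintype.card F ≤ B) (hnB : n ≤ B) : Holds enc B n A (State.init (encMat enc A)) := by
  refine ⟨State.Bd.init (by rwa [length_encMat]) fun v hv =>
    (mem_encMat_le A hv).trans (max_le hnB hp), ?_, ?_⟩
  · have := State.store_same (σ := fun _ _ => 0) (x := 0) (l := encMat enc A) (j := 0)
      (by simp [encMat])
    exact this.trans (by simp [encMat])
  · refine State.Mat.of_getD (l := encMat enc A) (o := 0) (fun j hj => State.store_same hj) ?_ ?_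
    · simp
    · simp [length_encMat]

end DetProg

variable {enc}

/-- Time bound of `DetProg.prog` in dimension `n`. -/
def detTime (enc : F ≃ Fin (Fintype.card F)) (n : ℕ) : ℕ :=
  (n + 2) ^ 3 * (4 + (DetProg.stepK enc + forK DetProg.dim + forK DetProg.dim) +
    (Cmd.setVar 7 (.const (enc 1))).K +
    ((DetProg.diagBody enc).K + forK DetProg.dim) + DetProg.output.K) *
    (n ^ 2 + 2 + Fintype.card F).size

theorem detProg_runsOn {n : ℕ} (A : Matrix (Fin n) (Fin n) F) :
    RunsOn (DetProg.prog enc) (encMat enc A) (detTime enc n) (PMF.pure [(enc A.det : ℕ)]) := by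
  -- This bounds the length of the input, all loop counters and all codes of field elements, and its
  -- bit length is logarithmic in `n`.
  set B := n ^ 2 + 2 + Fintype.card F with hBdef
  have hB : 2 ≤ B := by omega
  have hp : Fintype.card F ≤ B := by omega
  have hn : n ≤ B := by nlinarith
  have h0 := DetProg.init_holds (enc := enc) hB A (by omega) hp hn
  have hs := one_le_size hB
  have h : Tri (DetProg.prog enc) (State.init (encMat enc A)) _
      fun s => s.read 0 = [(enc A.det : ℕ)] :=
    Tri.seq (DetProg.tri_elim hB hp hn h0) fun s ⟨A', h, hd, hc⟩ =>
      Tri.seq (Tri.simple (by exact trivial) hB h.bd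
        (Q := fun s => DetProg.Holds enc B n A' s ∧ s 7 0 = enc 1)
        ⟨h.write (by decide) ((enc_lt _).le.trans hp), by simp [State.write_apply, Expr.val]⟩)
        fun s ⟨h, h7⟩ => Tri.seq (DetProg.tri_diag hB hp hn h h7) fun s ⟨hbd, h7⟩ =>
          DetProg.tri_output hB hbd (by rw [h7, ← hc.det, hd])
  have hr := h.runsOn (out := fun _ => [(enc A.det : ℕ)]) (u := 1 + B.size) (fun _ _ s hs => hs)
    fun _ _ => by
      have := Nat.size_le_size ((enc_lt (enc := enc) A.det).le.trans hp)
      simpa [listCost] using this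
  rw [PMF.pure_map] at hr
  refine hr.mono ?_
  have hin := listCost_le (l := encMat enc A) (B := B) fun v hv =>
    (mem_encMat_le A hv).trans (max_le hn hp)
  rw [length_encMat] at hin
  rw [detTime, ← hBdef]
  generalize (DetProg.stepK enc + forK DetProg.dim + forK DetProg.dim) = K₁
  generalize ((DetProg.diagBody enc).K + forK DetProg.dim) = K₂
  generalize (Cmd.setVar 7 (.const (enc 1))).K = K₃
  generalize DetProg.output.K = K₄
  generalize B.size = S at *
  have e1 : (n ^ 2 + 1) * (1 + S) ≤ 2 * (n + 2) ^ 3 * S - (1 + S) := by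
    have : 2 * (n ^ 2 + 2) ≤ 2 * (n + 2) ^ 3 := by nlinarith
    have : (n ^ 2 + 2) * (1 + S) ≤ 2 * (n + 2) ^ 3 * S := by nlinarith
    have : (n ^ 2 + 2) * (1 + S) = (n ^ 2 + 1) * (1 + S) + (1 + S) := by ring
    omega
  have e0 : 1 + S ≤ 2 * (n + 2) ^ 3 * S := by
    have : 1 ≤ (n + 2) ^ 3 := Nat.one_le_pow _ _ (by omega)
    nlinarith
  have e2 : (n + 1) * ((n + 1) * (n + 1)) ≤ (n + 2) ^ 3 := by nlinarith
  have e3 : (n + 1) * 1 ≤ (n + 2) ^ 3 := by nlinarith [Nat.one_le_pow 2 (n + 2) (by omega)]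
  have e4 : 1 ≤ (n + 2) ^ 3 := Nat.one_le_pow _ _ (by omega)
  calc _ ≤ (n ^ 2 + 1) * (1 + S) + ((n + 2) ^ 3 * K₁ * S + ((n + 2) ^ 3 * K₃ * S +
        ((n + 2) ^ 3 * K₂ * S + (n + 2) ^ 3 * K₄ * S))) + (1 + S) := by
        gcongr
        · exact Nat.le_mul_of_pos_left _ e4
        · exact Nat.le_mul_of_pos_left _ e4
    _ ≤ 2 * (n + 2) ^ 3 * S + ((n + 2) ^ 3 * K₁ * S + ((n + 2) ^ 3 * K₃ * S +
        ((n + 2) ^ 3 * K₂ * S + (n + 2) ^ 3 * K₄ * S))) := by omega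
    _ ≤ _ := by nlinarith [Nat.zero_le ((n + 2) ^ 3 * S)]

end

section

/-! ### Polynomial and soft-O bounds -/

/-- `f` is bounded by a polynomial. -/
def PolyB (f : ℕ → ℕ) : Prop := ∃ C k : ℕ, ∀ n, f n ≤ C * (n + 1) ^ k

theorem PolyB.mono {f g : ℕ → ℕ} (hg : PolyB g) (h : ∀ n, f n ≤ g n) : PolyB f := by
  obtain ⟨C, k, hC⟩ := hg
  exact ⟨C, k, fun n => (h n).trans (hC n)⟩

theorem PolyB.const (c : ℕ) : PolyB fun _ => c := ⟨c, 0, fun n => by simp⟩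

theorem PolyB.id : PolyB fun n => n := ⟨1, 1, fun n => by simp⟩

theorem PolyB.add {f g : ℕ → ℕ} (hf : PolyB f) (hg : PolyB g) : PolyB fun n => f n + g n := by
  obtain ⟨C, k, hC⟩ := hf
  obtain ⟨D, l, hD⟩ := hg
  refine ⟨C + D, k + l, fun n => ?_⟩
  have h1 : (n + 1) ^ k ≤ (n + 1) ^ (k + l) := Nat.pow_le_pow_right (by omega) (by omega)
  have h2 : (n + 1) ^ l ≤ (n + 1) ^ (k + l) := Nat.pow_le_pow_right (by omega) (by omega)
  calc f n + g n ≤ C * (n + 1) ^ (k + l) + D * (n + 1) ^ (k + l) :=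
        add_le_add ((hC n).trans (Nat.mul_le_mul_left _ h1))
          ((hD n).trans (Nat.mul_le_mul_left _ h2))
    _ = _ := by ring

theorem PolyB.mul {f g : ℕ → ℕ} (hf : PolyB f) (hg : PolyB g) : PolyB fun n => f n * g n := by
  obtain ⟨C, k, hC⟩ := hf
  obtain ⟨D, l, hD⟩ := hg
  refine ⟨C * D, k + l, fun n => (Nat.mul_le_mul (hC n) (hD n)).trans (le_of_eq ?_)⟩
  ring

theorem PolyB.pow {f : ℕ → ℕ} (hf : PolyB f) (k : ℕ) : PolyB fun n => f n ^ k := by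
  induction k with
  | zero => simpa using PolyB.const 1
  | succ k ih => simpa only [pow_succ] using ih.mul hf

theorem size_le_self (n : ℕ) : n.size ≤ n := Nat.size_le.2 Nat.lt_two_pow_self

theorem PolyB.size {f : ℕ → ℕ} (hf : PolyB f) : PolyB fun n => (f n).size :=
  hf.mono fun n => size_le_self (f n)

/-- This shape has a single parameter, is valid for all `n` including 0 and 1, and is easily
computed by a program; all budgets of subroutine calls have it. -/
theorem PolyB.exists_pow {f : ℕ → ℕ} (hf : PolyB f) : ∃ e, ∀ n, f n ≤ n ^ e + e := by
  obtain ⟨C, k, hC⟩ := hf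
  refine ⟨2 * k + C * 2 ^ k, fun n => (hC n).trans ?_⟩
  rcases n with _ | _ | n
  · have : C ≤ C * 2 ^ k := Nat.le_mul_of_pos_right _ (by positivity)
    simp only [zero_add, one_pow, mul_one]
    exact le_trans (by omega) (Nat.le_add_left _ _)
  · norm_num
    omega
  · refine le_trans ?_ (Nat.le_add_right _ _)
    have h1 : n + 1 + 1 + 1 ≤ (n + 2) ^ 2 := by nlinarith
    have h2 : C * 2 ^ k ≤ (n + 2) ^ (C * 2 ^ k) :=
      Nat.lt_two_pow_self.le.trans (Nat.pow_le_pow_left (by omega) _)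
    have h3 : C ≤ C * 2 ^ k := Nat.le_mul_of_pos_right _ (by positivity)
    calc C * (n + 1 + 1 + 1) ^ k ≤ (n + 2) ^ (C * 2 ^ k) * ((n + 2) ^ 2) ^ k := by
          gcongr
          exact h3.trans h2
      _ = _ := by rw [← pow_mul, ← pow_add, Nat.add_comm (C * 2 ^ k)]

/-- A polynomially bounded function is eventually at most `n ^ e`, for some `e`. -/
theorem PolyB.eventually_le {f : ℕ → ℕ} (hf : PolyB f) : ∃ e, ∀ᶠ n in atTop, f n ≤ n ^ e := by
  obtain ⟨e, he⟩ := hf.exists_pow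
  refine ⟨e + 1, ?_⟩
  filter_upwards [eventually_ge_atTop (e + 2)] with n hn
  have h1 : 1 ≤ n ^ e := Nat.one_le_pow _ _ (by omega)
  calc f n ≤ n ^ e + e := he n
    _ ≤ n ^ e * n := by nlinarith
    _ = _ := by ring

theorem eventually_one_le_log : ∀ᶠ n in atTop, 1 ≤ Nat.log 2 n := by
  filter_upwards [eventually_ge_atTop 2] with n hn
  exact Nat.log_pos (by omega) hn

theorem SoftO.of_le {f g : ℕ → ℕ} (C : ℕ) (h : ∀ᶠ n in atTop, f n ≤ C * g n) : SoftO f g :=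
  ⟨C, 0, by simpa using h⟩

theorem SoftO.mono {f f' g : ℕ → ℕ} (h : SoftO f g) (h' : ∀ᶠ n in atTop, f' n ≤ f n) :
    SoftO f' g := by
  obtain ⟨C, k, hC⟩ := h
  refine ⟨C, k, ?_⟩
  filter_upwards [hC, h'] with n h1 h2 using h2.trans h1

theorem SoftO.add {f f' g : ℕ → ℕ} (h : SoftO f g) (h' : SoftO f' g) :
    SoftO (fun n => f n + f' n) g := by
  obtain ⟨C, k, hC⟩ := h
  obtain ⟨D, l, hD⟩ := h'
  refine ⟨C + D, k + l, ?_⟩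
  filter_upwards [hC, hD, eventually_one_le_log] with n h1 h2 h3
  have e1 : Nat.log 2 n ^ k ≤ Nat.log 2 n ^ (k + l) := Nat.pow_le_pow_right h3 (by omega)
  have e2 : Nat.log 2 n ^ l ≤ Nat.log 2 n ^ (k + l) := Nat.pow_le_pow_right h3 (by omega)
  calc f n + f' n ≤ C * g n * Nat.log 2 n ^ (k + l) + D * g n * Nat.log 2 n ^ (k + l) :=
        add_le_add (h1.trans (Nat.mul_le_mul_left _ e1)) (h2.trans (Nat.mul_le_mul_left _ e2))
    _ = _ := by ring

theorem SoftO.mul {f f' g g' : ℕ → ℕ} (h : SoftO f g) (h' : SoftO f' g') :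
    SoftO (fun n => f n * f' n) fun n => g n * g' n := by
  obtain ⟨C, k, hC⟩ := h
  obtain ⟨D, l, hD⟩ := h'
  refine ⟨C * D, k + l, ?_⟩
  filter_upwards [hC, hD] with n h1 h2
  exact (Nat.mul_le_mul h1 h2).trans (le_of_eq (by ring))

theorem SoftO.trans {f g h : ℕ → ℕ} (h₁ : SoftO f g) (h₂ : SoftO g h) : SoftO f h := by
  obtain ⟨C, k, hC⟩ := h₁
  obtain ⟨D, l, hD⟩ := h₂
  refine ⟨C * D, k + l, ?_⟩
  filter_upwards [hC, hD] with n h1 h2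
  calc f n ≤ C * (D * h n * Nat.log 2 n ^ l) * Nat.log 2 n ^ k := h1.trans (by gcongr)
    _ = _ := by ring

theorem SoftO.const (c : ℕ) : SoftO (fun _ => c) fun _ => 1 :=
  .of_le c (by simp)

theorem SoftO.mul_one {f f' g : ℕ → ℕ} (h : SoftO f g) (h' : SoftO f' fun _ => 1) :
    SoftO (fun n => f n * f' n) g := by
  simpa using h.mul h'

theorem SoftO.const_mul {f g : ℕ → ℕ} (c : ℕ) (h : SoftO f g) : SoftO (fun n => c * f n) g := by
  simpa using (SoftO.const c).mul h

theorem softO_size_pow (e : ℕ) : SoftO (fun n => (n ^ e).size) fun _ => 1 := by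
  refine ⟨2 * (e + 1), 1, ?_⟩
  filter_upwards [eventually_one_le_log] with n hn
  have h1 : n.size ≤ Nat.log 2 n + 1 := Nat.size_le.2 (Nat.lt_pow_succ_log_self (by omega) n)
  have h2 : (n ^ e).size ≤ (n ^ (e + 1)).size := by
    refine Nat.size_le_size (Nat.pow_le_pow_right ?_ (by omega))
    rcases Nat.eq_zero_or_pos n with rfl | h
    · simp at hn
    · exact h
  have h3 := size_pow_le n (e + 1) (by omega)
  calc _ ≤ (e + 1) * n.size := h2.trans h3
    _ ≤ (e + 1) * (2 * Nat.log 2 n) := Nat.mul_le_mul_left _ (by omega)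
    _ = _ := by ring

/-- Polynomially bounded numbers have logarithmic bit length, so the logarithmic cost of handling
them disappears in the soft-O. -/
theorem softO_size {f : ℕ → ℕ} (hf : PolyB f) : SoftO (fun n => (f n).size) fun _ => 1 := by
  obtain ⟨e, he⟩ := hf.eventually_le
  exact (softO_size_pow e).mono (he.mono fun n h => Nat.size_le_size h)

/-- A soft-O of a polynomially bounded function is eventually at most a power of `n`. -/
theorem SoftO.eventually_le {f g : ℕ → ℕ} (h : SoftO f g) (hg : PolyB g) :
    ∃ e, ∀ᶠ n in atTop, f n ≤ n ^ e := by
  obtain ⟨C, k, hC⟩ := h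
  have : PolyB fun n => C * g n * Nat.log 2 n ^ k :=
    ((PolyB.const C).mul hg).mul ((PolyB.id.mono fun n => Nat.log_le_self 2 n).pow k)
  obtain ⟨e, he⟩ := this.eventually_le
  refine ⟨e, ?_⟩
  filter_upwards [hC, he] with n h1 h2 using h1.trans h2

variable {F : Type*} [Field F] [Fintype F] {enc : F ≃ Fin (Fintype.card F)}

theorem polyB_detTime : PolyB (detTime enc) :=
  (((PolyB.id.add (.const 2)).pow 3).mul (.const _)).mul
    (((PolyB.id.pow 2).add (.const 2)).add (.const (Fintype.card F))).size

end

section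

/-! ### Random matrices -/

variable {F : Type*} [Field F] [Fintype F]

section Fibres

variable {n : ℕ}

open Classical in
/-- Among the translates of `R` by the matrices `y ⬝ uᵀ`, no value of the determinant is more
frequent than `0`. -/
theorem card_det_translate_le {u : Fin n → F} (hu : u ≠ 0) (R : Matrix (Fin n) (Fin n) F) (z : F) :
    (Finset.univ.filter fun y : Fin n → F => (R + Matrix.vecMulVec y u).det = z).card ≤
      (Finset.univ.filter fun y : Fin n → F => (R + Matrix.vecMulVec y u).det = 0).card := by
  rcases eq_or_ne z 0 with rfl | hz
  · exact le_rfl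
  by_cases hex : ∃ y₀ : Fin n → F, (R + Matrix.vecMulVec y₀ u).det = z
  · obtain ⟨y₀, hy₀⟩ := hex
    set R₁ := R + Matrix.vecMulVec y₀ u with hR₁
    have hunit : IsUnit R₁.det := by rw [hy₀]; exact hz.isUnit
    -- The matrix determinant lemma at an invertible translate `R₁`: along the family the
    -- determinant is an affine function of `y`.
    have key : ∀ y, (R + Matrix.vecMulVec y u).det =
        z * (1 + u ⬝ᵥ (R₁⁻¹.mulVec (y - y₀))) := by
      intro y
      have h := Matrix.det_add_replicateCol_mul_replicateRow (ι := Unit) hunit (y - y₀) u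
      rw [hy₀] at h
      have e : R₁ + Matrix.replicateCol Unit (y - y₀) * Matrix.replicateRow Unit u =
          R + Matrix.vecMulVec y u := by
        rw [← Matrix.vecMulVec_eq, hR₁, add_assoc, ← Matrix.add_vecMulVec, add_sub_cancel]
      rw [e] at h
      rw [h]
      congr 1
      rw [Matrix.mul_assoc]
      simp [Matrix.det_unique, Matrix.mul_apply, dotProduct, Matrix.mulVec]
    obtain ⟨j, hj⟩ : ∃ j, u j ≠ 0 := by
      by_contra h
      push Not at h
      exact hu (funext h)
    -- Chosen so that the linear part of the affine function takes the value -1 at `x₀`; translation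
    -- by `x₀` then carries the fibre over `z` injectively into the fibre over 0.
    set x₀ : Fin n → F := -(R₁.mulVec (Pi.single j (u j)⁻¹)) with hx₀
    have hgx : u ⬝ᵥ (R₁⁻¹.mulVec x₀) = -1 := by
      rw [hx₀, Matrix.mulVec_neg, Matrix.mulVec_mulVec, Matrix.nonsing_inv_mul _ hunit,
        Matrix.one_mulVec, dotProduct_neg, dotProduct_single, mul_inv_cancel₀ hj]
    refine Finset.card_le_card_of_injOn (fun y => y + x₀) ?_ ?_
    · intro y hy
      simp only [Finset.coe_filter, Finset.mem_univ, true_and, Set.mem_ofPred_eq] at hy ⊢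
      rw [key] at hy ⊢
      have h1 : u ⬝ᵥ (R₁⁻¹.mulVec (y - y₀)) = 0 := by
        have := mul_left_cancel₀ hz (hy.trans (mul_one z).symm)
        simpa using this
      rw [add_sub_right_comm, Matrix.mulVec_add, dotProduct_add, h1, hgx]
      simp
    · intro a _ b _ h
      exact add_right_cancel h
  · push Not at hex
    rw [Finset.filter_false_of_mem (fun y _ => hex y)]
    simp

open Classical in
/-- For singular `A`, the determinant of `R` cannot be guessed from `R * A` better than by the
constant `0`. -/
theorem sum_guess_le {A : Matrix (Fin n) (Fin n) F} (hA : A.det = 0)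
    (h : Matrix (Fin n) (Fin n) F → F → ℝ) (h0 : ∀ B z, 0 ≤ h B z) (h1 : ∀ B, ∑ z, h B z = 1)
    {d : F} (hd : d ≠ 0) :
    ∑ R : Matrix (Fin n) (Fin n) F, h (R * A) (d * R.det) ≤
      ((Finset.univ.filter fun R : Matrix (Fin n) (Fin n) F => R.det = 0).card : ℝ) := by
  obtain ⟨u, hu, huA⟩ := Matrix.exists_vecMul_eq_zero_iff.2 hA
  have hmul : ∀ (R : Matrix (Fin n) (Fin n) F) (y : Fin n → F),
      (R + Matrix.vecMulVec y u) * A = R * A := by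
    intro R y
    rw [Matrix.add_mul, Matrix.vecMulVec_mul, huA]
    ext i j
    simp [Matrix.vecMulVec]
  -- Summing over all `R` may be replaced by averaging over the translates of each `R`, along which
  -- `R * A`, and hence the guess, is constant.
  have avg : ∀ f : Matrix (Fin n) (Fin n) F → ℝ,
      ∑ R, ∑ y : Fin n → F, f (R + Matrix.vecMulVec y u) =
        (Fintype.card (Fin n → F) : ℝ) * ∑ R, f R := by
    intro f
    rw [Finset.sum_comm]
    have : ∀ y : Fin n → F, ∑ R, f (R + Matrix.vecMulVec y u) = ∑ R, f R := fun y =>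
      Equiv.sum_comp (Equiv.addRight (Matrix.vecMulVec y u)) f
    simp [this]
  have hcard : (0 : ℝ) < Fintype.card (Fin n → F) := by exact_mod_cast Fintype.card_pos
  have e : ((Finset.univ.filter fun R : Matrix (Fin n) (Fin n) F => R.det = 0).card : ℝ) =
      ∑ R : Matrix (Fin n) (Fin n) F, if R.det = 0 then 1 else 0 := by simp
  rw [e]
  refine le_of_mul_le_mul_left ?_ hcard
  rw [← avg, ← avg]
  refine Finset.sum_le_sum fun R _ => ?_
  simp only [hmul]
  set φ : (Fin n → F) → F := fun y => (R + Matrix.vecMulVec y u).det with hφ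
  have e1 : ∑ y, h (R * A) (d * φ y) =
      ∑ z, h (R * A) (d * z) * ((Finset.univ.filter fun y => φ y = z).card : ℝ) := by
    rw [← Finset.sum_fiberwise Finset.univ φ]
    refine Finset.sum_congr rfl fun z _ => ?_
    rw [Finset.sum_congr rfl (g := fun _ => h (R * A) (d * z)), Finset.sum_const, nsmul_eq_mul,
      mul_comm]
    intro y hy
    rw [(Finset.mem_filter.1 hy).2]
  change ∑ y, h (R * A) (d * φ y) ≤ ∑ y, if φ y = 0 then (1 : ℝ) else 0
  rw [e1]
  calc _ ≤ ∑ z, h (R * A) (d * z) * ((Finset.univ.filter fun y => φ y = 0).card : ℝ) := by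
        refine Finset.sum_le_sum fun z _ => mul_le_mul_of_nonneg_left ?_ (h0 _ _)
        exact_mod_cast card_det_translate_le hu R z
    _ = _ := by
        -- As `d ≠ 0`, the values `d * z` run through the whole field, so the weights of the guess
        -- still sum to 1.
        have e2 := Equiv.sum_comp (Equiv.mulLeft₀ d hd) (fun z => h (R * A) z)
        change ∑ z, h (R * A) (d * z) = _ at e2
        rw [← Finset.sum_mul, e2, h1]
        simp

end Fibres

/-! ### One comparison of `R` and `R * A` -/

/-- `δ` is applied to `R` and to `R * A`, with independent random choices. -/
def pairLaw {n : ℕ} (δ : Matrix (Fin n) (Fin n) F → PMF F) (A R : Matrix (Fin n) (Fin n) F) :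
    PMF (F × F) :=
  (δ R).bind fun x => (δ (R * A)).map fun y => (x, y)

/-- The pairs that support the value `d` of the determinant. -/
def ratioSet (d : F) : Set (F × F) := {z | z.2 = d * z.1}

theorem sum_toReal (p : PMF F) : ∑ x, (p x).toReal = 1 := by
  rw [← ENNReal.toReal_sum fun x _ => p.apply_ne_top x, ← tsum_fintype (L := .unconditional _),
    p.tsum_coe, ENNReal.toReal_one]

theorem toReal_le_one {α : Type*} (p : PMF α) (x : α) : (p x).toReal ≤ 1 :=
  ENNReal.toReal_le_of_le_ofReal zero_le_one (by simpa using p.coe_le_one x)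

theorem toOuterMeasure_le_one {α : Type*} (p : PMF α) (s : Set α) : p.toOuterMeasure s ≤ 1 := by
  rw [PMF.toOuterMeasure_apply, ← p.tsum_coe]
  exact ENNReal.tsum_le_tsum fun a => Set.indicator_le_self' (fun _ _ => bot_le) a

theorem pairLaw_ratioSet {n : ℕ} (δ : Matrix (Fin n) (Fin n) F → PMF F)
    (A R : Matrix (Fin n) (Fin n) F) (d : F) :
    ((pairLaw δ A R).toOuterMeasure (ratioSet d)).toReal =
      ∑ x, (δ R x).toReal * (δ (R * A) (d * x)).toReal := by
  rw [pairLaw, PMF.toOuterMeasure_bind_apply, tsum_fintype, ENNReal.toReal_sum]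
  · refine Finset.sum_congr rfl fun x _ => ?_
    rw [ENNReal.toReal_mul, PMF.toOuterMeasure_map_apply]
    congr 2
    rw [← PMF.toOuterMeasure_apply_singleton]
    congr 1
  · intro x _
    refine ENNReal.mul_ne_top (PMF.apply_ne_top _ _) (ne_top_of_le_ne_top ENNReal.one_ne_top ?_)
    exact toOuterMeasure_le_one _ _

/-- Either the first answer differs from `x`, or the second one must be `d * x`. It is applied with
`x = R.det`. -/
theorem pairLaw_ratioSet_le {n : ℕ} (δ : Matrix (Fin n) (Fin n) F → PMF F)
    (A R : Matrix (Fin n) (Fin n) F) (d x : F) :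
    ((pairLaw δ A R).toOuterMeasure (ratioSet d)).toReal ≤
      (1 - (δ R x).toReal) + (δ (R * A) (d * x)).toReal := by
  classical
  rw [pairLaw_ratioSet, ← Finset.add_sum_erase _ _ (Finset.mem_univ x)]
  have h1 : ∑ y ∈ Finset.univ.erase x, (δ R y).toReal * (δ (R * A) (d * y)).toReal ≤
      1 - (δ R x).toReal := by
    rw [← sum_toReal (δ R), ← Finset.add_sum_erase _ _ (Finset.mem_univ x), add_sub_cancel_left]
    refine Finset.sum_le_sum fun y _ => ?_
    exact mul_le_of_le_one_right ENNReal.toReal_nonneg (toReal_le_one _ _)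
  have h2 : (δ R x).toReal * (δ (R * A) (d * x)).toReal ≤ (δ (R * A) (d * x)).toReal :=
    mul_le_of_le_one_left ENNReal.toReal_nonneg (toReal_le_one _ _)
  linarith

theorem le_pairLaw_ratioSet {n : ℕ} (δ : Matrix (Fin n) (Fin n) F → PMF F)
    (A R : Matrix (Fin n) (Fin n) F) (d x : F) :
    (δ R x).toReal + (δ (R * A) (d * x)).toReal - 1 ≤
      ((pairLaw δ A R).toOuterMeasure (ratioSet d)).toReal := by
  classical
  rw [pairLaw_ratioSet]
  have h1 : (δ R x).toReal * (δ (R * A) (d * x)).toReal ≤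
      ∑ y, (δ R y).toReal * (δ (R * A) (d * y)).toReal :=
    Finset.single_le_sum (f := fun y => (δ R y).toReal * (δ (R * A) (d * y)).toReal)
      (fun y _ => mul_nonneg ENNReal.toReal_nonneg ENNReal.toReal_nonneg) (Finset.mem_univ x)
  nlinarith [toReal_le_one (δ R) x, toReal_le_one (δ (R * A)) (d * x)]

/-- The probability that `pairLaw` supports `d`, averaged over `R`. -/
def ratioProb {n : ℕ} (δ : Matrix (Fin n) (Fin n) F → PMF F) (A : Matrix (Fin n) (Fin n) F)
    (d : F) : ℝ :=
  (∑ R, ((pairLaw δ A R).toOuterMeasure (ratioSet d)).toReal) /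
    (Fintype.card (Matrix (Fin n) (Fin n) F) : ℝ)

/-! ### Support probabilities for uniform R -/

section Average

variable {n : ℕ} {δ : Matrix (Fin n) (Fin n) F → PMF F} {e : ℝ}
  (hδ : (1 - e) * (Fintype.card (Matrix (Fin n) (Fin n) F) : ℝ) ≤ ∑ R, (δ R R.det).toReal)

theorem card_matrix_pos : (0 : ℝ) < Fintype.card (Matrix (Fin n) (Fin n) F) := by
  exact_mod_cast Fintype.card_pos

theorem sum_mul_unit {A : Matrix (Fin n) (Fin n) F} (hA : A.det ≠ 0)
    (f : Matrix (Fin n) (Fin n) F → ℝ) : ∑ R, f (R * A) = ∑ R, f R := by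
  have hu : IsUnit A := (Matrix.isUnit_iff_isUnit_det A).2 hA.isUnit
  obtain ⟨U, rfl⟩ := hu
  exact Equiv.sum_comp (Units.mulRight U) f

/-- The fraction of singular matrices. -/
def singFrac (F : Type*) [Field F] [Fintype F] (n : ℕ) : ℝ :=
  open Classical in
  ((Finset.univ.filter fun R : Matrix (Fin n) (Fin n) F => R.det = 0).card : ℝ) /
    (Fintype.card (Matrix (Fin n) (Fin n) F) : ℝ)

include hδ

/-- Union bound over the two answers: right multiplication by an invertible matrix permutes the
matrices, so the average error on `R * A` is again at most `e`. -/
theorem ratioProb_det {A : Matrix (Fin n) (Fin n) F} (hA : A.det ≠ 0) :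
    1 - 2 * e ≤ ratioProb δ A A.det := by
  rw [ratioProb, le_div_iff₀ card_matrix_pos]
  have h1 : ∀ R, (δ R R.det).toReal + (δ (R * A) (R * A).det).toReal - 1 ≤
      ((pairLaw δ A R).toOuterMeasure (ratioSet A.det)).toReal := fun R => by
    rw [Matrix.det_mul, mul_comm R.det]
    exact le_pairLaw_ratioSet δ A R A.det R.det
  have h2 := Finset.sum_le_sum fun R (_ : R ∈ Finset.univ) => h1 R
  rw [Finset.sum_sub_distrib, Finset.sum_add_distrib,
    sum_mul_unit hA fun R => (δ R R.det).toReal] at h2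
  simp only [Finset.sum_const, nsmul_eq_mul, mul_one, Finset.card_univ] at h2
  linarith

/-- For invertible `R` the values `d * R.det` and `(R * A).det` differ, so supporting `d` requires
one of the two answers to be wrong. Singular `R` are given up entirely. -/
theorem ratioProb_ne {A : Matrix (Fin n) (Fin n) F} (hA : A.det ≠ 0) {d : F} (hd : d ≠ A.det) :
    ratioProb δ A d ≤ singFrac F n + 2 * e := by
  classical
  rw [ratioProb, div_le_iff₀ card_matrix_pos, singFrac, add_mul,
    div_mul_cancel₀ _ card_matrix_pos.ne']
  have h1 : ∀ R, ((pairLaw δ A R).toOuterMeasure (ratioSet d)).toReal ≤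
      (if R.det = 0 then 1 else 0) + (1 - (δ R R.det).toReal) +
        (1 - (δ (R * A) (R * A).det).toReal) := fun R => by
    split_ifs with hR
    · have h3 := pairLaw_ratioSet_le δ A R d R.det
      have h4 := toReal_le_one (δ (R * A)) (R * A).det
      have h5 := toReal_le_one (δ (R * A)) (d * R.det)
      linarith
    · have h3 := pairLaw_ratioSet_le δ A R d R.det
      have hne : d * R.det ≠ (R * A).det := by
        rw [Matrix.det_mul, mul_comm R.det]
        exact fun h => hd (mul_right_cancel₀ hR h)
      have h4 : (δ (R * A) (d * R.det)).toReal + (δ (R * A) (R * A).det).toReal ≤ 1 := by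
        rw [← sum_toReal (δ (R * A)), ← Finset.sum_pair (f := fun z => (δ (R * A) z).toReal) hne]
        exact Finset.sum_le_sum_of_subset_of_nonneg (Finset.subset_univ _)
          fun _ _ _ => ENNReal.toReal_nonneg
      linarith
  have h2 := Finset.sum_le_sum fun R (_ : R ∈ Finset.univ) => h1 R
  rw [Finset.sum_add_distrib, Finset.sum_add_distrib,
    sum_mul_unit hA fun R => 1 - (δ R R.det).toReal, Finset.sum_sub_distrib] at h2
  simp only [Finset.sum_const, nsmul_eq_mul, mul_one, Finset.card_univ, Finset.sum_boole] at h2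
  linarith

/-- Here `R * A` is never uniform, so the answer on it is treated as an arbitrary guess of `d *
R.det` from `R * A`. Only the error on `R` itself is paid for, hence `e` and not `2 * e`. -/
theorem ratioProb_singular {A : Matrix (Fin n) (Fin n) F} (hA : A.det = 0) {d : F} (hd : d ≠ 0) :
    ratioProb δ A d ≤ singFrac F n + e := by
  classical
  rw [ratioProb, div_le_iff₀ card_matrix_pos, singFrac, add_mul,
    div_mul_cancel₀ _ card_matrix_pos.ne']
  have h2 := Finset.sum_le_sum fun R (_ : R ∈ Finset.univ) => pairLaw_ratioSet_le δ A R d R.det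
  rw [Finset.sum_add_distrib, Finset.sum_sub_distrib] at h2
  have h3 := sum_guess_le hA (fun B z => (δ B z).toReal) (fun _ _ => ENNReal.toReal_nonneg)
    (fun B => sum_toReal (δ B)) hd
  simp only [Finset.sum_const, nsmul_eq_mul, mul_one, Finset.card_univ] at h2
  convert h2.trans (add_le_add_right h3 _) |>.trans ?_ using 1
  linarith

end Average

/-! ### The fraction of singular matrices -/

theorem card_ratio_bddBelow : BddBelow (Set.range fun n : ℕ =>
    (Nat.card (Matrix.GeneralLinearGroup (Fin n) F) : ℝ) /
      (Nat.card (Matrix (Fin n) (Fin n) F) : ℝ)) :=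
  ⟨0, by rintro _ ⟨n, rfl⟩; positivity⟩

theorem singFrac_eq (n : ℕ) : singFrac F n =
    1 - (Nat.card (Matrix.GeneralLinearGroup (Fin n) F) : ℝ) /
      (Nat.card (Matrix (Fin n) (Fin n) F) : ℝ) := by
  classical
  have h1 : (Nat.card (Matrix.GeneralLinearGroup (Fin n) F)) =
      (Finset.univ.filter fun R : Matrix (Fin n) (Fin n) F => R.det ≠ 0).card := by
    rw [← Fintype.card_subtype, ← Nat.card_eq_fintype_card]
    refine Nat.card_congr
      ⟨fun U => ⟨U, (U.isUnit.map Matrix.detMonoidHom).ne_zero⟩,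
        fun R => Matrix.GeneralLinearGroup.mk'' R.1 R.2.isUnit, fun U => ?_, fun R => ?_⟩
    · ext; rfl
    · rfl
  have h2 := Finset.card_filter_add_card_filter_not (s := Finset.univ)
    fun R : Matrix (Fin n) (Fin n) F => R.det = 0
  rw [h1, Nat.card_eq_fintype_card, singFrac, eq_sub_iff_add_eq, ← add_div,
    div_eq_one_iff_eq card_matrix_pos.ne']
  rw [← Finset.card_univ, ← h2]
  push_cast
  congr

theorem singFrac_le (n : ℕ) : singFrac F n ≤ qSing F := by
  rw [singFrac_eq, qSing]
  have := ciInf_le (card_ratio_bddBelow (F := F)) n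
  linarith

theorem qSing_nonneg : 0 ≤ qSing F := by
  refine le_trans ?_ (singFrac_le 0)
  unfold singFrac
  positivity

/-- The extra term makes the induction work: with `t = 1 / 2 ^ (n + 1)`, the next factor is at least
`1 - t`, and `(1/4 + t) * (1 - t) ≥ 1/4 + t/2` as soon as `t ≤ 1/4`, that is, from `n = 1` on. -/
theorem card_GL_ge (n : ℕ) : (1 / 4 : ℝ) + 1 / 2 ^ (n + 1) ≤
    ∏ i : Fin n, (1 - 1 / (Fintype.card F : ℝ) ^ ((i : ℕ) + 1)) ∨ n = 0 := by
  rcases Nat.eq_zero_or_pos n with rfl | hn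
  · exact Or.inr rfl
  refine Or.inl ?_
  have hq : (2 : ℝ) ≤ Fintype.card F := by exact_mod_cast Fintype.one_lt_card
  have hpow : ∀ k : ℕ, 1 / (Fintype.card F : ℝ) ^ k ≤ 1 / 2 ^ k := fun k => by gcongr
  induction n, hn using Nat.le_induction with
  | base =>
    have := hpow 1
    norm_num at this ⊢
    linarith
  | succ n hn ih =>
    rw [Fin.prod_univ_castSucc]
    simp only [Fin.val_castSucc, Fin.val_last]
    have h1 := hpow (n + 1)
    have h2 : (1 : ℝ) / 2 ^ (n + 1) ≤ 1 / 4 := by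
      have : (4 : ℝ) ≤ 2 ^ (n + 1) := by
        calc (4 : ℝ) = 2 ^ 2 := by norm_num
          _ ≤ _ := pow_le_pow_right₀ (by norm_num) (by omega)
      exact one_div_le_one_div_of_le (by norm_num) this
    have h3 : (0 : ℝ) < 1 / 2 ^ (n + 1) := by positivity
    have h4 : (1 : ℝ) / 2 ^ (n + 1 + 1) = (1 / 2 ^ (n + 1)) / 2 := by
      rw [pow_succ]; field_simp
    rw [h4]
    set t : ℝ := 1 / 2 ^ (n + 1)
    calc 1 / 4 + t / 2 ≤ (1 / 4 + t) * (1 - t) := by nlinarith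
      _ ≤ _ := mul_le_mul ih (by linarith) (by linarith) (by linarith)

theorem qSing_le : qSing F ≤ 3 / 4 := by
  have : (1 / 4 : ℝ) ≤ ⨅ n : ℕ, (Nat.card (Matrix.GeneralLinearGroup (Fin n) F) : ℝ) /
      (Nat.card (Matrix (Fin n) (Fin n) F) : ℝ) := by
    refine le_ciInf fun n => ?_
    have hq : (2 : ℝ) ≤ Fintype.card F := by exact_mod_cast Fintype.one_lt_card
    have hq0 : (Fintype.card F : ℝ) ≠ 0 := by positivity
    have e : (Nat.card (Matrix.GeneralLinearGroup (Fin n) F) : ℝ) /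
      (Nat.card (Matrix (Fin n) (Fin n) F) : ℝ) =
        ∏ i : Fin n, (1 - 1 / (Fintype.card F : ℝ) ^ ((i : ℕ) + 1)) := by
      rw [Matrix.card_GL_field, Nat.card_eq_fintype_card]
      have : Fintype.card (Matrix (Fin n) (Fin n) F) = ∏ _i : Fin n, Fintype.card F ^ n := by
        rw [← Nat.card_eq_fintype_card]
        change Nat.card (Fin n → Fin n → F) = _
        simp [Nat.card_eq_fintype_card]
      rw [this]
      push_cast
      rw [← Finset.prod_div_distrib, ← Equiv.prod_comp Fin.revPerm]
      refine Finset.prod_congr rfl fun i _ => ?_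
      -- After reversing the order of the factors, `(q ^ n - q ^ (n - 1 - i)) / q ^ n` is `1 - 1 / q
      -- ^ (i + 1)`, where `q` is the number of field elements.
      have hi := i.2
      rw [Nat.cast_sub (Nat.pow_le_pow_right Fintype.card_pos (Fin.revPerm i).is_lt.le)]
      push_cast
      rw [sub_div, div_self (by positivity), Fin.revPerm_apply, Fin.val_rev]
      congr 1
      rw [div_eq_div_iff (by positivity) (by positivity), one_mul, ← pow_add]
      congr 1
      omega
    rw [e]
    rcases card_GL_ge (F := F) n with h | rfl
    · refine le_trans ?_ h
      have : (0 : ℝ) < 1 / 2 ^ (n + 1) := by positivity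
      linarith
    · norm_num
  rw [qSing]
  linarith

end

section

/-! ### Tail bounds for independent trials -/

section Tail

variable {α β : Type*}

/-- The expectation of a nonnegative function. -/
def expect (p : PMF α) (f : α → ENNReal) : ENNReal := ∑' a, p a * f a

theorem expect_pure (a : α) (f : α → ENNReal) : expect (PMF.pure a) f = f a := by
  rw [expect, tsum_eq_single a]
  · simp
  · intro b hb
    simp [hb]

theorem expect_bind (p : PMF α) (κ : α → PMF β) (f : β → ENNReal) :
    expect (p.bind κ) f = expect p fun a => expect (κ a) f := by
  simp only [expect, PMF.bind_apply, ← ENNReal.tsum_mul_right, ← ENNReal.tsum_mul_left]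
  rw [ENNReal.tsum_comm]
  simp only [mul_assoc]

theorem expect_map (p : PMF α) (g : α → β) (f : β → ENNReal) :
    expect (p.map g) f = expect p fun a => f (g a) := by
  rw [PMF.map, expect_bind]
  simp only [Function.comp_apply, expect_pure]

theorem expect_mono {p : PMF α} {f g : α → ENNReal} (h : ∀ a, f a ≤ g a) :
    expect p f ≤ expect p g :=
  ENNReal.tsum_le_tsum fun a => mul_le_mul_right (h a) _

theorem expect_mul_const (p : PMF α) (f : α → ENNReal) (c : ENNReal) :
    expect p (fun a => f a * c) = expect p f * c := by
  simp only [expect, ← mul_assoc, ENNReal.tsum_mul_right]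

theorem expect_indicator (p : PMF α) (s : Set α) (c : ENNReal) :
    expect p (s.indicator fun _ => c) = p.toOuterMeasure s * c := by
  rw [PMF.toOuterMeasure_apply, expect, ← ENNReal.tsum_mul_right]
  refine tsum_congr fun a => ?_
  by_cases h : a ∈ s <;> simp [h]

open Classical in
/-- The number of members of `E` in a list. -/
def hits (E : Set α) : List α → ℕ
  | [] => 0
  | a :: l => (if a ∈ E then 1 else 0) + hits E l

open Classical in
theorem hits_add_hits_compl (E : Set α) (l : List α) : hits E l + hits Eᶜ l = l.length := by
  induction l with
  | nil => rfl
  | cons a l ih =>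
    by_cases h : a ∈ E <;> simp [hits, h] <;> omega

theorem hits_le_length (E : Set α) (l : List α) : hits E l ≤ l.length := by
  rw [← hits_add_hits_compl E l]
  omega

/-- The outcomes of `m` independent trials. -/
def trials (τ : PMF α) (m : ℕ) : PMF (List α) := iterPMF (fun l => τ.map (· :: l)) m []

theorem length_of_mem_trials {τ : PMF α} {m : ℕ} {l : List α} (h : l ∈ (trials τ m).support) :
    l.length = m := by
  have key : ∀ m (l₀ l : List α), l ∈ (iterPMF (fun l => τ.map (· :: l)) m l₀).support →
      l.length = m + l₀.length := by
    intro m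
    induction m with
    | zero =>
      intro l₀ l h
      rw [iterPMF, PMF.mem_support_pure_iff] at h
      simp [h]
    | succ m ih =>
      intro l₀ l h
      rw [iterPMF, PMF.mem_support_bind_iff] at h
      obtain ⟨l₁, h1, h2⟩ := h
      obtain ⟨a, -, rfl⟩ := (PMF.mem_support_map_iff _ _ _).1 h1
      rw [ih _ _ h2, List.length_cons]
      omega
  simpa using key m [] l h

theorem hits_cons (E : Set α) (a : α) (l : List α) : hits E (a :: l) = hits E [a] + hits E l := rfl

/-- The generating function of the number of hits is multiplicative because each trial is drawn
independently; the induction carries an arbitrary initial list. -/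
theorem expect_trials (τ : PMF α) (E : Set α) (z : ENNReal) (m : ℕ) :
    expect (trials τ m) (fun l => z ^ hits E l) = expect τ (fun a => z ^ hits E [a]) ^ m := by
  have key : ∀ m (l₀ : List α), expect (iterPMF (fun l => τ.map (· :: l)) m l₀)
      (fun l => z ^ hits E l) = expect τ (fun a => z ^ hits E [a]) ^ m * z ^ hits E l₀ := by
    intro m
    induction m with
    | zero => intro l₀; simp [iterPMF, expect_pure]
    | succ m ih =>
      intro l₀
      rw [iterPMF, expect_bind, expect_map]
      have : ∀ a, expect τ (fun a => z ^ hits E [a]) ^ m * z ^ hits E (a :: l₀) =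
          z ^ hits E [a] * (expect τ (fun a => z ^ hits E [a]) ^ m * z ^ hits E l₀) := by
        intro a
        rw [hits_cons, pow_add]
        ring
      simp only [ih, this, expect_mul_const]
      ring
  have h := key m []
  rwa [hits, pow_zero, mul_one] at h

/-- A Chernoff bound: events of probability at most `a` happen in a fraction `θ > a` of `m`
independent trials with exponentially small probability. -/
theorem exists_tail_rate {a θ : ℝ} (ha : 0 ≤ a) (haθ : a < θ) (hθ : θ ≤ 1) :
    ∃ r : ℝ, 0 < r ∧ r < 1 ∧ ∀ (τ : PMF α) (E : Set α), (τ.toOuterMeasure E).toReal ≤ a →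
      ∀ m : ℕ, (trials τ m).toOuterMeasure {l | θ * m ≤ hits E l} ≤ ENNReal.ofReal (r ^ m) := by
  -- The exponential moment is taken at `s = log (1 + t)`: each trial then contributes a factor at
  -- most `1 + a * t ≤ exp (a * t)`, and Markov's inequality gives the rate `exp (a * t - θ * s)`.
  set t := θ - a with ht
  have htpos : 0 < t := sub_pos.2 haθ
  set s := Real.log (1 + t) with hs
  have hexp : Real.exp s = 1 + t := Real.exp_log (by linarith)
  have hslog : 1 - (1 + t)⁻¹ ≤ s := Real.one_sub_inv_le_log_of_pos (by linarith)
  have hs0 : 0 ≤ s := Real.log_nonneg (by linarith)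
  refine ⟨Real.exp (a * t - θ * s), Real.exp_pos _, (Real.exp_lt_one_iff.2 ?_), fun τ E hE m => ?_⟩
  · have h1 : 1 - (1 + t)⁻¹ = t / (1 + t) := by field_simp; ring
    rw [h1] at hslog
    -- After clearing denominators this is `a * (1 + t) < a + t`, which holds because `a < θ ≤ 1`.
    have h2 : a * t < θ * (t / (1 + t)) := by
      rw [← mul_div_assoc, lt_div_iff₀ (by linarith)]
      nlinarith [mul_pos htpos htpos, mul_nonneg ha htpos.le]
    nlinarith
  · set z : ENNReal := ENNReal.ofReal (Real.exp s) with hz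
    have hstep : expect τ (fun a => z ^ hits E [a]) ≤ ENNReal.ofReal (Real.exp (a * t)) := by
      have e1 : ∀ x, z ^ hits E [x] = 1 + E.indicator (fun _ => ENNReal.ofReal t) x := by
        intro x
        by_cases hx : x ∈ E
        · simp only [hits, hx, if_true, add_zero, pow_one, Set.indicator_of_mem]
          rw [hz, hexp, ENNReal.ofReal_add zero_le_one htpos.le, ENNReal.ofReal_one]
        · simp [hits, hx]
      have e2 : expect τ (fun a => z ^ hits E [a]) =
          1 + τ.toOuterMeasure E * ENNReal.ofReal t := by
        rw [← expect_indicator]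
        simp only [expect, e1, mul_add, mul_one]
        rw [ENNReal.tsum_add, τ.tsum_coe]
      have hfin : τ.toOuterMeasure E ≠ ⊤ :=
        ne_top_of_le_ne_top ENNReal.one_ne_top (toOuterMeasure_le_one _ _)
      rw [e2, ← ENNReal.ofReal_toReal hfin, ← ENNReal.ofReal_mul ENNReal.toReal_nonneg,
        ← ENNReal.ofReal_one, ← ENNReal.ofReal_add zero_le_one
          (mul_nonneg ENNReal.toReal_nonneg htpos.le)]
      refine ENNReal.ofReal_le_ofReal ?_
      have := Real.add_one_le_exp (a * t)
      nlinarith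
    have hmarkov : (trials τ m).toOuterMeasure {l | θ * m ≤ hits E l} *
        ENNReal.ofReal (Real.exp (s * (θ * m))) ≤ ENNReal.ofReal (Real.exp (a * t)) ^ m := by
      refine le_trans ?_ (pow_le_pow_left₀ bot_le hstep m)
      rw [← expect_trials, ← expect_indicator]
      refine expect_mono fun l => ?_
      by_cases hl : l ∈ {l : List α | θ * m ≤ hits E l}
      · rw [Set.indicator_of_mem hl, hz, ← ENNReal.ofReal_pow (Real.exp_pos _).le,
          ← Real.exp_nat_mul]
        refine ENNReal.ofReal_le_ofReal (Real.exp_le_exp.2 ?_)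
        rw [mul_comm]
        exact mul_le_mul_of_nonneg_right hl hs0
      · rw [Set.indicator_of_notMem hl]
        exact bot_le
    have hpos : ENNReal.ofReal (Real.exp (s * (θ * m))) ≠ 0 := by
      simpa using Real.exp_pos _
    rw [← ENNReal.le_div_iff_mul_le (Or.inl hpos) (Or.inl ENNReal.ofReal_ne_top)] at hmarkov
    refine hmarkov.trans (le_of_eq ?_)
    rw [← ENNReal.ofReal_pow (Real.exp_pos _).le, ← ENNReal.ofReal_div_of_pos (Real.exp_pos _),
      ← Real.exp_nat_mul, ← Real.exp_nat_mul, ← Real.exp_sub]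
    congr 2
    ring

end Tail

/-- Logarithmically many trials make the error polynomially small. -/
theorem exists_trial_count {r : ℝ} (hr : 0 < r) (hr1 : r < 1) (p c : ℕ) :
    ∃ K : ℕ, ∀ n : ℕ, 1 ≤ n → p * r ^ (K * n.size) ≤ 1 / (n : ℝ) ^ c := by
  -- The factor `p + 1` pays for a union bound over `p` events, and `2 ^ c` per binary digit of `n`
  -- produces `n ^ c`.
  obtain ⟨K, hK⟩ := exists_pow_lt_of_lt_one (y := r) (x := 1 / (((p : ℝ) + 1) * 2 ^ c))
    (by positivity) hr1
  refine ⟨K, fun n hn => ?_⟩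
  have hs : 1 ≤ n.size := Nat.lt_size.2 (by simpa using hn)
  have h1 : (n : ℝ) ≤ 2 ^ n.size := by exact_mod_cast (Nat.lt_size_self n).le
  have hn0 : (0 : ℝ) < n := by exact_mod_cast hn
  have h2 : (p : ℝ) + 1 ≤ ((p : ℝ) + 1) ^ n.size := le_self_pow₀ (by linarith [Nat.cast_nonneg (α := ℝ) p]) (by omega)
  calc p * r ^ (K * n.size) = p * (r ^ K) ^ n.size := by rw [pow_mul]
    _ ≤ (p + 1) * (1 / (((p : ℝ) + 1) * 2 ^ c)) ^ n.size := by gcongr; linarith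
    _ = (p + 1) / ((p + 1) ^ n.size * (2 ^ n.size) ^ c) := by
        rw [div_pow, one_pow, mul_pow, ← pow_mul, ← pow_mul, mul_comm c]
        ring
    _ ≤ (p + 1) / ((p + 1) * (n : ℝ) ^ c) := by gcongr
    _ = 1 / (n : ℝ) ^ c := by
        have : (p : ℝ) + 1 ≠ 0 := by positivity
        field_simp

variable {F : Type*} [Field F] [Fintype F] (enc : F ≃ Fin (Fintype.card F))

/-! ### The decision -/

open Classical in
/-- The last nonzero element with code below `k` that was supported in a fraction of at least
`a / b` of the trials. -/
def decision (a b : ℕ) (l : List (F × F)) : ℕ → F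
  | 0 => 0
  | k + 1 => if decode enc k ≠ 0 ∧ a * l.length ≤ b * hits (ratioSet (decode enc k)) l
      then decode enc k else decision a b l k

variable {enc}

/-- If `x ≠ 0`, it is the only element that passes the test, so the order of the search is
irrelevant. If `x = 0`, none passes and the default 0 remains. -/
theorem decision_eq {a b : ℕ} {l : List (F × F)} {x : F}
    (h : ∀ d : F, d ≠ 0 → (a * l.length ≤ b * hits (ratioSet d) l ↔ d = x)) :
    decision enc a b l (Fintype.card F) = x := by
  have key : ∀ k ≤ Fintype.card F,
      decision enc a b l k = if (enc x : ℕ) < k then x else 0 := by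
    intro k
    induction k with
    | zero => simp [decision]
    | succ k ih =>
      intro hk
      have hcode : (enc (decode enc k) : ℕ) = k := by simp [decode, Nat.lt_of_succ_le hk]
      rw [decision, ih (by omega)]
      by_cases hd : decode enc k = 0
      · rw [if_neg (by simp [hd])]
        by_cases hx : (enc x : ℕ) = k
        · have : x = 0 := by rw [← hd, ← hx, decode_enc]
          simp [this]
        · have : (enc x : ℕ) < k + 1 ↔ (enc x : ℕ) < k := by omega
          simp only [this]
      · by_cases hx : decode enc k = x
        · rw [if_pos ⟨hd, (h _ hd).2 hx⟩, hx, if_pos]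
          rw [← hx, hcode]
          omega
        · rw [if_neg fun h' => hx ((h _ hd).1 h'.2)]
          have hne : (enc x : ℕ) ≠ k := fun h' => hx (by rw [← h', decode_enc])
          have : (enc x : ℕ) < k + 1 ↔ (enc x : ℕ) < k := by omega
          simp only [this]
  rw [key _ le_rfl, if_pos (enc_lt x)]

/-- If the probabilities of support are separated from `a / b`, then logarithmically many trials
suffice for a correct decision. -/
theorem exists_decision_bound {a b : ℕ} (hb : 0 < b) {η : ℝ} (hη : 0 < η)
    (h0 : η ≤ (a : ℝ) / b) (h1 : (a : ℝ) / b + η ≤ 1) (c : ℕ) :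
    ∃ K : ℕ, ∀ (τ : PMF (F × F)) (x : F),
      (∀ d : F, d ≠ 0 → d = x → (a : ℝ) / b + η ≤ (τ.toOuterMeasure (ratioSet d)).toReal) →
      (∀ d : F, d ≠ 0 → d ≠ x → (τ.toOuterMeasure (ratioSet d)).toReal ≤ (a : ℝ) / b - η) →
      ∀ n : ℕ, 1 ≤ n → 1 - 1 / (n : ℝ) ^ c ≤
        (((trials τ (K * n.size)).map fun l => decision enc a b l (Fintype.card F)) x).toReal := by
  classical
  obtain ⟨r₁, hr₁, hr₁', H₁⟩ := exists_tail_rate (α := F × F) (a := (a : ℝ) / b - η) (θ := a / b)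
    (by linarith) (by linarith) (by linarith)
  obtain ⟨r₂, hr₂, hr₂', H₂⟩ := exists_tail_rate (α := F × F) (a := 1 - (a : ℝ) / b - η)
    (θ := 1 - a / b) (by linarith) (by linarith) (by have := hη.trans_le h0; linarith)
  obtain ⟨K, hK⟩ := exists_trial_count (r := max r₁ r₂) (lt_max_of_lt_left hr₁)
    (max_lt hr₁' hr₂') (Fintype.card F) c
  have hb' : (0 : ℝ) < b := by exact_mod_cast hb
  refine ⟨K, fun τ x hx hnx n hn => ?_⟩
  set m := K * n.size with hm
  set ν := trials τ m with hν
  -- For the true value the bad event is too many trials that do not support it, so the same upper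
  -- tail bound applies to the complement with threshold `1 - a / b`.
  let bad : F → Set (List (F × F)) := fun d =>
    if d = x then {l | (1 - (a : ℝ) / b) * m ≤ hits (ratioSet d)ᶜ l}
    else {l | (a : ℝ) / b * m ≤ hits (ratioSet d) l}
  let badU : Set (List (F × F)) := ⋃ d ∈ {d : F | d ≠ 0}, bad d
  have hfin : ∀ s, ν.toOuterMeasure s ≠ ⊤ := fun s =>
    ne_top_of_le_ne_top ENNReal.one_ne_top (toOuterMeasure_le_one _ _)
  have hbad : ∀ d : F, d ≠ 0 → ν.toOuterMeasure (bad d) ≤ ENNReal.ofReal ((max r₁ r₂) ^ m) := by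
    intro d hd
    by_cases hdx : d = x
    · simp only [bad, if_pos hdx]
      refine (H₂ τ (ratioSet d)ᶜ ?_ m).trans (ENNReal.ofReal_le_ofReal
        (pow_le_pow_left₀ hr₂.le (le_max_right _ _) m))
      have e : τ.toOuterMeasure (ratioSet d) + τ.toOuterMeasure (ratioSet d)ᶜ = 1 := by
        rw [PMF.toOuterMeasure_apply, PMF.toOuterMeasure_apply, ← ENNReal.tsum_add,
          ← τ.tsum_coe]
        exact tsum_congr fun a => congrFun (Set.indicator_self_add_compl (ratioSet d) ⇑τ) a
      have e' := congrArg ENNReal.toReal e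
      rw [ENNReal.toReal_add
        (ne_top_of_le_ne_top ENNReal.one_ne_top (toOuterMeasure_le_one _ _))
        (ne_top_of_le_ne_top ENNReal.one_ne_top (toOuterMeasure_le_one _ _)),
        ENNReal.toReal_one] at e'
      have := hx d hd hdx
      linarith
    · simp only [bad, if_neg hdx]
      exact (H₁ τ (ratioSet d) (hnx d hd hdx) m).trans (ENNReal.ofReal_le_ofReal
        (pow_le_pow_left₀ hr₁.le (le_max_left _ _) m))
  have hbadU : (ν.toOuterMeasure badU).toReal ≤ 1 / (n : ℝ) ^ c := by
    refine le_trans ?_ (hK n hn)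
    have : ν.toOuterMeasure badU ≤ ∑ d : F, ENNReal.ofReal ((max r₁ r₂) ^ m) := by
      have h2 : badU ⊆ ⋃ d : F, if d = 0 then ∅ else bad d := by
        intro l hl
        simp only [badU, Set.mem_iUnion] at hl ⊢
        obtain ⟨d, hd, hl⟩ := hl
        exact ⟨d, by rwa [if_neg hd]⟩
      refine (MeasureTheory.measure_mono h2).trans ((MeasureTheory.measure_iUnion_le _).trans ?_)
      rw [tsum_fintype]
      refine Finset.sum_le_sum fun d _ => ?_
      split_ifs with h
      · simp
      · exact hbad d h
    have h3 := ENNReal.toReal_mono (by simp [ENNReal.mul_eq_top]) this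
    have hr0 : 0 ≤ max r₁ r₂ := hr₁.le.trans (le_max_left _ _)
    rwa [Finset.sum_const, nsmul_eq_mul, Finset.card_univ, ENNReal.toReal_mul,
      ENNReal.toReal_ofReal (pow_nonneg hr0 m), ENNReal.toReal_natCast] at h3
  have hgood : ∀ l ∈ ν.support, l ∉ badU → decision enc a b l (Fintype.card F) = x := by
    intro l hl hlb
    have hlen : l.length = m := length_of_mem_trials hl
    refine decision_eq fun d hd => ?_
    have hlb' : l ∉ bad d := fun h => hlb (Set.mem_biUnion (show d ∈ {d : F | d ≠ 0} from hd) h)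
    have hcomp := hits_add_hits_compl (ratioSet d) l
    rw [hlen] at hcomp ⊢
    have hcomp' : (hits (ratioSet d) l : ℝ) + hits (ratioSet d)ᶜ l = m := by exact_mod_cast hcomp
    by_cases hdx : d = x
    · simp only [bad, if_pos hdx, Set.mem_ofPred_eq, not_le] at hlb'
      refine ⟨fun _ => hdx, fun _ => ?_⟩
      have h5 : (a : ℝ) / b * m ≤ hits (ratioSet d) l := by linarith
      rw [div_mul_eq_mul_div, div_le_iff₀ hb', mul_comm (hits (ratioSet d) l : ℝ)] at h5
      exact_mod_cast h5
    · simp only [bad, if_neg hdx, Set.mem_ofPred_eq, not_le] at hlb'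
      refine ⟨fun h => absurd ?_ (not_le.2 hlb'), fun h => absurd h hdx⟩
      rw [div_mul_eq_mul_div, div_le_iff₀ hb', mul_comm (hits (ratioSet d) l : ℝ)]
      exact_mod_cast h
  have hfinal : 1 ≤ ((ν.map fun l => decision enc a b l (Fintype.card F)) x) +
      ν.toOuterMeasure badU := by
    rw [← PMF.toOuterMeasure_apply_singleton, PMF.toOuterMeasure_map_apply, ← ν.tsum_coe,
      PMF.toOuterMeasure_apply, PMF.toOuterMeasure_apply, ← ENNReal.tsum_add]
    refine ENNReal.tsum_le_tsum fun l => ?_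
    by_cases hl : l ∈ ν.support
    · by_cases hlb : l ∈ badU
      · rw [Set.indicator_of_mem hlb]
        exact le_add_self
      · rw [Set.indicator_of_mem (s := _ ⁻¹' _) (by exact hgood l hl hlb)]
        exact le_self_add
    · rw [PMF.mem_support_iff, not_not] at hl
      rw [hl]
      exact bot_le
  have h6 := ENNReal.toReal_mono (ENNReal.add_ne_top.2 ⟨PMF.apply_ne_top _ _, hfin _⟩) hfinal
  rw [ENNReal.toReal_add (PMF.apply_ne_top _ _) (hfin _), ENNReal.toReal_one] at h6
  linarith

end

section

/-! ### Polynomial budgets and the clocked algorithm -/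

/-- `x ^ k`. -/
def Expr.powK (x : Expr) : ℕ → Expr
  | 0 => .const 1
  | k + 1 => .op .mul (Expr.powK x k) x

@[simp] theorem Expr.val_powK (x : Expr) (k : ℕ) (σ : State) :
    (x.powK k).val σ = x.val σ ^ k := by
  induction k with
  | zero => rfl
  | succ k ih => simp [Expr.powK, Expr.val, Op.eval, ih, pow_succ]

/-- `x ^ e + e`. -/
def Expr.budget (x : Expr) (e : ℕ) : Expr := .op .add (x.powK e) (.const e)

@[simp] theorem Expr.val_budget (x : Expr) (e : ℕ) (σ : State) :
    (x.budget e).val σ = x.val σ ^ e + e := by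
  simp [Expr.budget, Expr.val, Op.eval]

theorem State.read_congr {σ σ' : State} {x x' : ℕ} (h : ∀ j, σ x j = σ' x' j) :
    σ.read x = σ'.read x' := by
  simp [State.read, h]

theorem PTri.tri_of_pure {α : Type*} {c : Cmd} {σ : State} {t : ℕ} {a : α} {Q : α → State → Prop}
    (h : PTri c σ t (PMF.pure a) Q) : Tri c σ t (Q a) := by
  have e : PMF.pure a = (PMF.pure ()).map fun _ => a := by rw [PMF.pure_map]
  rw [e] at h
  exact h.of_map

theorem size_two_pow (m : ℕ) : (2 ^ m).size = m + 1 := Nat.size_pow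

theorem le_two_pow_of_size_le {v m : ℕ} (h : v.size ≤ m) : v ≤ 2 ^ m := (Nat.size_le.1 h).le

theorem size_le_listCost {l : List ℕ} {v : ℕ} (h : v ∈ l) : v.size ≤ listCost l := by
  induction l with
  | nil => simp at h
  | cons a l ih =>
    simp only [listCost, List.map_cons, List.sum_cons, List.mem_cons] at h ih ⊢
    rcases h with rfl | h
    · omega
    · have := ih h
      omega

theorem State.init_encMat_dim {F : Type*} [Field F] [Fintype F] {enc : F ≃ Fin (Fintype.card F)}
    {n : ℕ} (A : Matrix (Fin n) (Fin n) F) : State.init (encMat enc A) 0 1 = n :=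
  (State.store_same (by simp [encMat])).trans (by simp [encMat])

variable {F : Type*} [Field F] [Fintype F] (enc : F ≃ Fin (Fintype.card F))

/-- The field element that a list consisting of one code stands for. -/
def normOut : List ℕ → F
  | [v] => decode enc v
  | _ => 0

/-! ### Cutting off long runs -/

namespace Clocked

def dim : Expr := .get 0 (.const 1)

def finish : Cmd :=
  -- The test is nonzero exactly if the returned array has length one and its entry is the code of a
  -- field element; all other outputs are normalised to 0.
  .seq (.cond (.op .mul ((Expr.var 1).isConst 1)
      (.op .sub (.const (Fintype.card F)) (.get 1 (.const 1))))
    (.setVar 2 (.get 1 (.const 1))) (.setVar 2 (.const (enc 0))))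
  (.seq (.set 0 (.const 0) (.const 1)) (.set 0 (.const 1) (.var 2)))

/-- Run `M` within the budget `n ^ e + e`; if it is interrupted, compute the determinant by Gaussian
elimination. -/
def prog (M : Cmd) (e : ℕ) : Cmd :=
  -- A sentinel: an array returned within the budget has length at most the budget, so cell 0 of
  -- bank 1 still exceeds the budget exactly if the call was interrupted.
  .seq (.setVar 1 (.op .add (dim.budget e) (.const 1)))
    (.seq (.seq (.call M 0 1 (dim.budget e))
      (.cond (.op .sub (.var 1) (dim.budget e)) (.call (DetProg.prog enc) 0 1 (dim.budget e)) .skip))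
      (finish enc))

variable {enc}

theorem tri_finish {σ : State} {B : ℕ} (hB : 2 ≤ B) {l : List ℕ} (hσ : (σ.store 1 l).Bd B) :
    Tri (finish enc) (σ.store 1 l) ((finish enc).K * B.size)
      fun s => s.read 0 = [(enc (normOut enc l) : ℕ)] := by
  refine Tri.simple (by exact ⟨⟨trivial, trivial⟩, trivial, trivial⟩) hB hσ ?_
  have h2 : ∀ s : State, s 2 0 = (enc (normOut enc l) : ℕ) →
      ((Cmd.seq (.set 0 (.const 0) (.const 1)) (.set 0 (.const 1) (.var 2))).exec s).read 0 =
        [(enc (normOut enc l) : ℕ)] := by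
    intro s hs
    refine State.read_eq (by simp [Cmd.exec, State.write_apply, Expr.val]) fun j hj => ?_
    obtain rfl : j = 0 := by simpa using hj
    simp [Cmd.exec, State.write_apply, Expr.val, hs]
  refine h2 _ ?_
  simp only [Cmd.exec, Expr.val, Op.eval, Expr.val_isConst, Expr.val_var, State.store_zero]
  rcases l with _ | ⟨v, _ | ⟨w, l⟩⟩
  · simp [State.write_apply, Expr.val, normOut, Cmd.setVar, Cmd.exec]
  · have hv : σ.store 1 [v] 1 1 = v := State.store_same (by simp)
    by_cases hlt : v < Fintype.card F
    · have : Fintype.card F - v ≠ 0 := by omega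
      simp [State.write_apply, Expr.val, normOut, Cmd.setVar, Cmd.exec, hv, this, decode, hlt]
    · have : Fintype.card F - v = 0 := by omega
      simp [State.write_apply, Expr.val, normOut, Cmd.setVar, Cmd.exec, hv, this, decode, hlt]
  · simp [State.write_apply, Expr.val, normOut, Cmd.setVar, Cmd.exec]

end Clocked

variable {enc}

/-- The budget is chosen to cover Gaussian elimination. If `M` exceeds it, the time spent so far
already dominates that of the fallback, so the total stays of order `min (T n) (n ^ e + e)`, up to
logarithmic terms. Replaced outcomes are correct determinants, so no success probability is lost. -/
theorem exists_clocked {M : Cmd} {T : ℕ → ℕ}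
    {ρ : ∀ n : ℕ, Matrix (Fin n) (Fin n) F → PMF (List ℕ)}
    (hM : ∀ (n : ℕ) (A : Matrix (Fin n) (Fin n) F), RunsOn M (encMat enc A) (T n) (ρ n A)) :
    ∃ (P : Cmd) (t : ℕ → ℕ) (δ : ∀ n : ℕ, Matrix (Fin n) (Fin n) F → PMF F),
      PolyB t ∧ SoftO t T ∧
      (∀ (n : ℕ) (A : Matrix (Fin n) (Fin n) F),
        RunsOn P (encMat enc A) (t n) ((δ n A).map fun x => [(enc x : ℕ)])) ∧
      ∀ (n : ℕ) (A : Matrix (Fin n) (Fin n) F),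
        detProb enc A (ρ n A) ≤ (δ n A A.det).toReal := by
  obtain ⟨e, he⟩ := (polyB_detTime (enc := enc)).exists_pow
  set b : ℕ → ℕ := fun n => n ^ e + e with hb
  have hpb : PolyB b := (PolyB.id.pow e).add (.const e)
  have hT : ∀ n, n ^ 2 + 1 ≤ T n := fun n => by
    have := (length_le_listCost _).trans (hM n 0).listCost_le
    rwa [length_encMat] at this
  choose μ hμ hμt hμρ using hM
  set m : ℕ → ℕ := fun n => min (T n) (b n) with hm
  set S : ℕ → ℕ := fun n => m n + Fintype.card F + (b n + 1).size + 1 with hS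
  set K₁ := (Cmd.setVar 1 (.op .add (Clocked.dim.budget e) (.const 1))).K with hK₁
  set K₂ := (Clocked.dim.budget e).K with hK₂
  set K₃ := (Expr.op .sub (.var 1) (Clocked.dim.budget e)).K with hK₃
  set K₄ := (Clocked.finish enc).K with hK₄
  set t : ℕ → ℕ := fun n => (10 + K₁ + 2 * K₂ + K₃ + K₄) * S n with ht
  -- The array found in bank 1 in the end, as a function of the hypothetical unlimited run of `M`.
  let f : ∀ n : ℕ, Matrix (Fin n) (Fin n) F → State × ℕ → List ℕ := fun n A s =>
    if totalTime (encMat enc A) s ≤ b n then s.1.read 0 else [(enc A.det : ℕ)]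
  refine ⟨Clocked.prog enc M e, t, fun n A => ((μ n A).map (f n A)).map (normOut enc), ?_, ?_, ?_,
    ?_⟩
  · refine (PolyB.const _).mul ((((hpb.mono fun n => min_le_right _ _).add (.const _)).add
      (hpb.add (.const 1)).size).add (.const 1))
  · have h1 : SoftO (fun _ => 1) T := .of_le 1 (.of_forall fun n => by have := hT n; omega)
    refine SoftO.const_mul _ ((((SoftO.of_le 1 (.of_forall fun n => ?_)).add
      ((SoftO.const _).trans h1)).add ((softO_size (hpb.add (.const 1))).trans h1)).add h1)
    rw [one_mul]
    exact min_le_left _ _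
  · intro n A
    have hdet := (detProg_runsOn (enc := enc) A).mono (he n)
    have hin : listCost (encMat enc A) ≤ m n :=
      le_min ((RunsOn.listCost_le ⟨μ n A, hμ n A, hμt n A, hμρ n A⟩)) hdet.listCost_le
    have hp2 : 2 ≤ Fintype.card F := Fintype.one_lt_card
    -- The output of `M` may contain numbers with up to `m n` binary digits, so the bound is
    -- exponential. This is affordable because only boundedly many expressions are evaluated outside
    -- the calls; each costs a multiple of `S n`, the bit length of `B`.
    set B := 2 ^ (m n + Fintype.card F + (b n + 1).size) with hB
    have hBS : B.size = S n := size_two_pow _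
    have hB2 : 2 ≤ B := Nat.le_self_pow (by omega) 2
    have hmB : m n ≤ B := Nat.lt_two_pow_self.le.trans (Nat.pow_le_pow_right (by omega) (by omega))
    have hbB : b n + 1 ≤ B := le_two_pow_of_size_le (by omega)
    have hpB : Fintype.card F ≤ B :=
      Nat.lt_two_pow_self.le.trans (Nat.pow_le_pow_right (by omega) (by omega))
    have hlist : ∀ l : List ℕ, listCost l ≤ m n → l.length ≤ B ∧ ∀ v ∈ l, v ≤ B := fun l hl =>
      ⟨((length_le_listCost l).trans hl).trans hmB, fun v hv =>
        le_two_pow_of_size_le (by have := size_le_listCost hv; omega)⟩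
    set σ₀ := State.init (encMat enc A) with hσ₀
    have hbd₀ : σ₀.Bd B := State.Bd.init (hlist _ hin).1 (hlist _ hin).2
    have hdim₀ : σ₀ 0 1 = n := State.init_encMat_dim A
    set σ₁ := σ₀.write 1 0 (b n + 1) with hσ₁
    have hbd₁ : σ₁.Bd B := hbd₀.write hbB _ _
    have hdim₁ : Clocked.dim.val σ₁ = n := hdim₀
    have hbud : (Clocked.dim.budget e).val σ₁ = b n := by simp [hdim₁, hb]
    have hread : σ₁.read 0 = encMat enc A := by
      rw [State.read_congr (σ' := σ₀) (x' := 0) fun j => State.write_of_ne (by decide)]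
      exact State.read_init _
    have hc₂ : (Clocked.dim.budget e).cost σ₁ ≤ K₂ * S n := hBS ▸ Expr.cost_le hB2 hbd₁ _
    have hlong : ∀ a : List ℕ, (∀ v ∈ a, v ≤ B) → a.length ≤ B → (σ₁.store 1 a).Bd B :=
      fun a h1 h2 => hbd₁.store h2 h1 1
    have hcall : PTri (.call M 0 1 (Clocked.dim.budget e)) σ₁ (1 + K₂ * S n + m n)
        ((μ n A).map (f n A)) fun a s => (s = σ₁.store 1 a ∧ listCost a ≤ m n) ∨
          (a = [(enc A.det : ℕ)] ∧ s = σ₁ ∧ m n = b n) := by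
      have hr := Runs.call M 0 1 (Clocked.dim.budget e) σ₁ (μ n A) (by rw [hread]; exact hμ n A)
      rw [hread, hbud] at hr
      have := PTri.of_runs (f := id) (Q := fun s' s => s = s'.1) (t := 1 + K₂ * S n + m n) hr ?_
      · rw [PMF.map_id] at this
        obtain ⟨π, h1, h2, h3⟩ := this.of_map
        refine ⟨π.map fun z => (f n A z.1, z.2), ?_, ?_, ?_⟩
        · rw [← h1, PMF.map_comp, PMF.map_comp]; rfl
        · rw [PMF.map_comp]; exact h2
        · intro w hw
          obtain ⟨z, hz, rfl⟩ := (PMF.mem_support_map_iff _ _ _).1 hw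
          have hzs : z.1 ∈ (μ n A).support := h1 ▸ (PMF.mem_support_map_iff _ _ _).2 ⟨z, hz, rfl⟩
          refine ⟨?_, (h3 z hz).2⟩
          have h4 := (h3 z hz).1
          have h5 := hμt n A z.1 hzs
          simp only at h4 ⊢
          by_cases hle : totalTime (encMat enc A) z.1 ≤ b n
          · left
            simp only [f, if_pos hle] at h4 ⊢
            refine ⟨h4, ?_⟩
            unfold totalTime at h5 hle
            exact le_min (by omega) (by omega)
          · right
            simp only [f, if_neg hle] at h4 ⊢
            -- An interruption means `b n < T n`, so `m n = b n` pays for the elimination.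
            exact ⟨trivial, h4, min_eq_right (by omega)⟩
      · intro s hs
        obtain ⟨z, hz, rfl⟩ := (PMF.mem_support_map_iff _ _ _).1 hs
        refine ⟨rfl, ?_⟩
        have h5 := hμt n A z hz
        have : min (totalTime (encMat enc A) z) (b n) ≤ m n := min_le_min_right _ h5
        simp only
        omega
    have hfix : PTri (.seq (.call M 0 1 (Clocked.dim.budget e))
        (.cond (.op .sub (.var 1) (Clocked.dim.budget e))
          (.call (DetProg.prog enc) 0 1 (Clocked.dim.budget e)) .skip)) σ₁
        ((1 + K₂ * S n + m n) + (1 + K₃ * S n + (1 + K₂ * S n + m n)))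
        ((μ n A).map (f n A)) fun a s => s = σ₁.store 1 a ∧ (σ₁.store 1 a).Bd B := by
      refine PTri.seq_tri hcall ?_
      rintro a - s (⟨rfl, ha⟩ | ⟨rfl, rfl, hmb⟩)
      · have hbd := hlong a (hlist a ha).2 (hlist a ha).1
        have hc₃ : (Expr.op .sub (.var 1) (Clocked.dim.budget e)).cost (σ₁.store 1 a) ≤ K₃ * S n :=
          hBS ▸ Expr.cost_le hB2 hbd _
        refine Tri.mono (PTri.cond _ (fun h => absurd ?_ h) (fun _ => ?_))
          (t := 1 + (Expr.op .sub (.var 1) (Clocked.dim.budget e)).cost (σ₁.store 1 a) + 1)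
          (by omega) (fun _ h => h)
        · have hdim : Clocked.dim.val (σ₁.store 1 a) = n := hdim₀
          simp only [Expr.val, Op.eval, Expr.val_var, State.store_zero, Expr.val_budget, hdim]
          have := (length_le_listCost a).trans ha
          have : m n ≤ b n := min_le_right _ _
          simp only [hb] at this
          omega
        · exact Tri.of_runs_pure (Runs.skip _) le_rfl ⟨rfl, hbd⟩
      · have hc₃ : (Expr.op .sub (.var 1) (Clocked.dim.budget e)).cost σ₁ ≤ K₃ * S n :=
          hBS ▸ Expr.cost_le hB2 hbd₁ _
        have hd : Tri (.call (DetProg.prog enc) 0 1 (Clocked.dim.budget e)) σ₁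
            (1 + K₂ * S n + m n) fun s => s = σ₁.store 1 [(enc A.det : ℕ)] ∧
              (σ₁.store 1 [(enc A.det : ℕ)]).Bd B := by
          have := (RunsOn.call (σ := σ₁) (src := 0) (dst := 1) (b := Clocked.dim.budget e)
            (t := b n) (by rw [hread]; exact hdet) hbud.ge).tri_of_pure
          refine this.mono (by omega) fun s hs => ⟨hs, hlong _ ?_ ?_⟩
          · intro v hv
            obtain rfl := List.mem_singleton.1 hv
            exact (enc_lt _).le.trans hpB
          · simp only [List.length_singleton]; omega
        refine Tri.mono (PTri.cond _ (fun _ => hd) (fun h => absurd h ?_)) (by omega)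
          (fun _ h => h)
        have h1 : σ₁ 1 0 = b n + 1 := by simp [hσ₁, State.write_apply]
        simp only [Expr.val, Op.eval, Expr.val_var, hbud, h1]
        omega
    have hall : PTri (Clocked.prog enc M e) σ₀ (K₁ * S n +
        (((1 + K₂ * S n + m n) + (1 + K₃ * S n + (1 + K₂ * S n + m n))) + K₄ * S n))
        ((μ n A).map (f n A)) fun a s => s.read 0 = [(enc (normOut enc a) : ℕ)] := by
      refine Tri.seq_ptri (R := fun s => s = σ₁) (hBS ▸ Tri.simple (by trivial) hB2 hbd₀ ?_) ?_
      · have : Clocked.dim.val σ₀ = n := hdim₀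
        simp [Expr.val, Op.eval, this, hσ₁, hb]
      · rintro s rfl
        refine PTri.seq_tri hfix ?_
        rintro a - s ⟨rfl, hbd⟩
        exact hBS ▸ Clocked.tri_finish hB2 hbd
    have hrun := hall.runsOn (out := fun a => [(enc (normOut enc a) : ℕ)]) (u := S n)
      (fun a _ s hs => hs) fun a _ => by
        have h1 := Nat.size_le_size (enc_lt (enc := enc) (normOut enc a)).le
        have h2 := size_le_self (Fintype.card F)
        simp only [listCost, List.map_cons, List.map_nil, List.sum_cons, List.sum_nil, hS]
        omega
    rw [PMF.map_comp]
    refine hrun.mono ?_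
    have hmS : m n + 2 ≤ S n := by simp only [hS]; omega
    have : t n = 10 * S n + K₁ * S n + 2 * (K₂ * S n) + K₃ * S n + K₄ * S n := by
      simp only [ht]; ring
    omega
  · intro n A
    refine ENNReal.toReal_mono (PMF.apply_ne_top _ _) ?_
    simp only
    rw [PMF.map_comp, ← hμρ n A, ← PMF.toOuterMeasure_apply_singleton,
      ← PMF.toOuterMeasure_apply_singleton, PMF.toOuterMeasure_map_apply,
      PMF.toOuterMeasure_map_apply]
    -- Every run of `M` with the correct output leads to the correct normalised answer, whether or
    -- not it was interrupted.
    refine MeasureTheory.measure_mono fun s hs => ?_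
    have hs' : s.1.read 0 = [(enc A.det : ℕ)] := hs
    change normOut enc (f n A s) = A.det
    simp only [f, hs', ite_self, normOut, decode_enc]

end

section

/-! ### Applying a circuit to the columns of a matrix -/

variable {F : Type*} [Field F]

/-- The values of the wires after the first `t` gates. -/
def Circuit.wires (C : Circuit F) (v : List F) (t : ℕ) : List F :=
  (C.gates.take t).foldl (fun w g => w ++ [g.eval w]) v

theorem Circuit.wires_zero (C : Circuit F) (v : List F) : C.wires v 0 = v := rfl

theorem Circuit.wires_succ (C : Circuit F) (v : List F) {t : ℕ} (ht : t < C.gates.length) :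
    C.wires v (t + 1) = C.wires v t ++ [(C.gates[t]).eval (C.wires v t)] := by
  unfold wires
  rw [List.take_add_one, List.getElem?_eq_getElem ht, Option.toList_some, List.foldl_append]
  rfl

theorem Circuit.length_wires (C : Circuit F) (v : List F) {t : ℕ} (ht : t ≤ C.gates.length) :
    (C.wires v t).length = v.length + t := by
  induction t with
  | zero => rfl
  | succ t ih =>
    rw [C.wires_succ v ht, List.length_append, ih (by omega)]
    simp [add_assoc]

theorem Circuit.eval_eq (C : Circuit F) (v : List F) :
    C.eval v = C.outs.map fun i => (C.wires v C.gates.length).getD i 0 := by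
  simp [eval, wires]

theorem Circuit.Computes.length_outs {n : ℕ} {C : Circuit F} {R : Matrix (Fin n) (Fin n) F}
    (h : C.Computes R) : C.outs.length = n := by
  have := congrArg List.length (h.2 0)
  simpa [Circuit.eval_eq] using this

theorem Circuit.Computes.getD_wires {n : ℕ} {C : Circuit F} {R : Matrix (Fin n) (Fin n) F}
    (h : C.Computes R) (v : Fin n → F) (i : Fin n) :
    (C.wires (List.ofFn v) C.gates.length).getD (C.outs.getD i 0) 0 = R.mulVec v i := by
  have hi : (i : ℕ) < C.outs.length := by rw [h.length_outs]; exact i.2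
  have h1 : (C.eval (List.ofFn v)).getD i 0 = (List.ofFn (R.mulVec v)).getD i 0 := by rw [h.2 v]
  rw [Circuit.eval_eq, List.getD_eq_getElem _ _ (by simpa using hi), List.getElem_map,
    List.getD_eq_getElem (List.ofFn _) _ (by simp), List.getElem_ofFn] at h1
  rw [List.getD_eq_getElem _ _ hi]
  exact h1

variable [Fintype F] (enc : F ≃ Fin (Fintype.card F))

theorem State.write_bank {σ : State} {x i v y : ℕ} (h : y ≠ x) : (σ.write x i v) y = σ y :=
  funext fun _ => State.write_of_ne h

theorem State.store_bank {σ : State} {x y : ℕ} {l : List ℕ} (h : y ≠ x) : (σ.store x l) y = σ y :=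
  funext fun _ => State.store_of_ne h

/-! ### Evaluating the trapdoor circuit column by column -/

namespace CircProg

def dim : Expr := .get 0 (.const 1)

/-- The position of the circuit. -/
def off : Expr := .op .add (.const 2) (.op .mul dim dim)

/-- The number of gates. -/
def num : Expr := .get 2 off

/-- Entry `r` of the code of the gate with number `t`. -/
def gateEntry (r : ℕ) : Expr :=
  .get 2 (.op .add (.op .add (.op .add off (.const 1)) (.op .mul (.const 3) (.var 6))) (.const r))

def loadBody : Cmd := .set 4 (.var 6) (.get 0 (.ix (.const 2) dim (.var 6) (.var 5)))

def gateBody : Cmd :=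
  .cond (gateEntry 0)
    (.cond (.op .sub (gateEntry 0) (.const 1))
      (.set 4 (.op .add dim (.var 6)) (.fop enc (· * ·) (.get 4 (gateEntry 1)) (.get 4 (gateEntry 2))))
      (.set 4 (.op .add dim (.var 6)) (.fop enc (· + ·) (.get 4 (gateEntry 1)) (.get 4 (gateEntry 2)))))
    (.set 4 (.op .add dim (.var 6)) (gateEntry 1))

def storeBody : Cmd :=
  .set 3 (.ix (.const 2) dim (.var 6) (.var 5))
    (.get 4 (.get 2 (.op .add (.op .add (.op .add off (.const 1)) (.op .mul (.const 3) num))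
      (.var 6))))

def colBody : Cmd :=
  .seq (.for 6 dim loadBody) (.seq (.for 6 num (gateBody enc)) (.for 6 dim storeBody))

/-- Apply the circuit in bank `2` to the columns of the matrix in bank `0`, and write the resulting
columns into bank `3`. -/
def prog : Cmd := .for 5 dim (colBody enc)

/-- The banks `m₀` and `m₂` hold a matrix and a circuit. -/
structure Input {n : ℕ} (m₀ m₂ : ℕ → ℕ) (A : Matrix (Fin n) (Fin n) F) (C : Circuit F) :
    Prop where
  dim : m₀ 1 = n
  mat : ∀ i j : Fin n, m₀ (2 + (i * n + j)) = enc (A i j)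
  num : m₂ (2 + n * n) = C.gates.length
  gate : ∀ (t : ℕ) (ht : t < C.gates.length) (r : ℕ), r < 3 →
    m₂ (2 + n * n + 1 + 3 * t + r) = (encGate enc C.gates[t]).getD r 0
  out : ∀ i < C.outs.length, m₂ (2 + n * n + 1 + 3 * C.gates.length + i) = C.outs.getD i 0

/-- The memory is bounded, and the input is in place. -/
structure Base (B : ℕ) (m₀ m₂ : ℕ → ℕ) (σ : State) : Prop where
  bd : σ.Bd B
  bank0 : σ 0 = m₀
  bank2 : σ 2 = m₂

variable {enc}

theorem Base.write {B : ℕ} {m₀ m₂ : ℕ → ℕ} {σ : State} (h : Base B m₀ m₂ σ) {x i v : ℕ}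
    (hv : v ≤ B) (h0 : 0 ≠ x) (h2 : 2 ≠ x) : Base B m₀ m₂ (σ.write x i v) :=
  ⟨h.bd.write hv _ _, by rw [State.write_bank h0, h.bank0], by rw [State.write_bank h2, h.bank2]⟩

variable {n B : ℕ} {m₀ m₂ : ℕ → ℕ} {A R : Matrix (Fin n) (Fin n) F} {C : Circuit F}
  (hI : Input enc m₀ m₂ A C) (hB : 2 ≤ B) (hp : Fintype.card F ≤ B) (hn : n ≤ B)
  (hg : C.gates.length ≤ B)

include hI

theorem val_dim {σ : State} (h : Base B m₀ m₂ σ) : dim.val σ = n := by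
  simp [dim, Expr.val, h.bank0, hI.dim]

theorem val_off {σ : State} (h : Base B m₀ m₂ σ) : off.val σ = 2 + n * n := by
  simp [off, Expr.val, Op.eval, val_dim hI h]

theorem val_num {σ : State} (h : Base B m₀ m₂ σ) : num.val σ = C.gates.length := by
  simp only [num, Expr.val, val_off hI h, h.bank2, hI.num]

theorem val_gateEntry {σ : State} (h : Base B m₀ m₂ σ) {t r : ℕ} (ht : t < C.gates.length)
    (hr : r < 3) (h6 : σ 6 0 = t) :
    (gateEntry r).val σ = (encGate enc C.gates[t]).getD r 0 := by
  simp only [gateEntry, Expr.val, Op.eval, val_off hI h, h.bank2, Expr.val_var, h6,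
    hI.gate t ht r hr]

include hB hp hn

/-- Bank 4 receives the wires, beginning with the input vector. The arbitrary `Q` carries along what
is known about the columns already written to bank 3, which this loop does not touch. -/
theorem tri_load {σ : State} (h : Base B m₀ m₂ σ) (j : Fin n) (h5 : σ 5 0 = j) {Q : (ℕ → ℕ) → Prop}
    (h3 : Q (σ 3)) :
    Tri (.for 6 dim loadBody) σ ((n + 1) * 1 * (loadBody.K + forK dim) * B.size) fun s =>
      Base B m₀ m₂ s ∧ s 5 0 = j ∧ Q (s 3) ∧ ∀ i : Fin n, s 4 i = enc (A i j) := by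
  refine Tri.for_mul (Tri.mono (Tri.for (n := n) (Inv := fun k s => Base B m₀ m₂ s ∧ s 5 0 = j ∧
    Q (s 3) ∧ ∀ i : Fin n, (i : ℕ) < k → s 4 i = enc (A i j)) hB h.bd ?_ ?_ ?_ ?_ ?_) le_rfl ?_)
    le_rfl
  · exact fun _ _ _ h => h.1.bd
  · exact fun _ _ _ h => val_dim hI h.1
  · rintro s k v _ hv ⟨h, h5, h3, h4⟩
    exact ⟨h.write (hv.trans hn) (by decide) (by decide), by rwa [State.write_bank (by decide)],
      by rwa [State.write_bank (by decide)], by rwa [State.write_bank (by decide)]⟩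
  · exact ⟨h, h5, h3, fun i hi => by omega⟩
  · rintro k s hk ⟨h, h5, h3, h4⟩ h6
    rw [one_mul]
    refine Tri.simple (by trivial) hB h.bd ?_
    have hv : (Expr.get 0 (.ix (.const 2) dim (.var 6) (.var 5))).val s = enc (A ⟨k, hk⟩ j) := by
      simp only [Expr.val, Expr.val_ix, Expr.val_var, h6, h5, val_dim hI h, h.bank0]
      exact hI.mat ⟨k, hk⟩ j
    simp only [loadBody, Cmd.exec, hv, Expr.val_var, h6]
    refine ⟨⟨h.write ((enc_lt _).le.trans hp) (by decide) (by decide), ?_, ?_, ?_⟩, ?_⟩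
    · rwa [State.write_bank (by decide)]
    · rwa [State.write_bank (by decide)]
    · intro i hi
      rw [State.write_apply]
      by_cases hik : (i : ℕ) = k
      · obtain rfl : i = ⟨k, hk⟩ := Fin.ext hik
        simp
      · rw [if_neg (by simp [hik]), h4 i (by omega)]
    · rwa [State.write_bank (by decide)]
  · rintro s ⟨h, h5, h3, h4⟩
    exact ⟨h, h5, h3, fun i => h4 i i.2⟩

include hg

theorem tri_gates (hC : C.WellFormed n) {σ : State} (h : Base B m₀ m₂ σ) (j : Fin n)
    (h5 : σ 5 0 = j) {Q : (ℕ → ℕ) → Prop} (h3 : Q (σ 3)) (h4 : ∀ i : Fin n, σ 4 i = enc (A i j)) :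
    Tri (.for 6 num (gateBody enc)) σ
      ((C.gates.length + 1) * 1 * ((gateBody enc).K + forK num) * B.size) fun s =>
      Base B m₀ m₂ s ∧ s 5 0 = j ∧ Q (s 3) ∧ ∀ i < n + C.gates.length,
        s 4 i = enc ((C.wires (List.ofFn fun i => A i j) C.gates.length).getD i 0) := by
  set v := List.ofFn fun i => A i j with hv
  have hvl : v.length = n := by simp [hv]
  refine Tri.for_mul (Tri.for (n := C.gates.length) (Inv := fun t s => Base B m₀ m₂ s ∧
    s 5 0 = j ∧ Q (s 3) ∧ ∀ i < n + t, s 4 i = enc ((C.wires v t).getD i 0)) hB h.bd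
    ?_ ?_ ?_ ?_ ?_) le_rfl
  · exact fun _ _ _ h => h.1.bd
  · exact fun _ _ _ h => val_num hI h.1
  · rintro s k v _ hv ⟨h, h5, h3, h4⟩
    exact ⟨h.write (hv.trans hg) (by decide) (by decide), by rwa [State.write_bank (by decide)],
      by rwa [State.write_bank (by decide)], by rwa [State.write_bank (by decide)]⟩
  · refine ⟨h, h5, h3, fun i hi => ?_⟩
    rw [Circuit.wires_zero, List.getD_eq_getElem _ _ (by omega)]
    simpa [hv] using h4 ⟨i, by omega⟩
  · rintro t s ht ⟨h, h5, h3, h4⟩ h6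
    have hlen := C.length_wires v ht.le
    rw [hvl] at hlen
    rw [one_mul]
    refine Tri.simple (by exact ⟨⟨trivial, trivial⟩, trivial⟩) hB h.bd ?_
    have hstep : (gateBody enc).exec s =
        s.write 4 (n + t) (enc (C.gates[t].eval (C.wires v t))) := by
      have e0 := val_gateEntry hI h ht (r := 0) (by omega) h6
      have e1 := val_gateEntry hI h ht (r := 1) (by omega) h6
      have e2 := val_gateEntry hI h ht (r := 2) (by omega) h6
      -- Well-formedness: the operands of gate `t` are wires whose values are already in bank 4.
      have hw := hC.1 t C.gates[t] (List.getElem?_eq_getElem ht)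
      have epos : (Expr.op .add dim (.var 6)).val s = n + t := by
        simp only [Expr.val, Op.eval, val_dim hI h, Expr.val_var, h6]
      generalize C.gates[t] = g at *
      cases g with
      | const a =>
        simp only [gateBody, Cmd.exec, e0, e1, encGate, epos]
        simp [Gate.eval]
      | add a b =>
        have ha : (Expr.get 4 (gateEntry 1)).val s = enc ((C.wires v t).getD a 0) := by
          simp only [Expr.val, e1]; exact h4 a hw.1
        have hb : (Expr.get 4 (gateEntry 2)).val s = enc ((C.wires v t).getD b 0) := by
          simp only [Expr.val, e2]; exact h4 b hw.2
        simp only [gateBody, Cmd.exec, Expr.val_fop _ ha hb, epos]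
        simp [Expr.val, Op.eval, e0, encGate, Gate.eval]
      | mul a b =>
        have ha : (Expr.get 4 (gateEntry 1)).val s = enc ((C.wires v t).getD a 0) := by
          simp only [Expr.val, e1]; exact h4 a hw.1
        have hb : (Expr.get 4 (gateEntry 2)).val s = enc ((C.wires v t).getD b 0) := by
          simp only [Expr.val, e2]; exact h4 b hw.2
        simp only [gateBody, Cmd.exec, Expr.val_fop _ ha hb, epos]
        simp [Expr.val, Op.eval, e0, encGate, Gate.eval]
    rw [hstep]
    refine ⟨⟨h.write ((enc_lt _).le.trans hp) (by decide) (by decide), ?_, ?_, ?_⟩, ?_⟩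
    · rwa [State.write_bank (by decide)]
    · rwa [State.write_bank (by decide)]
    · intro i hi
      rw [State.write_apply, C.wires_succ v ht]
      by_cases hit : i = n + t
      · rw [if_pos ⟨rfl, hit⟩, List.getD_append_right _ _ _ _ (by omega), hit, hlen]
        simp
      · rw [if_neg (by simp [hit]), List.getD_append _ _ _ _ (by omega)]
        exact h4 i (by omega)
    · rwa [State.write_bank (by decide)]

omit hg in
theorem tri_store (hC : C.Computes R) {σ : State} (h : Base B m₀ m₂ σ) (j : Fin n)
    (h5 : σ 5 0 = j)
    (h0 : σ 3 0 = n ^ 2 + 1) (h1 : σ 3 1 = n)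
    (h3 : ∀ i c : Fin n, c < j → σ 3 (2 + (i * n + c)) = enc ((R * A) i c))
    (h4 : ∀ i < n + C.gates.length,
      σ 4 i = enc ((C.wires (List.ofFn fun i => A i j) C.gates.length).getD i 0)) :
    Tri (.for 6 dim storeBody) σ ((n + 1) * 1 * (storeBody.K + forK dim) * B.size) fun s =>
      Base B m₀ m₂ s ∧ s 5 0 = j ∧ s 3 0 = n ^ 2 + 1 ∧ s 3 1 = n ∧
      ∀ i c : Fin n, c ≤ j → s 3 (2 + (i * n + c)) = enc ((R * A) i c) := by
  refine Tri.for_mul (Tri.mono (Tri.for (n := n) (Inv := fun k s => Base B m₀ m₂ s ∧ s 5 0 = j ∧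
    s 4 = σ 4 ∧ s 3 0 = n ^ 2 + 1 ∧ s 3 1 = n ∧
    ∀ i c : Fin n, (c < j ∨ c = j ∧ (i : ℕ) < k) → s 3 (2 + (i * n + c)) = enc ((R * A) i c))
    hB h.bd ?_ ?_ ?_ ?_ ?_) le_rfl ?_) le_rfl
  · exact fun _ _ _ h => h.1.bd
  · exact fun _ _ _ h => val_dim hI h.1
  · rintro s k v _ hv ⟨h, h5, g4, g0, g1, h3⟩
    refine ⟨h.write (hv.trans hn) (by decide) (by decide), ?_⟩
    rw [State.write_bank (by decide), State.write_bank (by decide), State.write_bank (by decide)]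
    exact ⟨h5, g4, g0, g1, h3⟩
  · refine ⟨h, h5, rfl, h0, h1, fun i c hc => h3 i c ?_⟩
    rcases hc with hc | hc
    · exact hc
    · omega
  · rintro k s hk ⟨h, h5, g4, g0, g1, h3⟩ h6
    rw [one_mul]
    refine Tri.simple (by trivial) hB h.bd ?_
    have hout := hC.length_outs
    have hv : (Expr.get 4 (.get 2 (.op .add (.op .add (.op .add off (.const 1))
        (.op .mul (.const 3) num)) (.var 6)))).val s = enc ((R * A) ⟨k, hk⟩ j) := by
      simp only [Expr.val, Op.eval, val_off hI h, val_num hI h, Expr.val_var, h6, h.bank2,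
        hI.out k (by omega), g4]
      have hlt : C.outs.getD k 0 < n + C.gates.length := by
        rw [List.getD_eq_getElem _ _ (by omega)]
        exact hC.1.2 _ (List.getElem_mem _)
      rw [h4 _ hlt]
      exact congrArg (fun x => ((enc x : Fin _) : ℕ)) (hC.getD_wires (fun i => A i j) ⟨k, hk⟩)
    have hpos : (Expr.ix (.const 2) dim (.var 6) (.var 5)).val s = 2 + (k * n + j) := by
      simp only [Expr.val_ix, Expr.val_var, h6, h5, val_dim hI h, Expr.val]
    simp only [storeBody, Cmd.exec, hv, hpos]
    refine ⟨⟨h.write ((enc_lt _).le.trans hp) (by decide) (by decide), ?_, ?_, ?_, ?_, ?_⟩, ?_⟩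
    · rwa [State.write_bank (by decide)]
    · rwa [State.write_bank (by decide)]
    · rwa [State.write_of_ne' (by omega)]
    · rwa [State.write_of_ne' (by omega)]
    · intro i c hc
      have hix := index_inj (i := i) (i' := k) c.2 j.2
      rw [State.write_apply]
      by_cases hik : (i : ℕ) = k ∧ (c : ℕ) = j
      · obtain rfl : i = ⟨k, hk⟩ := Fin.ext hik.1
        obtain rfl : c = j := Fin.ext hik.2
        simp
      · rw [if_neg]
        · refine h3 i c ?_
          rcases hc with hc | ⟨hc, hc'⟩
          · exact Or.inl hc
          · refine Or.inr ⟨hc, ?_⟩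
            have : (i : ℕ) ≠ k := fun h' => hik ⟨h', by rw [hc]⟩
            omega
        · rintro ⟨-, h'⟩
          exact hik (hix.1 (by omega))
    · rwa [State.write_bank (by decide)]
  · rintro s ⟨h, h5, -, g0, g1, h3⟩
    refine ⟨h, h5, g0, g1, fun i c hc => h3 i c ?_⟩
    rcases hc.lt_or_eq with hc | hc
    · exact Or.inl hc
    · exact Or.inr ⟨hc, i.2⟩

/-- The cost factor of `prog`. -/
def costFactor (enc : F ≃ Fin (Fintype.card F)) : ℕ :=
  (loadBody.K + forK dim) + ((gateBody enc).K + forK num) + (storeBody.K + forK dim)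

/-- Each of the `n` columns of `R * A` is `R` applied to a column of `A` and costs one evaluation of
the circuit. For circuits of near-linear size this multiplies matrices in near-quadratic time. -/
theorem tri_prog (hC : C.Computes R) {σ : State} (h : Base B m₀ m₂ σ)
    (h0 : σ 3 0 = n ^ 2 + 1) (h1 : σ 3 1 = n) :
    Tri (prog enc) σ ((n + 1) * (n + C.gates.length + 1) * (costFactor enc + forK dim) * B.size)
      fun s => Base B m₀ m₂ s ∧ s.read 3 = encMat enc (R * A) := by
  refine Tri.for_mul (Tri.mono (Tri.for (n := n) (Inv := fun k s => Base B m₀ m₂ s ∧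
    s 3 0 = n ^ 2 + 1 ∧ s 3 1 = n ∧
    ∀ i c : Fin n, (c : ℕ) < k → s 3 (2 + (i * n + c)) = enc ((R * A) i c))
    hB h.bd ?_ ?_ ?_ ?_ ?_) le_rfl ?_) (by omega)
  · exact fun _ _ _ h => h.1.bd
  · exact fun _ _ _ h => val_dim hI h.1
  · rintro s k v _ hv ⟨h, g⟩
    refine ⟨h.write (hv.trans hn) (by decide) (by decide), ?_⟩
    rwa [State.write_bank (by decide)]
  · exact ⟨h, h0, h1, fun i c hc => by omega⟩
  · rintro k s hk ⟨h, g0, g1, g3⟩ h5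
    have hstep := Tri.seq (tri_load hI hB hp hn h ⟨k, hk⟩ h5
        (Q := fun m => m 0 = n ^ 2 + 1 ∧ m 1 = n ∧
          ∀ i c : Fin n, (c : ℕ) < k → m (2 + (i * n + c)) = enc ((R * A) i c)) ⟨g0, g1, g3⟩)
      fun s ⟨h, h5, h3, h4⟩ =>
        Tri.seq (tri_gates hI hB hp hn hg hC.1 h ⟨k, hk⟩ h5 (Q := fun m => m 0 = n ^ 2 + 1 ∧
          m 1 = n ∧ ∀ i c : Fin n, (c : ℕ) < k → m (2 + (i * n + c)) = enc ((R * A) i c)) h3 h4)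
          fun s ⟨h, h5, h3, h4⟩ =>
            tri_store hI hB hp hn hC h ⟨k, hk⟩ h5 h3.1 h3.2.1 h3.2.2 h4
    refine Tri.mono hstep ?_ ?_
    · rw [mul_one, mul_one]
      set G := C.gates.length
      have e1 : n + 1 ≤ n + G + 1 := by omega
      have e2 : G + 1 ≤ n + G + 1 := by omega
      calc _ ≤ (n + G + 1) * (loadBody.K + forK dim) * B.size +
            ((n + G + 1) * ((gateBody enc).K + forK num) * B.size +
            (n + G + 1) * (storeBody.K + forK dim) * B.size) := by gcongr
        _ = _ := by rw [costFactor]; ring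
    · rintro s ⟨h, h5, g0, g1, g3⟩
      exact ⟨⟨h, g0, g1, fun i c hc => g3 i c (Nat.lt_succ_iff.1 hc)⟩, h5⟩
  · rintro s ⟨h, g0, g1, g3⟩
    exact ⟨h, State.read_encMat g0 g1 fun i j => g3 i j j.2⟩

end CircProg

end

section

/-! ### Running a determinant algorithm on `R` and on `R * A` -/

theorem PTri.map {α β : Type*} {c : Cmd} {σ : State} {t : ℕ} {ν : PMF α} (g : α → β)
    {Q : β → State → Prop} (h : PTri c σ t ν fun a => Q (g a)) : PTri c σ t (ν.map g) Q := by
  obtain ⟨π, h1, h2, h3⟩ := h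
  refine ⟨π.map fun z => (g z.1, z.2), ?_, ?_, ?_⟩
  · rw [← h1, PMF.map_comp, PMF.map_comp]; rfl
  · rw [PMF.map_comp]; exact h2
  · intro w hw
    obtain ⟨z, hz, rfl⟩ := (PMF.mem_support_map_iff _ _ _).1 hw
    exact h3 z hz

variable {F : Type*} [Field F] [Fintype F] (enc : F ≃ Fin (Fintype.card F))

namespace PairProg

def dim : Expr := .get 0 (.const 1)

/-- `n * n + 1`. -/
def len : Expr := .op .add (.op .mul dim dim) (.const 1)

/-- Call `P` on the matrices in the banks `src` and `3`; the results are in the cells `1` of the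
banks `9` and `10`. -/
def prog (P : Cmd) (e src : ℕ) : Cmd :=
  -- In bank `src` the matrix is followed by further data: the circuit, or the advice. Overwriting
  -- the length in cell 0 with `n ^ 2 + 1` makes the call read the matrix alone.
  .seq (.set src (.const 0) len)
    (.seq (.call P src 9 (dim.budget e)) (.call P 3 10 (dim.budget e)))

/-- The cost factor of `prog`. -/
def costFactor (e src : ℕ) : ℕ :=
  (Cmd.set src (.const 0) len).K + 2 * (1 + (dim.budget e).K)

variable {enc}

theorem tri_prog {P : Cmd} {e : ℕ} {t : ℕ → ℕ} {δ : ∀ n : ℕ, Matrix (Fin n) (Fin n) F → PMF F}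
    (hP : ∀ (n : ℕ) (A : Matrix (Fin n) (Fin n) F),
      RunsOn P (encMat enc A) (t n) ((δ n A).map fun x => [(enc x : ℕ)]))
    {n B : ℕ} (ht : t n ≤ n ^ e + e) (hB : 2 ≤ B) (hp : Fintype.card F ≤ B) (hn : n ^ 2 + 1 ≤ B)
    {R A : Matrix (Fin n) (Fin n) F} {src : ℕ} (hsrc : src = 0 ∨ src = 2) {σ : State}
    (hσ : σ.Bd B) (hd : σ 0 1 = n) (h1 : σ src 1 = n) (hR : σ.Mat enc src 2 R)
    (hRA : σ.read 3 = encMat enc (R * A)) :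
    PTri (prog P e src) σ (costFactor e src * B.size + 2 * t n) (pairLaw (δ n) A R) fun z s =>
      s.Bd B ∧ s 9 1 = enc z.1 ∧ s 10 1 = enc z.2 ∧
      ∀ x j, x ≠ 9 → x ≠ 10 → j ≠ 0 → s x j = σ x j := by
  have hs := one_le_size hB
  have hsrc3 : 3 ≠ src := by omega
  have hbdenc : ∀ {τ : State}, τ.Bd B → ∀ x (y : F), (τ.store x [(enc y : ℕ)]).Bd B :=
    fun hτ x y => hτ.store (by simp; omega) (by
      intro v hv
      obtain rfl := List.mem_singleton.1 hv
      exact (enc_lt _).le.trans hp) x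
  set σ₁ := σ.write src 0 (n ^ 2 + 1) with hσ₁
  have hbd₁ : σ₁.Bd B := hσ.write hn _ _
  have hnz : ∀ x j, j ≠ 0 → σ₁ x j = σ x j := fun x j hj => State.write_of_ne' hj
  have hsim : (prog P e src) = .seq (.set src (.const 0) len)
    (.seq (.call P src 9 (dim.budget e)) (.call P 3 10 (dim.budget e))) := rfl
  rw [hsim]
  have hfirst : Tri (.set src (.const 0) len) σ ((Cmd.set src (.const 0) len).K * B.size)
      fun s => s = σ₁ := by
    refine Tri.simple (by trivial) hB hσ ?_
    simp only [Cmd.exec, len, Expr.val, Op.eval, dim, hd, hσ₁, sq]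
  have hsecond : PTri (.call P src 9 (dim.budget e)) σ₁ ((1 + (dim.budget e).K) * B.size + t n)
      (δ n R) fun x s => s = σ₁.store 9 [(enc x : ℕ)] := by
    have hr : σ₁.read src = encMat enc R := by
      refine State.read_encMat (by simp [hσ₁, State.write_apply]) ?_ fun i j => ?_
      · rw [hnz _ _ (by omega), h1]
      · rw [hnz _ _ (by omega), hR]
    have hc := Expr.cost_le hB hbd₁ (dim.budget e)
    have := RunsOn.call (σ := σ₁) (src := src) (dst := 9) (b := dim.budget e)
      (by rw [hr]; exact hP n R) (by
        simp only [Expr.val_budget, dim, Expr.val]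
        rwa [hnz _ _ (by omega), hd])
    exact this.of_map.mono (by nlinarith) fun _ _ h => h
  have hthird : ∀ x : F, PTri (.call P 3 10 (dim.budget e)) (σ₁.store 9 [(enc x : ℕ)])
      ((1 + (dim.budget e).K) * B.size + t n) (δ n (R * A))
      fun y s => s = (σ₁.store 9 [(enc x : ℕ)]).store 10 [(enc y : ℕ)] := by
    intro x
    set σ₂ := σ₁.store 9 [(enc x : ℕ)] with hσ₂
    have hr : σ₂.read 3 = encMat enc (R * A) := by
      rw [← hRA]
      refine State.read_congr fun j => ?_
      rw [hσ₂, State.store_of_ne (by decide), hσ₁, State.write_of_ne hsrc3]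
    have hc := Expr.cost_le hB (hbdenc hbd₁ 9 x) (dim.budget e)
    have := RunsOn.call (σ := σ₂) (src := 3) (dst := 10) (b := dim.budget e)
      (by rw [hr]; exact hP n (R * A)) (by
        simp only [Expr.val_budget, dim, Expr.val]
        rwa [hσ₂, State.store_of_ne (by decide), hnz _ _ (by omega), hd])
    exact this.of_map.mono (by nlinarith) fun _ _ h => h
  refine (Tri.seq_ptri hfirst (t' := (((1 + (dim.budget e).K) * B.size + t n) +
    ((1 + (dim.budget e).K) * B.size + t n))) (ν := pairLaw (δ n) A R) ?_).mono
    (by simp only [costFactor]; nlinarith) (fun _ _ h => h)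
  rintro s rfl
  refine PTri.seq hsecond ?_
  rintro x - s rfl
  refine PTri.map (fun y => (x, y)) ((hthird x).mono le_rfl ?_)
  rintro y s rfl
  refine ⟨hbdenc (hbdenc hbd₁ 9 x) 10 y, ?_, State.store_same (by simp), ?_⟩
  · rw [State.store_of_ne (by decide)]
    exact State.store_same (by simp)
  · intro x' j h9 h10 hj
    rw [State.store_of_ne h10, State.store_of_ne h9, hnz _ _ hj]

end PairProg

/-! ### Matrix multiplication and the distinguisher -/

namespace DistProg

open PairProg (dim len)

/-- The position of the second matrix. -/
def off : Expr := .op .add (.const 3) (.op .mul dim dim)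

def accBody : Cmd :=
  .setVar 7 (.fop enc (· + ·) (.var 7) (.fop enc (· * ·)
    (.get 0 (.ix (.const 2) dim (.var 6) (.var 8))) (.get 0 (.ix off dim (.var 8) (.var 5)))))

def entryBody : Cmd :=
  .seq (.setVar 7 (.const (enc 0))) (.seq (.for 8 dim (accBody enc))
    (.set 3 (.ix (.const 2) dim (.var 6) (.var 5)) (.var 7)))

/-- Write the product of the two matrices in bank `0` into bank `3`. -/
def mulProg : Cmd :=
  .seq (.seq (.set 3 (.const 0) len) (.set 3 (.const 1) dim))
    (.for 5 dim (.for 6 dim (entryBody enc)))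

open Classical in
/-- Whether the ratio of the two results is `d`. -/
def result : Cmd :=
  .seq (.setVar 11 (.fun₂ enc (fun u v => if u = v then 1 else 0) (.get 10 (.const 1))
    (.fop enc (· * ·) (.get 0 (.op .add off (.op .mul dim dim))) (.get 9 (.const 1)))))
    (.seq (.set 0 (.const 0) (.const 1)) (.set 0 (.const 1) (.var 11)))

def prog (P : Cmd) (e : ℕ) : Cmd :=
  .seq (mulProg enc) (.seq (PairProg.prog P e 0) (result enc))

/-- Bank `0` holds two matrices and a field element. -/
structure Base (B : ℕ) {n : ℕ} (R A : Matrix (Fin n) (Fin n) F) (d : F) (σ : State) : Prop where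
  bd : σ.Bd B
  dim : σ 0 1 = n
  left : σ.Mat enc 0 2 R
  right : σ.Mat enc 0 (3 + n * n) A
  val : σ 0 (3 + n * n + n * n) = enc d

variable {enc}

theorem Base.write {B n : ℕ} {R A : Matrix (Fin n) (Fin n) F} {d : F} {σ : State} (h : Base enc B R A d σ)
    {x i v : ℕ} (hv : v ≤ B) (hx : 0 ≠ x) : Base enc B R A d (σ.write x i v) :=
  ⟨h.bd.write hv _ _, by rw [State.write_of_ne hx, h.dim], h.left.write_of_ne hx,
    h.right.write_of_ne hx, by rw [State.write_of_ne hx, h.val]⟩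

variable {n B : ℕ} {R A : Matrix (Fin n) (Fin n) F} {d : F} (hB : 2 ≤ B) (hp : Fintype.card F ≤ B)
  (hn : n ^ 2 + 1 ≤ B)

include hB hp hn

theorem tri_acc {σ : State} (h : Base enc B R A d σ) (i j : Fin n) (h5 : σ 5 0 = j) (h6 : σ 6 0 = i)
    (h7 : σ 7 0 = enc 0) :
    Tri (.for 8 dim (accBody enc)) σ ((n + 1) * 1 * ((accBody enc).K + forK dim) * B.size) fun s =>
      Base enc B R A d s ∧ s 5 0 = j ∧ s 6 0 = i ∧ s 3 = σ 3 ∧ s 7 0 = enc ((R * A) i j) := by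
  have hnB : n ≤ B := by nlinarith
  refine Tri.for_mul (Tri.mono (Tri.for (n := n) (Inv := fun k s => Base enc B R A d s ∧ s 5 0 = j ∧
    s 6 0 = i ∧ s 3 = σ 3 ∧ s 7 0 = enc (∑ k ∈ Finset.range k,
      if hk : k < n then R i ⟨k, hk⟩ * A ⟨k, hk⟩ j else 0)) hB h.bd ?_ ?_ ?_ ?_ ?_) le_rfl ?_) le_rfl
  · exact fun _ _ _ h => h.1.bd
  · exact fun _ _ _ h => h.1.dim
  · rintro s k v _ hv ⟨h, g⟩
    refine ⟨h.write (hv.trans hnB) (by decide), ?_⟩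
    rwa [State.write_bank (by decide), State.write_bank (by decide), State.write_bank (by decide),
      State.write_bank (by decide)]
  · exact ⟨h, h5, h6, rfl, by simpa using h7⟩
  · rintro k s hk ⟨h, h5, h6, h3, h7⟩ h8
    rw [one_mul]
    refine Tri.simple (by trivial) hB h.bd ?_
    have e1 : (Expr.get 0 (.ix (.const 2) dim (.var 6) (.var 8))).val s = enc (R i ⟨k, hk⟩) := by
      simp only [Expr.val, Expr.val_ix, Expr.val_var, h6, h8, dim, h.dim]
      exact h.left i ⟨k, hk⟩
    have e2 : (Expr.get 0 (.ix off dim (.var 8) (.var 5))).val s = enc (A ⟨k, hk⟩ j) := by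
      simp only [Expr.val, Expr.val_ix, Expr.val_var, h5, h8, off, Op.eval, dim, h.dim]
      exact h.right ⟨k, hk⟩ j
    simp only [accBody, Cmd.exec_setVar]
    rw [Expr.val_fop _ (e₁ := .var 7) h7 (Expr.val_fop _ e1 e2)]
    refine ⟨⟨h.write ((enc_lt _).le.trans hp) (by decide), ?_, ?_, ?_, ?_⟩, ?_⟩
    · rwa [State.write_bank (by decide)]
    · rwa [State.write_bank (by decide)]
    · rwa [State.write_bank (by decide)]
    · simp [State.write_apply, Finset.sum_range_succ, hk]
    · rwa [State.write_bank (by decide)]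
  · rintro s ⟨h, h5, h6, h3, h7⟩
    refine ⟨h, h5, h6, h3, ?_⟩
    rw [h7, Finset.sum_range, Matrix.mul_apply]
    simp

/-- The cost factor of `entryBody`. -/
def entryK (enc : F ≃ Fin (Fintype.card F)) : ℕ :=
  (Cmd.setVar 7 (.const (enc 0))).K + ((accBody enc).K + forK dim) +
    (Cmd.set 3 (.ix (.const 2) dim (.var 6) (.var 5)) (.var 7)).K

theorem tri_entry {σ : State} (h : Base enc B R A d σ) (i j : Fin n) (h5 : σ 5 0 = j)
    (h6 : σ 6 0 = i) {v : ℕ → ℕ} (h3 : σ 3 = v) :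
    Tri (entryBody enc) σ ((n + 1) * entryK enc * B.size) fun s =>
      Base enc B R A d s ∧ s 5 0 = j ∧ s 6 0 = i ∧
      ∀ y, s 3 y = if y = 2 + ((i : ℕ) * n + j) then (enc ((R * A) i j) : ℕ) else v y := by
  have h := Tri.seq (Tri.simple (c := .setVar 7 (.const (enc 0))) trivial hB h.bd
      (Q := fun s => Base enc B R A d s ∧ s 5 0 = j ∧ s 6 0 = i ∧ s 3 = v ∧ s 7 0 = enc 0) ?_)
    fun s ⟨h, h5, h6, h3, h7⟩ => Tri.seq (tri_acc hB hp hn h i j h5 h6 h7)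
      fun s' ⟨h, h5, h6, h3', h7⟩ => Tri.simple
        (c := .set 3 (.ix (.const 2) dim (.var 6) (.var 5)) (.var 7)) trivial hB h.bd
        (Q := fun s => Base enc B R A d s ∧ s 5 0 = j ∧ s 6 0 = i ∧
          ∀ y, s 3 y = if y = 2 + ((i : ℕ) * n + j) then (enc ((R * A) i j) : ℕ) else v y) ?_
  · refine Tri.mono h ?_ fun _ h => h
    have e1 : 1 ≤ n + 1 := by omega
    rw [mul_one]
    calc _ ≤ (n + 1) * (Cmd.setVar 7 (.const (enc 0))).K * B.size +
          ((n + 1) * ((accBody enc).K + forK dim) * B.size +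
          (n + 1) * (Cmd.set 3 (.ix (.const 2) dim (.var 6) (.var 5)) (.var 7)).K * B.size) := by
          gcongr
          · exact Nat.le_mul_of_pos_left _ e1
          · exact Nat.le_mul_of_pos_left _ e1
      _ = _ := by rw [entryK]; ring
  · simp only [Cmd.exec_setVar, Expr.val]
    refine ⟨h.write ((enc_lt _).le.trans hp) (by decide), ?_⟩
    rw [State.write_bank (by decide), State.write_bank (by decide), State.write_bank (by decide)]
    exact ⟨h5, h6, h3, by simp [State.write_apply]⟩
  · have hpos : (Expr.ix (.const 2) dim (.var 6) (.var 5)).val s' = 2 + ((i : ℕ) * n + j) := by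
      simp only [Expr.val_ix, Expr.val_var, h6, h5, Expr.val, dim, h.dim]
    simp only [Cmd.exec, hpos, Expr.val_var, h7]
    refine ⟨h.write ((enc_lt _).le.trans hp) (by decide), ?_, ?_, fun y => ?_⟩
    · rwa [State.write_bank (by decide)]
    · rwa [State.write_bank (by decide)]
    · rw [State.write_apply]
      simp only [true_and, h3', h3]

/-- The cost factor of `mulProg`. -/
def mulK (enc : F ≃ Fin (Fintype.card F)) : ℕ :=
  (Cmd.seq (.set 3 (.const 0) len) (.set 3 (.const 1) dim)).K + (entryK enc + forK dim + forK dim)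

/-- Cubic time is good enough here: the distinguisher has no trapdoor and only needs to be
polynomial. -/
theorem tri_mul {σ : State} (h : Base enc B R A d σ) :
    Tri (mulProg enc) σ ((n + 1) * ((n + 1) * (n + 1)) * mulK enc * B.size) fun s =>
      Base enc B R A d s ∧ s.read 3 = encMat enc (R * A) := by
  have hnB : n ≤ B := by nlinarith
  refine Tri.mono (Tri.seq (R := fun s => Base enc B R A d s ∧ s 3 0 = n ^ 2 + 1 ∧ s 3 1 = n)
    (Tri.simple (by exact ⟨trivial, trivial⟩) hB h.bd ?_) (t' := (n + 1) * ((n + 1) * (n + 1)) *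
    (entryK enc + forK dim + forK dim) * B.size) ?_) ?_ fun _ h => h
  · have e1 : len.val σ = n ^ 2 + 1 := by
      simp [len, Expr.val, Op.eval, dim, h.dim, sq]
    have h' := h.write (x := 3) (i := 0) (v := n ^ 2 + 1) hn (by decide)
    have e2 : dim.val (σ.write 3 0 (n ^ 2 + 1)) = n := h'.dim
    simp only [Cmd.exec, e1, Expr.val, e2]
    refine ⟨h'.write hnB (by decide), ?_, ?_⟩ <;> simp [State.write_apply]
  · rintro s ⟨h, g0, g1⟩
    refine Tri.for_mul (Tri.mono (Tri.for (n := n) (Inv := fun k s => Base enc B R A d s ∧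
      s 3 0 = n ^ 2 + 1 ∧ s 3 1 = n ∧
      ∀ i c : Fin n, (c : ℕ) < k → s 3 (2 + (i * n + c)) = enc ((R * A) i c))
      hB h.bd ?_ ?_ ?_ ?_ ?_) le_rfl ?_) (Nat.mul_pos (by omega) (by omega))
    · exact fun _ _ _ h => h.1.bd
    · exact fun _ _ _ h => h.1.dim
    · rintro s k v _ hv ⟨h, g⟩
      refine ⟨h.write (hv.trans hnB) (by decide), ?_⟩
      rwa [State.write_bank (by decide)]
    · exact ⟨h, g0, g1, fun i c hc => by omega⟩
    · rintro k s hk ⟨h, g0, g1, g3⟩ h5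
      refine Tri.for_mul (Tri.mono (Tri.for (n := n) (Inv := fun r s => Base enc B R A d s ∧
        s 5 0 = k ∧ s 3 0 = n ^ 2 + 1 ∧ s 3 1 = n ∧
        ∀ i c : Fin n, ((c : ℕ) < k ∨ (c : ℕ) = k ∧ (i : ℕ) < r) →
          s 3 (2 + (i * n + c)) = enc ((R * A) i c))
        hB h.bd ?_ ?_ ?_ ?_ ?_) le_rfl ?_) (by omega)
      · exact fun _ _ _ h => h.1.bd
      · exact fun _ _ _ h => h.1.dim
      · rintro s k v _ hv ⟨h, g⟩
        refine ⟨h.write (hv.trans hnB) (by decide), ?_⟩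
        rwa [State.write_bank (by decide), State.write_bank (by decide)]
      · refine ⟨h, h5, g0, g1, fun i c hc => g3 i c ?_⟩
        omega
      · rintro r s hr ⟨h, h5, g0, g1, g3⟩ h6
        refine (tri_entry hB hp hn h ⟨r, hr⟩ ⟨k, hk⟩ h5 h6 rfl).mono le_rfl ?_
        rintro s' ⟨h, h5, h6, h3⟩
        refine ⟨⟨h, h5, ?_, ?_, ?_⟩, h6⟩
        · rw [h3, if_neg (by omega), g0]
        · rw [h3, if_neg (by omega), g1]
        · intro i c hc
          have hix := index_inj (i := i) (i' := r) c.2 hk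
          rw [h3]
          by_cases hik : (i : ℕ) = r ∧ (c : ℕ) = k
          · obtain rfl : i = ⟨r, hr⟩ := Fin.ext hik.1
            obtain rfl : c = ⟨k, hk⟩ := Fin.ext hik.2
            simp
          · rw [if_neg]
            · exact g3 i c (by omega)
            · intro h'
              exact hik (hix.1 (by simp only at h'; omega))
      · rintro s ⟨h, h5, g0, g1, g3⟩
        refine ⟨⟨h, g0, g1, fun i c hc => g3 i c ?_⟩, h5⟩
        have := i.2
        omega
    · rintro s ⟨h, g0, g1, g3⟩
      exact ⟨h, State.read_encMat g0 g1 fun i j => g3 i j j.2⟩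
  · have e1 : 1 ≤ (n + 1) * ((n + 1) * (n + 1)) := Nat.mul_pos (by omega) (by positivity)
    simp only [mulK]
    generalize (n + 1) * ((n + 1) * (n + 1)) = m at *
    generalize (Cmd.seq (.set 3 (.const 0) len) (.set 3 (.const 1) dim)).K = K
    calc _ ≤ m * K * B.size + m * (entryK enc + forK dim + forK dim) * B.size := by
          gcongr
          exact Nat.le_mul_of_pos_left _ e1
      _ = _ := by ring

open Classical in
omit hp hn in
theorem tri_result {σ : State} (hσ : σ.Bd B) (hd : σ 0 1 = n)
    (hval : σ 0 (3 + n * n + n * n) = enc d) {z : F × F} (h9 : σ 9 1 = enc z.1)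
    (h10 : σ 10 1 = enc z.2) :
    Tri (result enc) σ ((result enc).K * B.size) fun s =>
      s.read 0 = [if z.2 = d * z.1 then 1 else 0] := by
  refine Tri.simple (by exact ⟨trivial, trivial, trivial⟩) hB hσ ?_
  have e1 : (Expr.get 0 (.op .add off (.op .mul dim dim))).val σ = enc d := by
    simpa only [Expr.val, Op.eval, off, dim, hd] using hval
  have e2 := Expr.val_fun₂ (fun u v => if u = v then 1 else 0) (e₁ := .get 10 (.const 1)) h10
    (Expr.val_fop (fun x y : F => x * y) (e₂ := .get 9 (.const 1)) e1 h9)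
  refine State.read_eq ?_ fun j hj => ?_
  · simp [result, Cmd.exec, State.write_apply, Expr.val]
  · obtain rfl : j = 0 := by simpa using hj
    simp only [result, Cmd.exec, Cmd.exec_setVar, e2]
    simp [State.write_apply, Expr.val]

end DistProg

variable {enc}

/-- A polynomial-time algorithm that, on input `R` and with advice `A` and `d`, tests whether the
results on `R` and `R * A` have ratio `d`. -/
theorem exists_distinguisher {P : Cmd} {t : ℕ → ℕ}
    {δ : ∀ n : ℕ, Matrix (Fin n) (Fin n) F → PMF F} (ht : PolyB t)
    (hP : ∀ (n : ℕ) (A : Matrix (Fin n) (Fin n) F),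
      RunsOn P (encMat enc A) (t n) ((δ n A).map fun x => [(enc x : ℕ)])) :
    ∃ (Q : Cmd) (k : ℕ), ∀ (n : ℕ) (R A : Matrix (Fin n) (Fin n) F) (d : F),
      RunsOn Q (encMat enc R ++ (encMat enc A ++ [(enc d : ℕ)])) (n ^ k + k)
        ((pairLaw (δ n) A R).map fun z => open Classical in
          [if z.2 = d * z.1 then 1 else 0]) := by
  classical
  obtain ⟨e, he⟩ := ht.exists_pow
  set B : ℕ → ℕ := fun n => 2 * n ^ 2 + 3 + Fintype.card F with hBdef
  set tt : ℕ → ℕ := fun n => (2 * n ^ 2 + 3) * (1 + (B n).size) +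
    ((n + 1) * ((n + 1) * (n + 1)) * DistProg.mulK enc * (B n).size +
      ((PairProg.costFactor e 0 * (B n).size + 2 * t n) +
        (DistProg.result enc).K * (B n).size)) + 2 with htt
  have hBp : PolyB B :=
    (((PolyB.const 2).mul (PolyB.id.pow 2)).add (.const 3)).add (.const (Fintype.card F))
  have h1 : PolyB fun n => n + 1 := PolyB.id.add (.const 1)
  have hpoly : PolyB tt := by
    refine PolyB.add (PolyB.add (PolyB.mul ?_ ((PolyB.const 1).add hBp.size)) (PolyB.add
      (PolyB.mul ((h1.mul (h1.mul h1)).mul (.const _)) hBp.size)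
      (PolyB.add (PolyB.add ((PolyB.const _).mul hBp.size) ((PolyB.const 2).mul ht))
        ((PolyB.const _).mul hBp.size)))) (.const 2)
    exact ((PolyB.const 2).mul (PolyB.id.pow 2)).add (.const 3)
  obtain ⟨k, hk⟩ := hpoly.exists_pow
  refine ⟨DistProg.prog enc P e, k, fun n R A d => ?_⟩
  set l := encMat enc R ++ (encMat enc A ++ [(enc d : ℕ)]) with hl
  have hlen : l.length = 2 * n ^ 2 + 3 := by
    simp only [hl, List.length_append, length_encMat, List.length_singleton]
    ring
  have hB : 2 ≤ B n := by simp only [hBdef]; omega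
  have hp : Fintype.card F ≤ B n := by simp only [hBdef]; omega
  have hn : n ^ 2 + 1 ≤ B n := by simp only [hBdef]; omega
  have hnB : n ≤ B n := by nlinarith
  have hle : ∀ v ∈ l, v ≤ B n := by
    intro v hv
    simp only [hl, List.mem_append, List.mem_singleton] at hv
    rcases hv with hv | hv | rfl
    · exact (mem_encMat_le _ hv).trans (max_le hnB hp)
    · exact (mem_encMat_le _ hv).trans (max_le hnB hp)
    · exact (enc_lt d).le.trans hp
  set σ := State.init l with hσ
  have hget : ∀ j < l.length, σ 0 (j + 1) = l.getD j 0 := fun j hj => State.store_same hj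
  have hbase : DistProg.Base enc (B n) R A d σ := by
    refine ⟨State.Bd.init (by rw [hlen]; simp only [hBdef]; omega) hle, ?_, ?_, ?_, ?_⟩
    · rw [hget 0 (by omega)]
      simp [hl, encMat]
    · refine State.Mat.of_getD (o := 0) hget (fun j hj => ?_) (by omega)
      rw [zero_add, hl, List.getD_append _ _ _ _ (by rw [length_encMat]; omega)]
    · have : 3 + n * n = (n ^ 2 + 1) + 2 := by ring
      rw [this]
      refine State.Mat.of_getD hget (fun j hj => ?_) (by omega)
      rw [hl, List.getD_append_right _ _ _ _ (by rw [length_encMat]; omega), length_encMat,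
        List.getD_append _ _ _ _ (by rw [length_encMat]; omega)]
      congr 1
      omega
    · have : 3 + n * n + n * n = (2 * n ^ 2 + 2) + 1 := by ring
      rw [this, hget _ (by omega), hl,
        List.getD_append_right _ _ _ _ (by rw [length_encMat]; omega),
        List.getD_append_right _ _ _ _ (by simp only [length_encMat]; omega)]
      have e0 : 2 * n ^ 2 + 2 - (encMat enc R).length - (encMat enc A).length = 0 := by
        simp only [length_encMat]; omega
      rw [e0]
      rfl
  have hrun : PTri (DistProg.prog enc P e) σ _ (pairLaw (δ n) A R) fun z s =>
      s.read 0 = [if z.2 = d * z.1 then 1 else 0] :=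
    Tri.seq_ptri (DistProg.tri_mul hB hp hn hbase) fun s ⟨h, hread⟩ =>
      PTri.seq_tri (PairProg.tri_prog hP (he n) hB hp hn (Or.inl rfl) h.bd h.dim h.dim h.left
        hread) fun z _ s' ⟨hbd, h9, h10, hs'⟩ =>
        DistProg.tri_result hB hbd
          (by rw [hs' 0 1 (by decide) (by decide) (by decide), h.dim])
          (by rw [hs' 0 _ (by decide) (by decide) (by omega), h.val]) h9 h10
  refine (hrun.runsOn (u := 2) (fun _ _ _ h => h) fun z _ => ?_).mono ?_
  · split_ifs <;> simp [listCost]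
  · refine le_trans ?_ (hk n)
    have := listCost_le hle
    rw [hlen] at this
    simp only [htt]
    omega

end

section

/-! ### One trial with a trapdoored matrix -/

variable {F : Type*} [Field F] [Fintype F] (enc : F ≃ Fin (Fintype.card F))

theorem length_encGate (g : Gate F) : (encGate enc g).length = 3 := by
  cases g <;> rfl

theorem length_flatten_encGate (l : List (Gate F)) :
    ((l.map (encGate enc)).flatten).length = 3 * l.length := by
  induction l with
  | nil => rfl
  | cons g l ih =>
    rw [List.map_cons, List.flatten_cons, List.length_append, ih, length_encGate,
      List.length_cons]
    ring

theorem getD_flatten_encGate (l : List (Gate F)) (t : ℕ) (ht : t < l.length) {r : ℕ} (hr : r < 3) :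
    ((l.map (encGate enc)).flatten).getD (3 * t + r) 0 = (encGate enc l[t]).getD r 0 := by
  induction l generalizing t with
  | nil => simp at ht
  | cons g l ih =>
    have hg := length_encGate enc g
    rw [List.map_cons, List.flatten_cons]
    cases t with
    | zero =>
      rw [List.getD_append _ _ _ _ (by omega)]
      simp
    | succ t =>
      rw [List.getD_append_right _ _ _ _ (by omega), hg]
      have : 3 * (t + 1) + r - 3 = 3 * t + r := by omega
      rw [this]
      exact ih t (by simpa using ht)

theorem length_encCircuit (C : Circuit F) :
    (encCircuit enc C).length = 1 + 3 * C.gates.length + C.outs.length := by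
  rw [encCircuit, List.length_append, List.length_cons, length_flatten_encGate]
  ring

theorem mem_encCircuit_le {C : Circuit F} {n : ℕ} (hC : C.WellFormed n) {v : ℕ}
    (hv : v ∈ encCircuit enc C) : v ≤ n + C.gates.length + Fintype.card F + 2 := by
  simp only [encCircuit, List.mem_append, List.mem_cons, List.mem_flatten, List.mem_map] at hv
  rcases hv with (rfl | ⟨_, ⟨g, hg, rfl⟩, hv⟩) | hv
  · omega
  · obtain ⟨t, ht, rfl⟩ := List.getElem_of_mem hg
    have hw := hC.1 t _ (List.getElem?_eq_getElem ht)
    generalize C.gates[t] = g at *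
    cases g with
    | const a =>
      have := enc_lt (enc := enc) a
      simp only [encGate, List.mem_cons, List.not_mem_nil, or_false] at hv
      omega
    | add i j =>
      simp only [encGate, List.mem_cons, List.not_mem_nil, or_false] at hv
      simp only [Gate.UsesBelow] at hw
      omega
    | mul i j =>
      simp only [encGate, List.mem_cons, List.not_mem_nil, or_false] at hv
      simp only [Gate.UsesBelow] at hw
      omega
  · have := hC.2 v hv
    omega

/-- The outcome of one trial: a matrix is drawn from `D`, and `pairLaw` is applied. -/
def trialLaw {n : ℕ} (D : PMF (Matrix (Fin n) (Fin n) F × Circuit F))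
    (δ : Matrix (Fin n) (Fin n) F → PMF F) (A : Matrix (Fin n) (Fin n) F) : PMF (F × F) :=
  D.bind fun x => pairLaw δ A x.1

/-! ### The program for one trial -/

namespace TrialProg

open PairProg (dim len)

def query : Cmd := .seq (.set 1 (.const 0) (.const 1)) (.set 1 (.const 1) dim)

def header : Cmd := .seq (.set 3 (.const 0) len) (.set 3 (.const 1) dim)

def output : Cmd :=
  .seq (.set 0 (.const 0) (.const 2))
    (.seq (.set 0 (.const 1) (.get 9 (.const 1))) (.set 0 (.const 2) (.get 10 (.const 1))))

/-- Sample a matrix `R` with a circuit, compute `R * A` by means of the circuit, and call `P` on `R`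
and on `R * A`. -/
def prog (S P : Cmd) (eS e : ℕ) : Cmd :=
  .seq query (.seq (.call S 1 2 (dim.budget eS))
    (.seq (.seq header (CircProg.prog enc)) (.seq (PairProg.prog P e 2) output)))

/-- The cost factor of the parts of `prog` that take few steps. -/
def costFactor (eS e : ℕ) : ℕ :=
  query.K + (1 + (dim.budget eS).K) + header.K + PairProg.costFactor e 2 + output.K

variable {enc}

theorem input {n : ℕ} {σ : State} (A : Matrix (Fin n) (Fin n) F) {R : Matrix (Fin n) (Fin n) F}
    {C : Circuit F} (h0 : σ 0 = State.init (encMat enc A) 0)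
    (h2 : ∀ j < (encMat enc R ++ encCircuit enc C).length,
      σ 2 (j + 1) = (encMat enc R ++ encCircuit enc C).getD j 0) :
    CircProg.Input enc (σ 0) (σ 2) A C := by
  have hlen : (encMat enc R ++ encCircuit enc C).length =
      n * n + 1 + (1 + 3 * C.gates.length + C.outs.length) := by
    rw [List.length_append, length_encMat, length_encCircuit, sq]
  have hshift : ∀ j < 1 + 3 * C.gates.length + C.outs.length,
      σ 2 (2 + n * n + j) = (encCircuit enc C).getD j 0 := by
    intro j hj
    have e : 2 + n * n + j = (n * n + 1 + j) + 1 := by ring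
    rw [e, h2 _ (by omega), List.getD_append_right _ _ _ _ (by rw [length_encMat, sq]; omega),
      length_encMat, sq]
    congr 1
    omega
  refine ⟨?_, ?_, ?_, ?_, ?_⟩
  · rw [h0]; exact State.init_encMat_dim A
  · have : (State.init (encMat enc A)).Mat enc 0 2 A :=
      State.Mat.of_getD (l := encMat enc A) (o := 0) (fun j hj => State.store_same hj)
        (by simp) (by simp [length_encMat])
    intro i j
    rw [h0]
    exact this i j
  · have := hshift 0 (by omega)
    simpa [encCircuit] using this
  · intro t ht r hr
    have := hshift (1 + (3 * t + r)) (by omega)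
    rw [show 2 + n * n + 1 + 3 * t + r = 2 + n * n + (1 + (3 * t + r)) by ring, this, encCircuit,
      List.getD_append _ _ _ _ (by rw [List.length_cons, length_flatten_encGate]; omega),
      add_comm 1, List.getD_cons_succ]
    exact getD_flatten_encGate enc _ t ht hr
  · intro i hi
    have := hshift (1 + 3 * C.gates.length + i) (by omega)
    rw [show 2 + n * n + 1 + 3 * C.gates.length + i = 2 + n * n + (1 + 3 * C.gates.length + i) by
      ring, this, encCircuit,
      List.getD_append_right _ _ _ _ (by rw [List.length_cons, length_flatten_encGate]; omega),
      List.length_cons, length_flatten_encGate]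
    congr 1
    omega

/-- The time consists of one sampling, `n` evaluations of the circuit, two calls of the determinant
algorithm and overhead proportional to the size of the input. The bounds on `tS` and `s` are used at
this `n` only, as they will be available for large `n` only. -/
theorem runsOn_prog {S P : Cmd} {tS t s : ℕ → ℕ} {eS e : ℕ}
    {D : ∀ n : ℕ, PMF (Matrix (Fin n) (Fin n) F × Circuit F)}
    {δ : ∀ n : ℕ, Matrix (Fin n) (Fin n) F → PMF F}
    (hS : ∀ n, RunsOn S [n] (tS n) ((D n).map fun x => encMat enc x.1 ++ encCircuit enc x.2))
    (hcor : ∀ n, ∀ x ∈ (D n).support, x.2.Computes x.1)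
    (hsize : ∀ n, ∀ x ∈ (D n).support, x.2.size ≤ s n)
    (hP : ∀ (n : ℕ) (A : Matrix (Fin n) (Fin n) F),
      RunsOn P (encMat enc A) (t n) ((δ n A).map fun x => [(enc x : ℕ)]))
    {n B : ℕ} (htS : tS n ≤ n ^ eS + eS) (ht : t n ≤ n ^ e + e)
    (hBn : n ^ 2 + 3 * s n + n + Fintype.card F + 5 ≤ B) (A : Matrix (Fin n) (Fin n) F) :
    RunsOn (prog enc S P eS e) (encMat enc A)
      ((n ^ 2 + 3) * (1 + B.size) + (costFactor eS e * B.size + tS n +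
        (n + 1) * (n + s n + 1) * (CircProg.costFactor enc + forK dim) * B.size + 2 * t n))
      ((trialLaw (D n) (δ n) A).map fun z => [(enc z.1 : ℕ), (enc z.2 : ℕ)]) := by
  have hB : 2 ≤ B := by omega
  have hp : Fintype.card F ≤ B := by omega
  have hn2 : n ^ 2 + 1 ≤ B := by omega
  have hn : n ≤ B := by omega
  have hs := one_le_size hB
  set σ₀ := State.init (encMat enc A) with hσ₀
  have hbd₀ : σ₀.Bd B := State.Bd.init (by rw [length_encMat]; omega) fun v hv =>
    (mem_encMat_le A hv).trans (max_le hn hp)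
  have hd₀ : σ₀ 0 1 = n := State.init_encMat_dim A
  have hquery : Tri query σ₀ (query.K * B.size) fun s =>
      s.Bd B ∧ s 0 = σ₀ 0 ∧ s.read 1 = [n] := by
    refine Tri.simple (by exact ⟨trivial, trivial⟩) hB hbd₀ ?_
    have hd₁ : dim.val (σ₀.write 1 0 1) = n := hd₀
    simp only [query, Cmd.exec, Expr.val, hd₁]
    refine ⟨(hbd₀.write (by omega) _ _).write hn _ _, ?_, ?_⟩
    · rw [State.write_bank (by decide), State.write_bank (by decide)]
    · refine State.read_eq (by simp [State.write_apply]) fun j hj => ?_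
      obtain rfl : j = 0 := by simpa using hj
      simp [State.write_apply]
  have hall : PTri (prog enc S P eS e) σ₀ (query.K * B.size + (((1 + (dim.budget eS).K) * B.size +
      tS n) + ((header.K * B.size + (n + 1) * (n + s n + 1) *
        (CircProg.costFactor enc + forK dim) * B.size) +
      ((PairProg.costFactor e 2 * B.size + 2 * t n) + output.K * B.size))))
      (trialLaw (D n) (δ n) A)
      fun z s => s.read 0 = [(enc z.1 : ℕ), (enc z.2 : ℕ)] := by
    refine Tri.seq_ptri hquery ?_
    rintro σ₁ ⟨hbd₁, h01, hread₁⟩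
    have hdim₁ : dim.val σ₁ = n := by
      simp only [dim, Expr.val, h01, hd₀]
    have hcall := RunsOn.call (σ := σ₁) (src := 1) (dst := 2) (b := dim.budget eS)
      (by rw [hread₁]; exact hS n) (by rwa [Expr.val_budget, hdim₁])
    have hc := Expr.cost_le hB hbd₁ (dim.budget eS)
    refine PTri.seq (hcall.of_map.mono (by nlinarith) fun _ _ h => h) ?_
    rintro ⟨R, C⟩ hx σ₂ rfl
    have hC := hcor n _ hx
    have hg : C.gates.length ≤ s n := hsize n _ hx
    simp only at hC
    set l := encMat enc R ++ encCircuit enc C with hl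
    have hbd₂ : (σ₁.store 2 l).Bd B := by
      refine hbd₁.store ?_ ?_ 2
      · rw [hl, List.length_append, length_encMat, length_encCircuit, hC.length_outs]
        omega
      · intro v hv
        rcases List.mem_append.1 hv with hv | hv
        · exact (mem_encMat_le R hv).trans (max_le hn hp)
        · have := mem_encCircuit_le enc hC.1 hv
          omega
    have hm₂ : ∀ j < l.length, σ₁.store 2 l 2 (j + 1) = l.getD j 0 := fun j hj =>
      State.store_same hj
    set m₂ := σ₁.store 2 l 2 with hm₂def
    have hI : CircProg.Input enc (σ₀ 0) m₂ A C := by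
      have h0 : σ₁.store 2 l 0 = State.init (encMat enc A) 0 := by
        rw [State.store_bank (by decide), h01]
      have := input (σ := σ₁.store 2 l) A h0 hm₂
      rwa [h0] at this
    have hdim₂ : ∀ τ : State, τ 0 = σ₀ 0 → dim.val τ = n := fun τ hτ => by
      simp only [dim, Expr.val, hτ, hd₀]
    have hheader : Tri header (σ₁.store 2 l) (header.K * B.size) fun s =>
        CircProg.Base B (σ₀ 0) m₂ s ∧ s 3 0 = n ^ 2 + 1 ∧ s 3 1 = n := by
      refine Tri.simple (by exact ⟨trivial, trivial⟩) hB hbd₂ ?_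
      have b0 : (CircProg.Base B (σ₀ 0) m₂ (σ₁.store 2 l)) :=
        ⟨hbd₂, by rw [State.store_bank (by decide), h01], rfl⟩
      have e1 : len.val (σ₁.store 2 l) = n ^ 2 + 1 := by
        simp only [len, Expr.val, Op.eval, hdim₂ _ b0.bank0, sq]
      have b1 := b0.write (x := 3) (i := 0) hn2 (by decide) (by decide)
      simp only [header, Cmd.exec, e1, Expr.val, hdim₂ _ b1.bank0]
      refine ⟨b1.write hn (by decide) (by decide), ?_, ?_⟩ <;> simp [State.write_apply]
    have hcirc : Tri (.seq header (CircProg.prog enc)) (σ₁.store 2 l)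
        (header.K * B.size + (n + 1) * (n + s n + 1) *
          (CircProg.costFactor enc + forK dim) * B.size) fun s =>
        CircProg.Base B (σ₀ 0) m₂ s ∧ s.read 3 = encMat enc (R * A) := by
      refine Tri.seq hheader ?_
      rintro σ₃ ⟨hb, g0, g1⟩
      refine (CircProg.tri_prog hI hB hp hn (by omega) hC hb g0 g1).mono ?_ fun _ h => h
      change _ ≤ (n + 1) * (n + s n + 1) * (CircProg.costFactor enc + forK CircProg.dim) * B.size
      gcongr
    refine Tri.seq_ptri hcirc ?_
    rintro σ₄ ⟨hb, hread₄⟩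
    have hm1 : σ₄ 2 1 = n := by
      rw [hb.bank2, hm₂ 0 (by rw [hl, List.length_append, length_encMat]; omega)]
      simp [hl, encMat]
    have hmat : σ₄.Mat enc 2 2 R := by
      refine State.Mat.of_getD (l := l) (o := 0) (by rw [hb.bank2]; exact hm₂)
        (fun j hj => ?_) (by rw [hl, List.length_append, length_encMat]; omega)
      rw [zero_add, hl, List.getD_append _ _ _ _ (by rw [length_encMat]; omega)]
    refine PTri.seq_tri (PairProg.tri_prog hP ht hB hp hn2 (Or.inr rfl) hb.bd
      (by rw [hb.bank0, hd₀]) hm1 hmat hread₄) ?_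
    rintro z - σ₅ ⟨hbd₅, h9, h10, -⟩
    refine Tri.simple (by exact ⟨trivial, trivial, trivial⟩) hB hbd₅ ?_
    refine State.read_eq ?_ fun j hj => ?_
    · simp [output, Cmd.exec, State.write_apply, Expr.val]
    · have : j = 0 ∨ j = 1 := by simp at hj; omega
      rcases this with rfl | rfl <;>
        simp [output, Cmd.exec, State.write_apply, Expr.val, h9, h10]
  refine (hall.runsOn (u := 2 * (1 + B.size)) (fun _ _ _ h => h) fun z _ => ?_).mono ?_
  · have h1 := Nat.size_le_size ((enc_lt (enc := enc) z.1).le.trans hp)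
    have h2 := Nat.size_le_size ((enc_lt (enc := enc) z.2).le.trans hp)
    simp only [listCost, List.map_cons, List.map_nil, List.sum_cons, List.sum_nil]
    omega
  · have hin := listCost_le (l := encMat enc A) (B := B) fun v hv =>
      (mem_encMat_le A hv).trans (max_le hn hp)
    rw [length_encMat] at hin
    simp only [costFactor]
    generalize (n + 1) * (n + s n + 1) * (CircProg.costFactor enc + forK dim) * B.size = X
    have e3 : (n ^ 2 + 3) * (1 + B.size) = (n ^ 2 + 1) * (1 + B.size) + 2 * (1 + B.size) := by ring
    rw [e3]
    have e4 : (query.K + (1 + (dim.budget eS).K) + header.K + PairProg.costFactor e 2 + output.K) *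
      B.size = query.K * B.size + (1 + (dim.budget eS).K) * B.size + header.K * B.size +
        PairProg.costFactor e 2 * B.size + output.K * B.size := by ring
    rw [e4]
    omega

end TrialProg

end

section

/-! ### Trapdoored matrices behave like uniform ones -/

variable {F : Type*} [Field F] [Fintype F] {enc : F ≃ Fin (Fintype.card F)}

open Classical in
theorem map_test_apply (p : PMF (F × F)) (d : F) :
    (p.map fun z => [if z.2 = d * z.1 then 1 else 0]) [1] = p.toOuterMeasure (ratioSet d) := by
  rw [← PMF.toOuterMeasure_apply_singleton, PMF.toOuterMeasure_map_apply]
  congr 1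
  ext z
  by_cases h : z.2 = d * z.1 <;> simp [ratioSet, h]

theorem toReal_uniform_bind {n : ℕ} (δ : Matrix (Fin n) (Fin n) F → PMF F)
    (A : Matrix (Fin n) (Fin n) F) (d : F) :
    (((PMF.uniformOfFintype (Matrix (Fin n) (Fin n) F)).bind (pairLaw δ A)).toOuterMeasure
      (ratioSet d)).toReal = ratioProb δ A d := by
  rw [PMF.toOuterMeasure_bind_apply, tsum_fintype, ENNReal.toReal_sum, ratioProb, Finset.sum_div]
  · refine Finset.sum_congr rfl fun R _ => ?_
    rw [PMF.uniformOfFintype_apply, ENNReal.toReal_mul, ENNReal.toReal_inv, ENNReal.toReal_natCast]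
    ring
  · intro R _
    exact ENNReal.mul_ne_top (PMF.apply_ne_top _ _)
      ((toOuterMeasure_le_one _ _).trans_lt ENNReal.one_lt_top).ne

/-- For large `n`, a trapdoored matrix supports every value of the determinant with almost the
probability of a uniformly random matrix. -/
theorem eventually_ratioProb_close {D : ∀ n : ℕ, PMF (Matrix (Fin n) (Fin n) F × Circuit F)}
    (hD : Indistinguishable enc D) {P : Cmd} {t : ℕ → ℕ}
    {δ : ∀ n : ℕ, Matrix (Fin n) (Fin n) F → PMF F} (ht : PolyB t)
    (hP : ∀ (n : ℕ) (A : Matrix (Fin n) (Fin n) F),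
      RunsOn P (encMat enc A) (t n) ((δ n A).map fun x => [(enc x : ℕ)]))
    {η : ℝ} (hη : 0 < η) :
    ∀ᶠ n in atTop, ∀ (A : Matrix (Fin n) (Fin n) F) (d : F),
      |ratioProb (δ n) A d -
        ((trialLaw (D n) (δ n) A).toOuterMeasure (ratioSet d)).toReal| < η := by
  classical
  obtain ⟨Q, k, hQ⟩ := exists_distinguisher ht hP
  let gap : ∀ n : ℕ, Matrix (Fin n) (Fin n) F × F → ℝ := fun n w =>
    |ratioProb (δ n) w.1 w.2 -
      ((trialLaw (D n) (δ n) w.1).toOuterMeasure (ratioSet w.2)).toReal|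
  -- For each `n` the pair of `A` and `d` with the largest gap serves as advice, which makes the
  -- conclusion uniform in `A` and `d`.
  choose w hw using fun n => Finite.exists_max (gap n)
  have h := hD Q (fun n => encMat enc (w n).1 ++ [(enc (w n).2 : ℕ)]) k
    (fun n R => (pairLaw (δ n) (w n).1 R).map fun z => [if z.2 = (w n).2 * z.1 then 1 else 0])
    (fun n R => by convert hQ n R (w n).1 (w n).2)
  -- Of the superpolynomial decay only the exponent 0 is used: the advantage tends to 0.
  have h0 : Tendsto (fun n => gap n (w n)) atTop (nhds 0) := by
    refine (h 0).congr fun n => ?_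
    dsimp only
    rw [pow_zero, one_mul, ← PMF.map_bind _ (pairLaw (δ n) (w n).1),
      ← PMF.map_bind _ fun x : Matrix (Fin n) (Fin n) F × Circuit F => pairLaw (δ n) (w n).1 x.1,
      map_test_apply, map_test_apply, toReal_uniform_bind]
    rfl
  filter_upwards [h0.eventually_lt_const hη] with n hn A d
  exact (hw n (A, d)).trans_lt hn

end

section

/-! ### Repeating the trial and taking the vote -/

variable {F : Type*} [Field F] [Fintype F] (enc : F ≃ Fin (Fintype.card F))

/-! ### The program for the vote -/

namespace VoteProg

open PairProg (dim)

def start : Cmd := .seq (.setVar 1 (.const 0)) (.setVar 2 dim)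

def halve : Cmd :=
  .seq (.setVar 1 (.op .add (.var 1) (.const 1))) (.setVar 2 (.op .div (.var 2) (.const 2)))

def bounds (K : ℕ) : Cmd :=
  .seq (.setVar 3 (.op .mul (.const K) (.var 1))) (.setVar 4 (.const 0))

/-- Cell `d` of bank `7` counts the trials that support the element with code `d`. -/
def countBody : Cmd :=
  open Classical in
  .set 7 (.var 6) (.op .add (.get 7 (.var 6)) (Expr.fun₂ enc (fun y w => if y = w then 1 else 0)
    (.get 5 (.const 2)) (Expr.fop enc (· * ·) (.var 6) (.get 5 (.const 1)))))

def next : Cmd := .setVar 4 (.op .add (.var 4) (.const 1))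

def round (Q : Cmd) (e : ℕ) : Cmd :=
  .seq (.call Q 0 5 (dim.budget e)) (.seq (.for 6 (.const (Fintype.card F)) (countBody enc)) next)

def voteTest (a b : ℕ) : Expr :=
  -- The code of 0 is excluded by the first factor. In the second, the added 1 turns truncated
  -- subtraction into a test of the non-strict inequality: it is nonzero if and only if `a * N ≤ b *
  -- count`.
  .op .mul (.op .sub (.const 1) ((Expr.var 6).isConst (enc 0)))
    (.op .sub (.op .add (.op .mul (.const b) (.get 7 (.var 6))) (.const 1))
      (.op .mul (.const a) (.var 3)))

def voteBody (a b : ℕ) : Cmd := .cond (voteTest enc a b) (.setVar 8 (.var 6)) .skip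

def output : Cmd := .seq (.set 0 (.const 0) (.const 1)) (.set 0 (.const 1) (.var 8))

/-- Call the trial `Q` in `K * n.size` rounds; the vote is described by `decision`. -/
def prog (Q : Cmd) (e K a b : ℕ) : Cmd :=
  .seq (.seq start (.loop (.var 2) halve)) (.seq (bounds K)
    (.seq (.loop (.op .sub (.var 3) (.var 4)) (round enc Q e))
      (.seq (.setVar 8 (.const (enc 0)))
        (.seq (.for 6 (.const (Fintype.card F)) (voteBody enc a b)) output))))

def roundK (e : ℕ) : ℕ :=
  (Expr.op .sub (.var 3) (.var 4)).K + (dim.budget e).K + (Fintype.card F + 1) * ((countBody enc).K +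
    forK (.const (Fintype.card F))) + next.K + 2

def restK (K a b : ℕ) : ℕ :=
  start.K + (bounds K).K + (Cmd.setVar 8 (.const (enc 0))).K + (Fintype.card F + 1) *
    ((voteBody enc a b).K + forK (.const (Fintype.card F))) + output.K

def sizeK : ℕ := 1 + (Expr.var 2).K + halve.K

variable {enc}

section

variable {B : ℕ} (hB : 2 ≤ B) (hp : Fintype.card F ≤ B)

include hB

/-- The number of halvings that bring `n` to 0 is its bit length, which determines the number of
trials. -/
theorem tri_size {n : ℕ} (hn : n ≤ B) {σ : State} (hσ : σ.Bd B) (hd : σ 0 1 = n) :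
    Tri (.seq start (.loop (.var 2) halve)) σ (start.K * B.size + (n.size + 1) * (sizeK * B.size))
      fun s => s.Bd B ∧ s 0 = σ 0 ∧ s 7 = σ 7 ∧ s 1 0 = n.size := by
  have hs := one_le_size hB
  refine Tri.seq (R := fun s => (s.Bd B ∧ s 0 = σ 0 ∧ s 7 = σ 7) ∧ s 1 0 = 0 ∧ s 2 0 = n)
    (Tri.simple (by exact ⟨trivial, trivial⟩) hB hσ ?_) ?_
  · simp only [start, Cmd.exec, Cmd.exec_setVar, Expr.val, dim]
    rw [State.write_of_ne (by decide), hd]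
    exact ⟨⟨(hσ.write (by omega) _ _).write hn _ _,
      by rw [State.write_bank (by decide), State.write_bank (by decide)],
      by rw [State.write_bank (by decide), State.write_bank (by decide)]⟩,
      by simp [State.write_apply], by simp [State.write_apply]⟩
  · rintro s ⟨h, h1, h2⟩
    refine (Tri.loop (Inv := fun k s => (s.Bd B ∧ s 0 = σ 0 ∧ s 7 = σ 7) ∧ s 1 0 = k ∧
      s 2 0 = n / 2 ^ k) (.var 2) n.size (halve.K * B.size) ((Expr.var 2).K * B.size) ?_ ?_
      ⟨h, h1, by simpa using h2⟩).mono ?_ ?_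
    · rintro k s hk ⟨⟨hbd, -, -⟩, -, h2⟩
      refine ⟨?_, Expr.cost_le hB hbd _⟩
      rw [Expr.val_var, h2, Nat.div_eq_zero_iff_lt (by positivity), ← Nat.size_le]
      omega
    · rintro k s hk ⟨⟨hbd, h0, h7⟩, h1, h2⟩
      refine Tri.simple (by exact ⟨trivial, trivial⟩) hB hbd ?_
      have hkn : k + 1 ≤ B := by
        have := size_le_self n
        omega
      simp only [halve, Cmd.exec, Cmd.exec_setVar, Expr.val, Op.eval, Expr.val_var]
      rw [State.write_of_ne (by decide), h1, h2, Nat.div_div_eq_div_mul, ← pow_succ]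
      exact ⟨⟨(hbd.write hkn _ _).write ((Nat.div_le_self _ _).trans hn) _ _,
        by rw [State.write_bank (by decide), State.write_bank (by decide), h0],
        by rw [State.write_bank (by decide), State.write_bank (by decide), h7]⟩,
        by simp [State.write_apply], by simp [State.write_apply]⟩
    · gcongr
      simp only [sizeK]
      nlinarith
    · rintro s ⟨⟨hbd, h0, h7⟩, h1, -⟩
      exact ⟨hbd, h0, h7, h1⟩

include hp

variable (enc) in
/-- The memory after some rounds, with results `l`. -/
structure Counted (B N : ℕ) (m₀ : ℕ → ℕ) (l : List (F × F)) (s : State) : Prop where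
  bd : s.Bd B
  input : s 0 = m₀
  rounds : s 3 0 = N
  counts : ∀ d : F, s 7 (enc d) = hits (ratioSet d) l

theorem tri_count {N k : ℕ} (hN : N + 1 ≤ B) (hk : k < N) {m₀ : ℕ → ℕ} {l : List (F × F)}
    (hl : l.length = k) {s : State} (h : Counted enc B N m₀ l s) (h4 : s 4 0 = k) (z : F × F)
    (h51 : s 5 1 = enc z.1) (h52 : s 5 2 = enc z.2) :
    Tri (.seq (.for 6 (.const (Fintype.card F)) (countBody enc)) next) s
      ((Fintype.card F + 1) * ((countBody enc).K * B.size + forK (.const (Fintype.card F)) * B.size)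
        + next.K * B.size)
      fun s => Counted enc B N m₀ (z :: l) s ∧ s 4 0 = k + 1 := by
  classical
  refine Tri.seq (Tri.for (n := Fintype.card F) (Inv := fun j s => s.Bd B ∧ s 0 = m₀ ∧ s 3 0 = N ∧
    s 4 0 = k ∧ s 5 1 = enc z.1 ∧ s 5 2 = enc z.2 ∧ ∀ d : F, s 7 (enc d) =
      (if (enc d : ℕ) < j then hits (ratioSet d) [z] else 0) + hits (ratioSet d) l)
    hB h.bd (fun j s _ hs => hs.1) (fun j s _ _ => rfl) ?_ ?_ ?_) ?_
  · rintro s j v - hv ⟨hbd, h0, h3, h4, h51, h52, h7⟩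
    refine ⟨hbd.write (hv.trans hp) _ _, by rw [State.write_bank (by decide), h0], ?_, ?_, ?_, ?_, ?_⟩
    · rw [State.write_of_ne (by decide), h3]
    · rw [State.write_of_ne (by decide), h4]
    · rw [State.write_of_ne (by decide), h51]
    · rw [State.write_of_ne (by decide), h52]
    · intro d
      rw [State.write_of_ne (by decide), h7]
  · exact ⟨h.bd, h.input, h.rounds, h4, h51, h52, by simpa using h.counts⟩
  · rintro j s hj ⟨hbd, h0, h3, h4, h51, h52, h7⟩ h6
    refine Tri.simple (by trivial) hB hbd ?_
    obtain ⟨x, rfl⟩ : ∃ x : F, (enc x : ℕ) = j := ⟨enc.symm ⟨j, hj⟩, by simp⟩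
    have hval : (Expr.fun₂ enc (fun y w => if y = w then 1 else 0)
        (.get 5 (.const 2)) (Expr.fop enc (· * ·) (.var 6) (.get 5 (.const 1)))).val s =
          hits (ratioSet x) [z] := by
      have e1 : (Expr.get 5 (.const 1)).val s = enc z.1 := h51
      have e2 : (Expr.get 5 (.const 2)).val s = enc z.2 := h52
      have e3 : (Expr.var 6).val s = enc x := h6
      rw [Expr.val_fun₂ (x := z.2) (y := x * z.1) _ e2 (Expr.val_fop _ e3 e1)]
      simp only [hits, ratioSet, Set.mem_ofPred_eq, add_zero]
      congr
    have h7x : s 7 (enc x) = hits (ratioSet x) l := by simpa using h7 x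
    have hle : hits (ratioSet x) l + hits (ratioSet x) [z] ≤ B := by
      have h1 := hits_le_length (ratioSet x) l
      have h2 := hits_le_length (ratioSet x) [z]
      rw [List.length_singleton] at h2
      omega
    simp only [countBody, Cmd.exec, Expr.val, Op.eval, Expr.val_var, h6, h7x, hval]
    refine ⟨⟨hbd.write hle _ _, by rw [State.write_bank (by decide), h0], ?_, ?_, ?_, ?_, ?_⟩, ?_⟩
    · rw [State.write_of_ne (by decide), h3]
    · rw [State.write_of_ne (by decide), h4]
    · rw [State.write_of_ne (by decide), h51]
    · rw [State.write_of_ne (by decide), h52]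
    · intro d
      rcases eq_or_ne d x with rfl | hd
      · simp [State.write_apply, add_comm]
      · have hne : (enc d : ℕ) ≠ enc x := fun h => hd (enc.injective (Fin.ext h))
        rw [State.write_of_ne' hne, h7]
        congr 1
        have : (enc d : ℕ) < enc x + 1 ↔ (enc d : ℕ) < enc x := by omega
        simp only [this]
    · rw [State.write_of_ne (by decide), h6]
  · rintro s ⟨hbd, h0, h3, h4, -, -, h7⟩
    refine Tri.simple (by trivial) hB hbd ?_
    simp only [next, Cmd.exec_setVar, Expr.val, Op.eval, Expr.val_var, h4]
    refine ⟨⟨hbd.write (by omega) _ _, by rw [State.write_bank (by decide), h0], ?_, ?_⟩, ?_⟩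
    · rw [State.write_of_ne (by decide), h3]
    · intro d
      rw [State.write_of_ne (by decide), h7, if_pos (enc_lt d), hits_cons _ z l]
    · simp [State.write_apply]

/-- Each call starts with fresh memory on the same input, so the outcomes are independent with law
`τ`. The list of outcomes exists only in the coupling; the memory keeps the counts. -/
theorem ptri_rounds {N n tq e : ℕ} (hN : N + 1 ≤ B) {A : Matrix (Fin n) (Fin n) F} {Q : Cmd}
    {τ : PMF (F × F)}
    (hQ : RunsOn Q (encMat enc A) tq (τ.map fun z => [(enc z.1 : ℕ), (enc z.2 : ℕ)]))
    (hq : tq ≤ n ^ e + e) {σ : State}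
    (h : Counted enc B N (State.init (encMat enc A) 0) [] σ) (h4 : σ 4 0 = 0) :
    PTri (.loop (.op .sub (.var 3) (.var 4)) (round enc Q e)) σ
      ((N + 1) * (roundK enc e * B.size + tq)) (trials τ N)
      fun l s => Counted enc B N (State.init (encMat enc A) 0) l s ∧ l.length = N := by
  have hs := one_le_size hB
  refine (PTri.loop (Inv := fun k l s => Counted enc B N (State.init (encMat enc A) 0) l s ∧
    l.length = k ∧ s 4 0 = k) (.op .sub (.var 3) (.var 4)) N
    ((1 + (dim.budget e).K * B.size + tq) + ((Fintype.card F + 1) * ((countBody enc).K * B.size +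
      forK (.const (Fintype.card F)) * B.size) + next.K * B.size))
    ((Expr.op .sub (.var 3) (.var 4)).K * B.size) ?_ ?_ N 0 [] σ (by omega) ⟨h, rfl, h4⟩).mono ?_ ?_
  · rintro k l s hk ⟨hc, -, h4⟩
    refine ⟨?_, Expr.cost_le hB hc.bd _⟩
    simp only [Expr.val, Op.eval, Expr.val_var, h4, hc.rounds]
    omega
  · rintro k l s hk ⟨hc, hl, h4⟩
    have hread : s.read 0 = encMat enc A := by
      rw [State.read_congr (σ' := State.init (encMat enc A)) (x' := 0) fun j => by rw [hc.input]]
      exact State.read_init _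
    have hdim : dim.val s = n := by
      simp only [dim, Expr.val, hc.input]
      exact State.init_encMat_dim A
    have hcall := (RunsOn.call (σ := s) (src := 0) (dst := 5) (b := dim.budget e)
      (by rw [hread]; exact hQ) (by rwa [Expr.val_budget, hdim])).of_map
    have hcost := Expr.cost_le hB hc.bd (dim.budget e)
    refine PTri.map _ (PTri.seq_tri (hcall.mono (by omega) fun _ _ h => h) ?_)
    rintro z - s rfl
    refine (tri_count hB hp hN hk hl ⟨?_, ?_, ?_, ?_⟩ ?_ z ?_ ?_).mono le_rfl
      fun s h => ⟨h.1, by simp [hl], h.2⟩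
    · refine hc.bd.store ?_ ?_ _
      · simp only [List.length_cons, List.length_nil]
        omega
      · intro v hv
        have : v = enc z.1 ∨ v = enc z.2 := by simpa using hv
        rcases this with rfl | rfl <;> exact (enc_lt _).le.trans hp
    · rw [State.store_bank (by decide), hc.input]
    · rw [State.store_of_ne (by decide), hc.rounds]
    · intro d
      rw [State.store_of_ne (by decide), hc.counts]
    · rw [State.store_of_ne (by decide), h4]
    · exact State.store_same (j := 0) (by simp)
    · exact State.store_same (j := 1) (by simp)
  · refine Nat.mul_le_mul_left _ ?_
    simp only [roundK]
    nlinarith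
  · rintro l s ⟨hc, hl, -⟩
    exact ⟨hc, hl⟩

/-- The loop over the codes follows the recursion of `decision`: a later code that passes the test
overrides an earlier one. -/
theorem tri_vote {N a b : ℕ} {m₀ : ℕ → ℕ} {l : List (F × F)}
    {σ : State} (h : Counted enc B N m₀ l σ) (hl : l.length = N) :
    Tri (.seq (.setVar 8 (.const (enc 0)))
        (.seq (.for 6 (.const (Fintype.card F)) (voteBody enc a b)) output)) σ
      ((Cmd.setVar 8 (.const (enc 0))).K * B.size + ((Fintype.card F + 1) * ((voteBody enc a b).K *
        B.size + forK (.const (Fintype.card F)) * B.size) + output.K * B.size))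
      fun s => s.read 0 = [(enc (decision enc a b l (Fintype.card F)) : ℕ)] := by
  classical
  have henc : ∀ x : F, (enc x : ℕ) ≤ B := fun x => (enc_lt x).le.trans hp
  refine Tri.seq (R := fun s => Counted enc B N m₀ l s ∧ s 8 0 = enc (0 : F))
    (Tri.simple (by trivial) hB h.bd ?_) ?_
  · simp only [Cmd.exec_setVar, Expr.val]
    refine ⟨⟨h.bd.write (henc _) _ _, by rw [State.write_bank (by decide), h.input], ?_, ?_⟩, ?_⟩
    · rw [State.write_of_ne (by decide), h.rounds]
    · intro d
      rw [State.write_of_ne (by decide), h.counts]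
    · simp [State.write_apply]
  rintro s ⟨hc, h8⟩
  refine Tri.seq (Tri.for (n := Fintype.card F) (Inv := fun j s => Counted enc B N m₀ l s ∧
    s 8 0 = enc (decision enc a b l j)) hB hc.bd (fun j s _ hs => hs.1.bd) (fun j s _ _ => rfl)
    ?_ ⟨hc, h8⟩ ?_) ?_
  · rintro s j v - hv ⟨hc, h8⟩
    refine ⟨⟨hc.bd.write (hv.trans hp) _ _, by rw [State.write_bank (by decide), hc.input], ?_, ?_⟩,
      by rw [State.write_of_ne (by decide), h8]⟩
    · rw [State.write_of_ne (by decide), hc.rounds]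
    · intro d
      rw [State.write_of_ne (by decide), hc.counts]
  · rintro j s hj ⟨hc, h8⟩ h6
    refine Tri.simple (by exact ⟨trivial, trivial⟩) hB hc.bd ?_
    obtain ⟨x, rfl⟩ : ∃ x : F, (enc x : ℕ) = j := ⟨enc.symm ⟨j, hj⟩, by simp⟩
    have hx0 : (enc x : ℕ) = enc (0 : F) ↔ x = 0 :=
      ⟨fun h => enc.injective (Fin.ext h), fun h => by rw [h]⟩
    have htest : (voteTest enc a b).val s = 0 ↔
        ¬(x ≠ 0 ∧ a * l.length ≤ b * hits (ratioSet x) l) := by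
      simp only [voteTest, Expr.val, Op.eval, Expr.val_var, Expr.val_isConst, h6, hc.rounds,
        hc.counts, hx0, hl]
      by_cases hx : x = 0
      · simp [hx]
      · simp only [hx, if_false, ne_eq, not_false_eq_true, true_and]
        omega
    simp only [decision, decode_enc]
    rw [voteBody, Cmd.exec]
    by_cases hcond : x ≠ 0 ∧ a * l.length ≤ b * hits (ratioSet x) l
    · rw [if_neg (by rwa [htest, not_not]), if_pos hcond, Cmd.exec_setVar, Expr.val_var, h6]
      refine ⟨⟨⟨hc.bd.write (henc _) _ _, by rw [State.write_bank (by decide), hc.input], ?_, ?_⟩,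
        ?_⟩, ?_⟩
      · rw [State.write_of_ne (by decide), hc.rounds]
      · intro d
        rw [State.write_of_ne (by decide), hc.counts]
      · simp [State.write_apply]
      · rw [State.write_of_ne (by decide), h6]
    · rw [if_pos (htest.2 hcond), if_neg hcond]
      exact ⟨⟨hc, h8⟩, h6⟩
  · rintro s ⟨hc, h8⟩
    refine Tri.simple (by exact ⟨trivial, trivial⟩) hB hc.bd ?_
    refine State.read_eq (by simp [output, Cmd.exec, State.write_apply, Expr.val]) fun j hj => ?_
    obtain rfl : j = 0 := by simpa using hj
    simp [output, Cmd.exec, State.write_apply, Expr.val, h8]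

theorem ptri_prog {n tq e K a b : ℕ} (hn : n ^ 2 + 1 ≤ B) (hN : K * n.size + 1 ≤ B)
    {A : Matrix (Fin n) (Fin n) F} {Q : Cmd} {τ : PMF (F × F)}
    (hQ : RunsOn Q (encMat enc A) tq (τ.map fun z => [(enc z.1 : ℕ), (enc z.2 : ℕ)]))
    (hq : tq ≤ n ^ e + e) :
    PTri (prog enc Q e K a b) (State.init (encMat enc A))
      ((n.size + 1) * (sizeK * B.size) + (K * n.size + 1) * (roundK enc e * B.size + tq) +
        restK enc K a b * B.size)
      (trials τ (K * n.size))
      fun l s => s.read 0 = [(enc (decision enc a b l (Fintype.card F)) : ℕ)] := by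
  have hnB : n ≤ B := by nlinarith
  set σ₀ := State.init (encMat enc A) with hσ₀
  have hbd₀ : σ₀.Bd B := State.Bd.init (by rw [length_encMat]; omega) fun v hv =>
    (mem_encMat_le A hv).trans (max_le hnB hp)
  have hstart := tri_size hB hnB hbd₀ (State.init_encMat_dim A)
  have h7₀ : ∀ d, σ₀ 7 d = 0 := fun d => State.store_of_ne (by decide)
  have hbounds : ∀ s : State, s.Bd B ∧ s 0 = σ₀ 0 ∧ s 7 = σ₀ 7 ∧ s 1 0 = n.size →
      Tri (bounds K) s ((bounds K).K * B.size) fun s =>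
        Counted enc B (K * n.size) (σ₀ 0) [] s ∧ s 4 0 = 0 := by
    rintro s ⟨hbd, h0, h7, h1⟩
    refine Tri.simple (by exact ⟨trivial, trivial⟩) hB hbd ?_
    simp only [bounds, Cmd.exec, Cmd.exec_setVar, Expr.val, Op.eval, Expr.val_var, h1]
    refine ⟨⟨(hbd.write (by omega) _ _).write (by omega) _ _, ?_, ?_, fun d => ?_⟩, ?_⟩
    · rw [State.write_bank (by decide), State.write_bank (by decide), h0]
    · simp [State.write_apply]
    · rw [State.write_of_ne (by decide), State.write_of_ne (by decide), h7, h7₀, hits]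
    · simp [State.write_apply]
  refine (Tri.seq_ptri hstart fun s hs => Tri.seq_ptri (hbounds s hs) fun s hs =>
    PTri.seq_tri (ptri_rounds hB hp hN hQ hq hs.1 hs.2) fun l _ s hs =>
      tri_vote hB hp hs.1 hs.2).mono ?_ fun _ _ h => h
  simp only [restK]
  ring_nf
  omega

end

end VoteProg

end

section

/-! ### The reduction -/

variable {F : Type*} [Field F] [Fintype F] (enc : F ≃ Fin (Fintype.card F))

theorem map_enc_apply (p : PMF F) (x : F) :
    (p.map fun x => [(enc x : ℕ)]) [(enc x : ℕ)] = p x := by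
  rw [← PMF.toOuterMeasure_apply_singleton, PMF.toOuterMeasure_map_apply,
    ← PMF.toOuterMeasure_apply_singleton]
  congr 1
  ext y
  simp [Fin.val_inj]

/-- For dimensions below `n₀` the determinant is computed by Gaussian elimination. -/
def mainProg (n₀ : ℕ) (Q : Cmd) (eD e K a b : ℕ) : Cmd :=
  .cond (.op .sub (.const n₀) PairProg.dim)
    (.call (DetProg.prog enc) 0 0 (PairProg.dim.budget eD)) (VoteProg.prog enc Q e K a b)

/-- The time of a trial when sampling takes time `x`, the circuits have size `y`, and the algorithm
for the determinant takes time `z`. -/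
def trialTime (eS e : ℕ) (B : ℕ → ℕ) (x y z n : ℕ) : ℕ :=
  (n ^ 2 + 3) * (1 + (B n).size) + (TrialProg.costFactor eS e * (B n).size + x +
    (n + 1) * (n + y + 1) * (CircProg.costFactor enc + forK PairProg.dim) * (B n).size + 2 * z)

variable {enc}

theorem trialTime_mono {eS e : ℕ} {B : ℕ → ℕ} {x y z x' y' z' : ℕ} (hx : x ≤ x') (hy : y ≤ y')
    (hz : z ≤ z') (n : ℕ) : trialTime enc eS e B x y z n ≤ trialTime enc eS e B x' y' z' n := by
  unfold trialTime
  gcongr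

theorem polyB_trialTime {eS e : ℕ} {B x y z : ℕ → ℕ} (hB : PolyB B) (hx : PolyB x) (hy : PolyB y)
    (hz : PolyB z) : PolyB fun n => trialTime enc eS e B (x n) (y n) (z n) n :=
  (((PolyB.id.pow 2).add (.const 3)).mul ((PolyB.const 1).add hB.size)).add
    (((((PolyB.const _).mul hB.size).add hx).add
      ((((PolyB.id.add (.const 1)).mul ((PolyB.id.add hy).add (.const 1))).mul (.const _)).mul
        hB.size)).add ((PolyB.const 2).mul hz))

/-- Sampling and multiplication take near-quadratic time, and `n ^ 2` is below `T n` because the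
input has to be read. -/
theorem softO_trialTime {eS e : ℕ} {B x y z T : ℕ → ℕ} (hB : PolyB B)
    (hx : SoftO x fun n => n ^ 2) (hy : SoftO y fun n => n) (hz : SoftO z T)
    (hT : ∀ n, n ^ 2 + 1 ≤ T n) :
    SoftO (fun n => trialTime enc eS e B (x n) (y n) (z n) n) T := by
  have h1 : SoftO (fun _ => 1) T := .of_le 1 (.of_forall fun n => by have := hT n; omega)
  have h2 : SoftO (fun n => n ^ 2) T := .of_le 1 (.of_forall fun n => by have := hT n; omega)
  have hs := softO_size hB
  have h3 : SoftO (fun n => n + 1) fun n => n :=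
    .of_le 2 ((eventually_ge_atTop 1).mono fun n hn => by omega)
  have h4 : SoftO (fun n => n + y n + 1) fun n => n :=
    (h3.add hy).mono (.of_forall fun n => by omega)
  have h5 : SoftO (fun n => (n + 1) * (n + y n + 1)) T :=
    (h3.mul h4).trans (h2.mono (.of_forall fun n => by rw [sq]))
  refine ((h2.add ((SoftO.const 3).trans h1)).mul_one ((SoftO.const 1).add hs)).add
    ((((((hs.const_mul _).trans h1).add (hx.trans h2)).add
      ((h5.mul_one (SoftO.const _)).mul_one hs))).add (hz.const_mul 2))

/-- Of the margin `2 * η` available for uniform matrices, one `η` is spent on passing to trapdoored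
ones and the other is left for the tail bounds. -/
theorem decision_bounds {D : ∀ n : ℕ, PMF (Matrix (Fin n) (Fin n) F × Circuit F)}
    {δ : ∀ n : ℕ, Matrix (Fin n) (Fin n) F → PMF F} {n : ℕ} {e θ η : ℝ}
    (hδ : (1 - e) * (Fintype.card (Matrix (Fin n) (Fin n) F) : ℝ) ≤ ∑ R, (δ n R R.det).toReal)
    (hgood : θ + 2 * η ≤ 1 - 2 * e) (hsing : qSing F + e ≤ θ - 2 * η)
    (hne : qSing F + 2 * e ≤ θ - 2 * η ∨ Fintype.card F = 2) {A : Matrix (Fin n) (Fin n) F}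
    (hclose : ∀ d : F, |ratioProb (δ n) A d -
      ((trialLaw (D n) (δ n) A).toOuterMeasure (ratioSet d)).toReal| < η) {d : F} (hd : d ≠ 0) :
    (d = A.det → θ + η ≤ ((trialLaw (D n) (δ n) A).toOuterMeasure (ratioSet d)).toReal) ∧
      (d ≠ A.det → ((trialLaw (D n) (δ n) A).toOuterMeasure (ratioSet d)).toReal ≤ θ - η) := by
  have h := abs_lt.1 (hclose d)
  have hq := singFrac_le (F := F) n
  constructor
  · rintro rfl
    have := ratioProb_det hδ hd
    linarith
  · intro hdA
    by_cases hA : A.det = 0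
    · have := ratioProb_singular hδ hA hd
      linarith
    · rcases hne with hne | hF
      · have := ratioProb_ne hδ hA hdA
        linarith
      -- In a field with two elements, 0, `d` and `A.det` cannot be distinct.
      · classical
        have h3 := Finset.card_le_univ ({0, d, A.det} : Finset F)
        rw [Finset.card_eq_three.2 ⟨0, d, A.det, hd.symm, Ne.symm hA, hdA, rfl⟩, hF] at h3
        omega

/-- The threshold is rational so that the program can compare a fraction of the trials with it in
integer arithmetic. -/
theorem worstCaseDet_of_rat_gap {D : ∀ n : ℕ, PMF (Matrix (Fin n) (Fin n) F × Circuit F)}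
    (hD : IsTrapdooredFamily enc D) {M : Cmd} {T : ℕ → ℕ}
    {ρ : ∀ n : ℕ, Matrix (Fin n) (Fin n) F → PMF (List ℕ)}
    (hM : ∀ (n : ℕ) (A : Matrix (Fin n) (Fin n) F), RunsOn M (encMat enc A) (T n) (ρ n A))
    {e η : ℝ} {a b : ℕ} (hb : 0 < b) (hη : 0 < η) (h0 : η ≤ (a : ℝ) / b)
    (h1 : (a : ℝ) / b + η ≤ 1) (hgood : (a : ℝ) / b + 2 * η ≤ 1 - 2 * e)
    (hsing : qSing F + e ≤ (a : ℝ) / b - 2 * η)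
    (hne : qSing F + 2 * e ≤ (a : ℝ) / b - 2 * η ∨ Fintype.card F = 2)
    (havg : ∀ᶠ n in atTop, 1 - e ≤ avgDetProb enc ρ n) : WorstCaseDet enc T := by
  intro c
  have hT : ∀ n, n ^ 2 + 1 ≤ T n := fun n => by
    have := (length_le_listCost _).trans (hM n 0).listCost_le
    rwa [length_encMat] at this
  obtain ⟨P, t, δ, htB, htT, hP, hle⟩ := exists_clocked hM
  obtain ⟨S, tS, htS, hS⟩ := hD.samplable
  obtain ⟨s, hs, hsize⟩ := hD.efficient
  obtain ⟨K, hK⟩ := exists_decision_bound (enc := enc) hb hη h0 h1 c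
  obtain ⟨eD, heD⟩ := (polyB_detTime (enc := enc)).exists_pow
  obtain ⟨eP, heP⟩ := htB.exists_pow
  obtain ⟨eS, heS⟩ := htS.eventually_le (PolyB.id.pow 2)
  obtain ⟨es, hes⟩ := hs.eventually_le PolyB.id
  set B : ℕ → ℕ := fun n => n ^ 2 + 3 * n ^ es + n + K * n.size + Fintype.card F + 5 with hBdef
  have hBB : PolyB B := (((((PolyB.id.pow 2).add ((PolyB.const 3).mul (PolyB.id.pow es))).add
    PolyB.id).add ((PolyB.const K).mul PolyB.id.size)).add (.const _)).add (.const 5)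
  set tq : ℕ → ℕ := fun n => trialTime enc eS eP B (tS n) (s n) (t n) n with htq
  -- `tS` and `s` are controlled for large `n` only, so the budget of a trial is computed from the
  -- powers that eventually dominate them.
  obtain ⟨eQ, heQ⟩ := (polyB_trialTime (enc := enc) (eS := eS) (e := eP) hBB (PolyB.id.pow eS)
    (PolyB.id.pow es) htB).exists_pow
  -- From `n₀` on, all asymptotic hypotheses hold at once; this constant is built into the program.
  obtain ⟨n₀, hn₀⟩ := eventually_atTop.1
    (((heS.and hes).and havg).and (eventually_ratioProb_close hD.indistinguishable htB hP hη))
  set Q := TrialProg.prog enc S P eS eP with hQdef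
  have hQ : ∀ n ≥ n₀, ∀ A : Matrix (Fin n) (Fin n) F, RunsOn Q (encMat enc A) (tq n)
      ((trialLaw (D n) (δ n) A).map fun z => [(enc z.1 : ℕ), (enc z.2 : ℕ)]) := fun n hn A => by
    have := hn₀ n hn
    exact TrialProg.runsOn_prog hS hD.correct hsize hP (this.1.1.1.trans (Nat.le_add_right _ _))
      (heP n) (by have := this.1.1.2; simp only [hBdef]; omega) A
  have htqQ : ∀ n ≥ n₀, tq n ≤ n ^ eQ + eQ := fun n hn => by
    have := hn₀ n hn
    exact (trialTime_mono this.1.1.1 this.1.1.2 le_rfl n).trans (heQ n)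
  set kc := (Expr.op .sub (.const n₀) PairProg.dim).K with hkc
  set vt : ℕ → ℕ := fun n => (n.size + 1) * (VoteProg.sizeK * (B n).size) +
    (K * n.size + 1) * (VoteProg.roundK enc eQ * (B n).size + tq n) +
      VoteProg.restK enc K a b * (B n).size with hvt
  set bt : ℕ → ℕ := fun n => if n < n₀ then
    1 + (PairProg.dim.budget eD).K * (B n).size + detTime enc n else vt n with hbt
  set law : ∀ n : ℕ, Matrix (Fin n) (Fin n) F → PMF F := fun n A => if n < n₀ then PMF.pure A.det
    else (trials (trialLaw (D n) (δ n) A) (K * n.size)).map fun l =>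
      decision enc a b l (Fintype.card F) with hlaw
  refine ⟨mainProg enc n₀ Q eD eQ K a b,
    fun n => (n ^ 2 + 2) * (1 + (B n).size) + (1 + kc * (B n).size + bt n),
    fun n A => (law n A).map fun x => [(enc x : ℕ)], ?_, ?_, ?_⟩
  · have o1 : SoftO (fun _ => 1) T := .of_le 1 (.of_forall fun n => by have := hT n; omega)
    have o2 : SoftO (fun n => n ^ 2 + 2) T :=
      .of_le 2 (.of_forall fun n => by have := hT n; omega)
    have oB := softO_size hBB
    have on := softO_size PolyB.id
    have otq : SoftO tq T := softO_trialTime hBB htS hs htT hT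
    have ovt : SoftO vt T := ((((on.add (.const 1)).mul_one (oB.const_mul _)).trans o1).add
      ((((oB.const_mul _).trans o1).add otq).mul_one ((on.const_mul K).add (.const 1)) |>.mono
        (.of_forall fun n => (mul_comm _ _).le))).add ((oB.const_mul _).trans o1)
    refine (o2.mul_one ((SoftO.const 1).add oB)).add
      ((((SoftO.const 1).add (oB.const_mul kc)).trans o1).add (ovt.mono ?_))
    filter_upwards [eventually_ge_atTop n₀] with n hn
    simp only [hbt]
    rw [if_neg (by omega)]
  · intro n A
    have hB : 2 ≤ B n := by simp only [hBdef]; omega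
    have hp : Fintype.card F ≤ B n := by simp only [hBdef]; omega
    have hn2 : n ^ 2 + 1 ≤ B n := by simp only [hBdef]; omega
    have hn : n ≤ B n := by simp only [hBdef]; omega
    have hbd₀ : (State.init (encMat enc A)).Bd (B n) :=
      State.Bd.init (by rw [length_encMat]; omega) fun v hv =>
        (mem_encMat_le A hv).trans (max_le hn hp)
    have hdim : PairProg.dim.val (State.init (encMat enc A)) = n := State.init_encMat_dim A
    have hall : PTri (mainProg enc n₀ Q eD eQ K a b) (State.init (encMat enc A))
        (1 + kc * (B n).size + bt n) (law n A) fun x s => s.read 0 = [(enc x : ℕ)] := by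
      have hcost : (Expr.op .sub (.const n₀) PairProg.dim).cost (State.init (encMat enc A)) ≤
          kc * (B n).size := Expr.cost_le hB hbd₀ _
      refine PTri.mono (PTri.cond _ (t := bt n) (fun h => ?_) fun h => ?_) (by omega)
        fun _ _ h => h
      · have hlt : n < n₀ := by
          simp only [Expr.val, Op.eval, hdim] at h
          omega
        simp only [hbt, hlaw, if_pos hlt]
        have hcb := Expr.cost_le hB hbd₀ (PairProg.dim.budget eD)
        have hcall := (RunsOn.call (σ := State.init (encMat enc A)) (src := 0) (dst := 0)
          (b := PairProg.dim.budget eD) (by rw [State.read_init]; exact detProg_runsOn A)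
          (by rw [Expr.val_budget, hdim]; exact heD n)).tri_of_pure
        refine PTri.pure_tri (hcall.mono (by omega) ?_)
        rintro _ rfl
        exact State.read_store _ _ _
      · have hlt : ¬ n < n₀ := by
          simp only [Expr.val, Op.eval, hdim] at h
          omega
        simp only [hbt, hlaw, if_neg hlt]
        refine PTri.map _ (VoteProg.ptri_prog hB hp hn2 (by simp only [hBdef]; omega)
          (hQ n (not_lt.1 hlt) A) (htqQ n (not_lt.1 hlt)))
    refine (hall.runsOn (u := 1 + (B n).size) (fun _ _ _ h => h) fun x _ => ?_).mono ?_
    · have := Nat.size_le_size ((enc_lt (enc := enc) x).le.trans hp)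
      simp only [listCost, List.map_cons, List.map_nil, List.sum_cons, List.sum_nil]
      omega
    · have hin := listCost_le (l := encMat enc A) (B := B n) fun v hv =>
        (mem_encMat_le A hv).trans (max_le hn hp)
      rw [length_encMat] at hin
      nlinarith
  · intro n hn A
    rw [detProb, map_enc_apply]
    by_cases hlt : n < n₀
    · simp only [hlaw, if_pos hlt, PMF.pure_apply_self, ENNReal.toReal_one]
      have : 0 ≤ 1 / (n : ℝ) ^ c := by positivity
      linarith
    · simp only [hlaw, if_neg hlt]
      obtain ⟨⟨-, hav⟩, hclose⟩ := hn₀ n (not_lt.1 hlt)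
      have hδ : (1 - e) * (Fintype.card (Matrix (Fin n) (Fin n) F) : ℝ) ≤
          ∑ R, (δ n R R.det).toReal := by
        -- The clocked algorithm inherits the average success probability of `M`.
        rw [avgDetProb, le_div_iff₀ card_matrix_pos] at hav
        exact hav.trans (Finset.sum_le_sum fun R _ => hle n R)
      exact hK _ _
        (fun d hd => (decision_bounds hδ hgood hsing hne (hclose A) hd).1)
        (fun d hd => (decision_bounds hδ hgood hsing hne (hclose A) hd).2) n hn

/-- An algorithm with average error `e` can be turned into a worst-case algorithm if some threshold
`θ` separates the support of the determinant from the support of the other values. -/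
theorem worstCaseDet_of_gap {D : ∀ n : ℕ, PMF (Matrix (Fin n) (Fin n) F × Circuit F)}
    (hD : IsTrapdooredFamily enc D) {M : Cmd} {T : ℕ → ℕ}
    {ρ : ∀ n : ℕ, Matrix (Fin n) (Fin n) F → PMF (List ℕ)}
    (hM : ∀ (n : ℕ) (A : Matrix (Fin n) (Fin n) F), RunsOn M (encMat enc A) (T n) (ρ n A))
    {e θ : ℝ} (h0 : 0 < θ) (h1 : θ < 1) (hgood : θ < 1 - 2 * e) (hsing : qSing F + e < θ)
    (hne : qSing F + 2 * e < θ ∨ Fintype.card F = 2)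
    (havg : ∀ᶠ n in atTop, 1 - e ≤ avgDetProb enc ρ n) : WorstCaseDet enc T := by
  obtain ⟨η, hη, g0, g1, g2, g3, g4⟩ : ∃ η : ℝ, 0 < η ∧ 4 * η ≤ θ ∧ 4 * η ≤ 1 - θ ∧
      4 * η ≤ 1 - 2 * e - θ ∧ 4 * η ≤ θ - (qSing F + e) ∧
      (4 * η ≤ θ - (qSing F + 2 * e) ∨ Fintype.card F = 2) := by
    obtain ⟨m, hm, k1, k2, k3, k4⟩ : ∃ m : ℝ, 0 < m ∧ m ≤ θ ∧ m ≤ 1 - θ ∧ m ≤ 1 - 2 * e - θ ∧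
        m ≤ θ - (qSing F + e) :=
      ⟨min (min θ (1 - θ)) (min (1 - 2 * e - θ) (θ - (qSing F + e))),
        lt_min (lt_min h0 (by linarith)) (lt_min (by linarith) (by linarith)), by simp, by simp,
        by simp, by simp⟩
    rcases hne with hne | hF
    · refine ⟨min m (θ - (qSing F + 2 * e)) / 4, ?_, ?_, ?_, ?_, ?_, ?_⟩
      · have := lt_min hm (sub_pos.2 hne)
        linarith
      all_goals have := min_le_left m (θ - (qSing F + 2 * e))
      · linarith
      · linarith
      · linarith
      · linarith
      · have := min_le_right m (θ - (qSing F + 2 * e))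
        exact Or.inl (by linarith)
    · exact ⟨m / 4, by linarith, by linarith, by linarith, by linarith, by linarith, Or.inr hF⟩
  -- Moving the threshold up by less than `η` leaves at least `3 * η` of the margin `4 * η` on the
  -- upper side, and costs nothing on the lower.
  obtain ⟨r, hr1, hr2⟩ := exists_rat_btwn (show θ < θ + η by linarith)
  have hr0 : (0 : ℝ) < r := h0.trans hr1
  have hr : (r.num.toNat : ℝ) / r.den = r := by
    have hnum : 0 ≤ r.num := Rat.num_nonneg.2 (by exact_mod_cast hr0.le)
    have : ((r.num.toNat : ℤ) : ℝ) = r.num := by rw [Int.toNat_of_nonneg hnum]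
    rw [Rat.cast_def, ← this, Int.cast_natCast]
  exact worstCaseDet_of_rat_gap hD hM (a := r.num.toNat) (b := r.den) (η := η) (e := e) r.den_pos hη
    (by rw [hr]; linarith) (by rw [hr]; linarith) (by rw [hr]; linarith) (by rw [hr]; linarith)
    (by rw [hr]; exact g4.imp_left fun h => by linarith) havg

end

end DetRed
end

/-! ### The choice of thresholds -/

theorem mainTheorem8 {F : Type*} [Field F] [Fintype F] (enc : F ≃ Fin (Fintype.card F))
    (hfam : ∃ D : ∀ n : ℕ, PMF (Matrix (Fin n) (Fin n) F × DetRed.Circuit F),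
      DetRed.IsTrapdooredFamily enc D)
    (M : DetRed.Cmd) (T : ℕ → ℕ)
    (ρ : ∀ n : ℕ, Matrix (Fin n) (Fin n) F → PMF (List ℕ))
    (hM : ∀ (n : ℕ) (A : Matrix (Fin n) (Fin n) F),
      DetRed.RunsOn M (DetRed.encMat enc A) (T n) (ρ n A)) :
    ((∀ᶠ n in atTop, (0.99 : ℝ) ≤ DetRed.avgDetProb enc ρ n) →
      DetRed.WorstCaseDet enc T) ∧
    (2 < Fintype.card F → ∀ ε : ℝ, 0 < ε →
      (∀ᶠ n in atTop, (3 + 2 * DetRed.qSing F) / 4 + ε ≤ DetRed.avgDetProb enc ρ n) →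
      DetRed.WorstCaseDet enc T) ∧
    (Fintype.card F = 2 → ∀ ε : ℝ, 0 < ε →
      (∀ᶠ n in atTop, (2 + DetRed.qSing F) / 3 + ε ≤ DetRed.avgDetProb enc ρ n) →
      DetRed.WorstCaseDet enc T) := by
  obtain ⟨D, hD⟩ := hfam
  have hq0 := DetRed.qSing_nonneg (F := F)
  have hq1 := DetRed.qSing_le (F := F)
  refine ⟨fun h => ?_, fun _ ε hε h => ?_, fun hF ε hε h => ?_⟩
  -- As `q ≤ 3/4` over every finite field, `q + 2 * e ≤ 0.77 < 0.9 < 0.98 = 1 - 2 * e`.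
  · exact DetRed.worstCaseDet_of_gap hD hM (e := 0.01) (θ := 0.9) (by norm_num) (by norm_num)
      (by norm_num) (by norm_num; linarith) (Or.inl (by norm_num; linarith))
      (h.mono fun n hn => by norm_num at hn ⊢; linarith)
  -- Here `q + 2 * e = 1/2 - 2 * ε` and `1 - 2 * e = 1/2 + q + 2 * ε`; `θ` is their midpoint.
  · exact DetRed.worstCaseDet_of_gap hD hM (e := (1 - 2 * DetRed.qSing F) / 4 - ε)
      (θ := (1 + DetRed.qSing F) / 2) (by linarith) (by linarith) (by linarith) (by linarith)
      (Or.inl (by linarith)) (h.mono fun n hn => by linarith)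
  -- Only `q + e < θ < 1 - 2 * e` is needed; at `ε = 0` both ends equal `(1 + 2 * q) / 3`, which is
  -- taken as `θ`.
  · exact DetRed.worstCaseDet_of_gap hD hM (e := (1 - DetRed.qSing F) / 3 - ε)
      (θ := (1 + 2 * DetRed.qSing F) / 3) (by linarith) (by linarith) (by linarith) (by linarith)
      (Or.inr hF) (h.mono fun n hn => by linarith)
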